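/- **Setting.** Let $(X,A,D,Y^*)\sim P$ with $X\in\mathcal X$, protected attribute $A\in\{0,1\}$, decision $D\in\{0,1\}$ and outcome $Y^*\in[0,1]$, and let $(X_i,A_i,D_i,Y_i^*)$, $i\le n$, be i.i.d. draws from $P$; $Y_i^*$ is observed only if $D_i=1$. Assume selection on observables, $D\perp Y^*\mid X$, and positivity, $\mathbb P(D=1\mid X)>0$ almost surely. Let $\mu(x)=\mathbb E[Y^*\mid X=x]$. Let $\mathcal F$ be a class of measurable $f:\mathcal X\to[0,1]$, $\Delta(\mathcal F)$ the (countably supported) distributions on $\mathcal F$, $l:[0,1]^2\to[0,1]$ a loss that is 1-Lipschitz in the $\ell_1$-norm, and $\epsilon\ge 0$. Put $\operatorname{loss}_\mu(f)=\mathbb E[l(\mu(X),f(X))]$, and $$\operatorname{disparity}(f)=\sum_{a\in\{0,1\}}\beta_a\,\frac{\mathbb E[g(X,\mu(X))f(X)\mid\mathcal E_a]}{\mathbb E[g(X,\mu(X))\mid\mathcal E_a]},\qquad \mathcal E_a=\{A\in S_a\},\ S_a\subseteq\{0,1\},$$ with a measurable weight $g$ with values in $[0,1]$, where $\mathbb E[g(X,\mu(X))\mid\mathcal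 E_a]\ge\omega>0$ whenever $\beta_a\ne0$; both are extended linearly to $Q\in\Delta(\mathcal F)$. Call $\tilde Q\in\Delta(\mathcal F)$ feasible if $\operatorname{loss}_\mu(\tilde Q)\le\epsilon$; the problem is to minimize $|\operatorname{disparity}(Q)|$ over feasible $Q$. Let $n_a$ be the number of $i\le n$ with $A_i\in S_a$. **Discretization.** Let $\alpha=1/N$, $h_f(x,z)=1\{f(x)\ge z\}$ for $z\in[0,1]$, $\mathcal H=\{h_f:f\in\mathcal F\}$, and let $Z$ be uniform on $\{j\alpha:1\le j\le N\}$. Fix a finite subset of $[0,1]$ that is an $\frac\alpha2$-cover of the values of $\mu$, and let $\underline y$ be its smallest element within $\frac\alpha2$ of $y$. Let $c(y,z)=N\,(l(y,z+\frac\alpha2)-l(y,z-\frac\alpha2))$ (with $z+\frac\alpha2$ replaced by $1$ if it exceeds $1$), $\widehat{\operatorname{cost}}(h)=\frac1n\sum_i\mathbb E_Z[c(\underline{\mu(X_i)},Z)h(X_i,Z)]$, $\hat c_0=\frac1n\sum_i l(\underline{\mu(X_i)},\frac\alpha2)$, and let $\widehat{\operatorname{disparity}}(h)$ be the sample analogue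 of $\operatorname{disparity}$ with $\mathbb E_Z[h(X_i,Z)]$ for $f(X_i)$. **Algorithm** (input: data $(X_i,A_i,\mu(X_i))_{i\le n}$). With constraint vector $v(\xi,h)=(\widehat{\operatorname{disparity}}(h)-\xi,\,-\widehat{\operatorname{disparity}}(h)-\xi,\,\widehat{\operatorname{cost}}(h)-\hat\epsilon)$ let $L(\xi,h,\lambda)=\xi+\lambda\cdot v(\xi,h)$ for $\xi\in[0,B_\xi]$, $\lambda=(\lambda_+,\lambda_-,\lambda_{\rm cost})\ge0$, $\|\lambda\|_1\le B_\lambda$, extended linearly to distributions over $\mathcal H$. Start at $\theta_1=0\in\mathbb R^3$. In iteration $t$ put $\lambda_{t,k}=B_\lambda e^{\theta_{t,k}}/(1+\sum_{k'}e^{\theta_{t,k'}})$; let $(\xi_t,h_t)$ be an exact best response to $\lambda_t$ ($h_t$ from a best-response oracle); form the averages $\hat\xi_t,\hat\lambda_t$ and the uniform distribution $\hat Q_t$ on $h_1,\dots,h_t$. Stop if $(\hat\xi_t,\hat Q_t,\hat\lambda_t)$ is a $\nu$-approximate saddle point of $L$; then return $\hat Q_t$ if $\widehat{\operatorname{cost}}(\hat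 Q_t)\le\hat\epsilon+(B_\xi+2\nu)/B_\lambda$ and $null$ otherwise. If not stopped, $\theta_{t+1}=\theta_t+\eta\,v(\xi_t,h_t)$, with $\eta=\nu/(2\rho^2B_\lambda)$, $\rho=\sup_{f\in\mathcal F,\,\xi\in[0,B_\xi]}\|v(\xi,h_f)\|_\infty$. Here $B_\xi>0$ is a constant with $|\beta_0u+\beta_1v|\le B_\xi$ for all $u,v\in[0,1]$. **Theorem.** Suppose that, for constants $C>0$ and $0<\phi\le 1/2$, the Rademacher complexity satisfies $R_m(\mathcal H)\le Cm^{-\phi}$ for all $m\ge1$, and that $\mathcal F$ has a countable subclass such that for every cutoff $z\in[0,1]$ each $h_f(\cdot,z)$, $f\in\mathcal F$, is a pointwise limit of classifiers $h_{f'}(\cdot,z)$ with $f'$ in the subclass. Let $\hat\epsilon=\epsilon-\hat c_0+C'n^{-\phi}-C''n^{-1/2}$ with $$C'\ge 2C+2+\sqrt{2\ln(8N/\delta)},\qquad C''\ge\sqrt{-\ln(\delta/8)/2},\qquad 0<\delta<1,$$ and let $\nu=c_\nu n^{-\phi}$, $B_\lambda=c_Bn^{\phi}$, $c_Nn^{\phi}\le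 N\le c_N'n^{\phi}$ with positive constants. There are $K$, $p$ and a function $n_*(\delta,C'')$, which depend only on $\epsilon,\beta,B_\xi,C,\phi,\omega,c_\nu,c_B,c_N,c_N'$, such that the following holds, where $\tilde O(m^{-\phi})$ stands for $K(1+\ln n+\ln(1/\delta))^p\,m^{-\phi}$. (i) On every sample the algorithm terminates, in at most $K(1+C'n^{-\phi}+C''n^{-1/2})^2\,n^{4\phi}$ iterations, i.e. in $O(n^{4\phi})$ iterations. (ii) If $n\ge n_*(\delta,C'')$, or if $C'\ge C''+n^\phi/N+\sqrt{-\ln(\delta/8)/2}$, then with probability at least $1-\delta$ the returned $\hat Q_h$, viewed as a distribution over $\mathcal F$, satisfies one of the following: 1) $\hat Q_h\neq null$, $\operatorname{loss}_\mu(\hat Q_h)\le\epsilon+C'\,\tilde O(n^{-\phi})$, and, if $n_a>0$ for each $a$ with $\beta_a\neq0$, then $|\operatorname{disparity}(\hat Q_h)|\le|\operatorname{disparity}(\tilde Q)|+\tilde O(n_0^{-\phi})+\tilde O(n_1^{-\phi})$ for every feasible $\tilde Q$ (a term with $n_a=0$ is omitted); or 2) $\hat Q_h=null$ and the problem is infeasible.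 (iii) For $g=1$, $\operatorname{disparity}(Q)$ is $\beta_0\mathbb E[f(X)\mid\mathcal E_0]+\beta_1\mathbb E[f(X)\mid\mathcal E_1]$ averaged over $f\sim Q$. If $Y^*\in\{0,1\}$ almost surely and $A\perp Y^*\mid X$ (for instance, if $A$ is a function of $X$), then $g=\mu$ and $g=1-\mu$ give the same expression with conditioning events $\{Y^*=1,A\in S_a\}$ and $\{Y^*=0,A\in S_a\}$. If $l(\cdot,u)$ is convex for every $u$, then $\operatorname{loss}_\mu(Q)\le\mathbb E[l(Y^*,f(X))]$ averaged over $f\sim Q$, so that every $\tilde Q$ feasible for the true loss is feasible for $\operatorname{loss}_\mu$. -/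

import Mathlib

open MeasureTheory ProbabilityTheory

noncomputable section

namespace FairRashomon

/-! ### The population -/

/-- One draw `(X, A, D, Y*)`: features, protected attribute in `{0,1}`, binary decision
(`true` means `D = 1`, i.e. the outcome is observed), and outcome. -/
abbrev Obs (𝒳 : Type*) := 𝒳 × Fin 2 × Bool × ℝ

def featX {𝒳 : Type*} (o : Obs 𝒳) : 𝒳 := o.1
def attrA {𝒳 : Type*} (o : Obs 𝒳) : Fin 2 := o.2.1
def decD {𝒳 : Type*} (o : Obs 𝒳) : Bool := o.2.2.1
def outY {𝒳 : Type*} (o : Obs 𝒳) : ℝ := o.2.2.2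

/-- The σ-algebra generated by the features `X`. -/
abbrev sigmaX (𝒳 : Type*) [MeasurableSpace 𝒳] : MeasurableSpace (Obs 𝒳) :=
  MeasurableSpace.comap featX inferInstance

/-- `U` and `V` are conditionally independent given `X`. -/
def CondIndepGivenX {𝒳 : Type*} [MeasurableSpace 𝒳] (P : Measure (Obs 𝒳))
    {α γ : Type*} [MeasurableSpace α] [MeasurableSpace γ]
    (U : Obs 𝒳 → α) (V : Obs 𝒳 → γ) : Prop :=
  ∀ (s : Set α) (t : Set γ), MeasurableSet s → MeasurableSet t →
    P[(U ⁻¹' s ∩ V ⁻¹' t).indicator (fun _ => (1 : ℝ)) | sigmaX 𝒳] =ᵐ[P]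
      P[(U ⁻¹' s).indicator (fun _ => (1 : ℝ)) | sigmaX 𝒳] *
        P[(V ⁻¹' t).indicator (fun _ => (1 : ℝ)) | sigmaX 𝒳]

/-- Selection on observables: `D ⫫ Y* | X`. -/
def SelectionOnObservables {𝒳 : Type*} [MeasurableSpace 𝒳] (P : Measure (Obs 𝒳)) : Prop :=
  CondIndepGivenX P decD outY

/-- Positivity: `P(D = 1 | X) > 0` with probability one. -/
def Positivity {𝒳 : Type*} [MeasurableSpace 𝒳] (P : Measure (Obs 𝒳)) : Prop :=
  ∀ᵐ o ∂P, 0 < (P[(decD ⁻¹' {true}).indicator (fun _ => (1 : ℝ)) | sigmaX 𝒳]) o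

/-- `μ` is (a `[0,1]`-valued measurable version of) the regression function
`μ(x) = E[Y* | X = x]`. -/
structure IsRegression {𝒳 : Type*} [MeasurableSpace 𝒳] (P : Measure (Obs 𝒳))
    (μ : 𝒳 → ℝ) : Prop where
  measurable : Measurable μ
  mem_Icc : ∀ x, μ x ∈ Set.Icc (0 : ℝ) 1
  ae_eq : (fun o : Obs 𝒳 => μ (featX o)) =ᵐ[P] P[outY | sigmaX 𝒳]

/-! ### Loss and disparity of prediction functions and of randomized prediction functions -/

/-- `loss(f) = E[l(Y*, f(X))]`. -/
def loss {𝒳 : Type*} [MeasurableSpace 𝒳] (P : Measure (Obs 𝒳)) (l : ℝ → ℝ → ℝ)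
    (f : 𝒳 → ℝ) : ℝ :=
  ∫ o, l (outY o) (f (featX o)) ∂P

/-- `loss_μ(f) = E[l(μ(X), f(X))]`. -/
def lossMu {𝒳 : Type*} [MeasurableSpace 𝒳] (P : Measure (Obs 𝒳)) (μ : 𝒳 → ℝ)
    (l : ℝ → ℝ → ℝ) (f : 𝒳 → ℝ) : ℝ :=
  ∫ o, l (μ (featX o)) (f (featX o)) ∂P

/-- `disparity(f) = β₀ E[f(X) | E₀] + β₁ E[f(X) | E₁]` for conditioning events `E₀, E₁`. -/
def disparityOn {𝒳 : Type*} [MeasurableSpace 𝒳] (P : Measure (Obs 𝒳))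
    (E : Fin 2 → Set (Obs 𝒳)) (β : Fin 2 → ℝ) (f : 𝒳 → ℝ) : ℝ :=
  ∑ a, β a * ∫ o, f (featX o) ∂P[|E a]

/-- The predictive disparity under selective labels:
`∑ₐ βₐ E[g f(X) | Eₐ] / E[g | Eₐ]` with `g = g(X, μ(X))` and `Eₐ = {A ∈ Sₐ}`. -/
def disparity {𝒳 : Type*} [MeasurableSpace 𝒳] (P : Measure (Obs 𝒳)) (μ : 𝒳 → ℝ)
    (g : 𝒳 → ℝ → ℝ) (S : Fin 2 → Set (Fin 2)) (β : Fin 2 → ℝ) (f : 𝒳 → ℝ) : ℝ :=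
  ∑ a, β a *
    ((∫ o, g (featX o) (μ (featX o)) * f (featX o) ∂P[|attrA ⁻¹' S a]) /
      ∫ o, g (featX o) (μ (featX o)) ∂P[|attrA ⁻¹' S a])

/-- The average `∑_f Q(f) v(f)` of `v` under a distribution `Q ∈ Δ(ℱ)`. -/
def mix {ι : Type*} (Q : PMF ι) (v : ι → ℝ) : ℝ := ∑' f, (Q f).toReal * v f

/-! ### Threshold classifiers and Rademacher complexity -/

/-- `h_f(x, z) = 1{f(x) ≥ z}`. -/
def thr {𝒳 : Type*} (f : 𝒳 → ℝ) (x : 𝒳) (z : ℝ) : ℝ :=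
  open Classical in if z ≤ f x then 1 else 0

/-- `ℋ = {h_f : f ∈ ℱ}`, as functions on `𝒳 × [0,1]`. -/
def thrClass {𝒳 : Type*} (ℱ : Set (𝒳 → ℝ)) : Set (𝒳 × Set.Icc (0 : ℝ) 1 → ℝ) :=
  (fun f u => thr f u.1 u.2) '' ℱ

/-- `R_n(𝒢) = sup_{u₁,…,uₙ} E_σ sup_{g ∈ 𝒢} |n⁻¹ ∑ᵢ σᵢ g(uᵢ)|`, with independent uniform
signs `σᵢ`. -/
def rademacher {U : Type*} (𝒢 : Set (U → ℝ)) (n : ℕ) : ℝ :=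
  ⨆ u : Fin n → U, (1 / (2 : ℝ) ^ n) * ∑ σ : Fin n → Bool,
    ⨆ g : 𝒢, |(1 / (n : ℝ)) * ∑ i, (if σ i then (1 : ℝ) else -1) * (g : U → ℝ) (u i)|

/-- Measurability condition for suprema over `ℱ`: at every cutoff the threshold classifiers
are pointwise limits of those from one countable subclass (trivial for countable `ℱ`). -/
def PointwiseMeasurable {𝒳 : Type*} (ℱ : Set (𝒳 → ℝ)) : Prop :=
  ∃ 𝒢 ⊆ ℱ, 𝒢.Countable ∧ ∀ f ∈ ℱ, ∀ z ∈ Set.Icc (0 : ℝ) 1,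
    ∃ G : ℕ → 𝒳 → ℝ, (∀ k, G k ∈ 𝒢) ∧
      ∀ x, ∀ᶠ k in Filter.atTop, (z ≤ G k x ↔ z ≤ f x)

/-! ### Discretization and empirical quantities -/

/-- The smallest element of the cover within distance `1/(2N)` of `y`. -/
def lowerY (N : ℕ) (cover : Finset ℝ) (y : ℝ) : ℝ :=
  sInf {t : ℝ | t ∈ cover ∧ |y - t| ≤ 1 / (2 * (N : ℝ))}

/-- `c(y, z) = N (l(y, z + α/2) - l(y, z - α/2))` with `α = 1/N`. The prediction argument
`z + α/2` exceeds `1` for the last grid point only; it is then read as `1`. -/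
def costWeight (l : ℝ → ℝ → ℝ) (N : ℕ) (y z : ℝ) : ℝ :=
  (N : ℝ) * (l y (min (z + 1 / (2 * (N : ℝ))) 1) - l y (z - 1 / (2 * (N : ℝ))))

/-- Empirical version of the constant `c₀ = E[l(y̲, α/2)]`, for data `(Xᵢ, Aᵢ, yᵢ)`. -/
def c0Hat {𝒳 : Type*} {n : ℕ} (l : ℝ → ℝ → ℝ) (N : ℕ) (cover : Finset ℝ)
    (data : Fin n → 𝒳 × Fin 2 × ℝ) : ℝ :=
  (1 / (n : ℝ)) * ∑ i, l (lowerY N cover (data i).2.2) (1 / (2 * (N : ℝ)))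

/-- The input of the algorithm (apart from the learning rate). -/
structure AlgInput (𝒳 : Type*) (n : ℕ) where
  /-- the training data `(Xᵢ, Aᵢ, yᵢ)` -/
  data : Fin n → 𝒳 × Fin 2 × ℝ
  /-- parameters and group events of the disparity -/
  β : Fin 2 → ℝ
  S : Fin 2 → Set (Fin 2)
  /-- weight function `g` of the disparity -/
  g : 𝒳 → ℝ → ℝ
  /-- loss function -/
  l : ℝ → ℝ → ℝ
  /-- grid size and cover of the outcomes -/
  N : ℕ
  cover : Finset ℝ
  /-- empirical loss tolerance -/
  epsHat : ℝ
  /-- bounds for the multipliers and the slack variable, and the accuracy -/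
  Blam : ℝ
  Bxi : ℝ
  nu : ℝ

namespace AlgInput

variable {𝒳 : Type*} {n : ℕ}

/-- `E_{Z_α}[h_f(x, Z_α)]`, with `Z_α` uniform on the grid `{j/N : j = 1, …, N}`. -/
def gridThr (I : AlgInput 𝒳 n) (f : 𝒳 → ℝ) (x : 𝒳) : ℝ :=
  (1 / (I.N : ℝ)) * ∑ j ∈ Finset.Icc 1 I.N, thr f x ((j : ℝ) / I.N)

/-- `g(Xᵢ, yᵢ) 1{Aᵢ ∈ Sₐ}`. -/
def groupWeight (I : AlgInput 𝒳 n) (a : Fin 2) (i : Fin n) : ℝ :=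
  (I.S a).indicator (fun _ => I.g (I.data i).1 (I.data i).2.2) (I.data i).2.1

/-- Empirical disparity of the threshold classifier `h_f`. -/
def dispHat (I : AlgInput 𝒳 n) (f : 𝒳 → ℝ) : ℝ :=
  ∑ a, I.β a *
    ((∑ i, I.groupWeight a i * I.gridThr f (I.data i).1) / ∑ i, I.groupWeight a i)

/-- Empirical cost `Ê[E_{Z_α}[c(y̲ᵢ, Z_α) h_f(Xᵢ, Z_α)]]` of the threshold classifier `h_f`. -/
def costHat (I : AlgInput 𝒳 n) (f : 𝒳 → ℝ) : ℝ :=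
  (1 / (n : ℝ)) * ∑ i, (1 / (I.N : ℝ)) * ∑ j ∈ Finset.Icc 1 I.N,
    costWeight I.l I.N (lowerY I.N I.cover (I.data i).2.2) ((j : ℝ) / I.N) *
      thr f (I.data i).1 ((j : ℝ) / I.N)

/-- The constraint values `(d - ξ, -d - ξ, c - ε̂)` at slack `ξ`, empirical disparity `d` and
empirical cost `c`; the coordinates `0, 1, 2` stand for `+`, `-`, `cost`. -/
def viol (I : AlgInput 𝒳 n) (ξ d c : ℝ) : Fin 3 → ℝ := ![d - ξ, -d - ξ, c - I.epsHat]

/-- The Lagrangian, as a function of slack, empirical disparity, empirical cost, multipliers. -/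
def lagrangian (I : AlgInput 𝒳 n) (ξ d c : ℝ) (lam : Fin 3 → ℝ) : ℝ :=
  ξ + ∑ k, lam k * I.viol ξ d c k

/-- `ρ`: the largest absolute constraint value over `h ∈ ℋ`, `ξ ∈ [0, B_ξ]`. -/
def rho (I : AlgInput 𝒳 n) (ℱ : Set (𝒳 → ℝ)) : ℝ :=
  ⨆ p : ℱ × Set.Icc (0 : ℝ) I.Bxi × Fin 3,
    |I.viol p.2.1 (I.dispHat p.1) (I.costHat p.1) p.2.2|

/-- The learning rate `η = ν / (2 ρ² B_λ)`. -/
def learningRate (I : AlgInput 𝒳 n) (ℱ : Set (𝒳 → ℝ)) : ℝ :=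
  I.nu / (2 * I.rho ℱ ^ 2 * I.Blam)

/-! ### The exponentiated gradient algorithm -/

/-- `best` is a best-response oracle of the `h`-player: for every vector of multipliers it
returns an `f ∈ ℱ` minimizing `(λ₊ - λ₋) disp^(h_f) + λ_cost (cost^(h_f) - ε̂)`. -/
def IsBestH (I : AlgInput 𝒳 n) (ℱ : Set (𝒳 → ℝ)) (best : (Fin 3 → ℝ) → ℱ) : Prop :=
  ∀ lam : Fin 3 → ℝ, (∀ k, 0 ≤ lam k) → ∑ k, lam k ≤ I.Blam → ∀ f : ℱ,
    (lam 0 - lam 1) * I.dispHat (best lam) + lam 2 * (I.costHat (best lam) - I.epsHat) ≤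
      (lam 0 - lam 1) * I.dispHat f + lam 2 * (I.costHat f - I.epsHat)

/-- Best response of the slack variable. -/
def bestXi (I : AlgInput 𝒳 n) (lam : Fin 3 → ℝ) : ℝ :=
  open Classical in if 1 - lam 0 - lam 1 < 0 then I.Bxi else 0

/-- Best response of the multiplier player to constraint values `v`: all zero if no constraint
is violated, otherwise `B_λ` on a maximally violated constraint. -/
def bestLam (I : AlgInput 𝒳 n) (v : Fin 3 → ℝ) : Fin 3 → ℝ :=
  open Classical in
  if ∀ k, v k ≤ 0 then 0
  else if v 1 ≤ v 0 ∧ v 2 ≤ v 0 then ![I.Blam, 0, 0]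
  else if v 2 ≤ v 1 then ![0, I.Blam, 0]
  else ![0, 0, I.Blam]

/-- `λ_k = B_λ exp(θ_k) / (1 + ∑_{k'} exp(θ_{k'}))`. -/
def weights (I : AlgInput 𝒳 n) (θ : Fin 3 → ℝ) : Fin 3 → ℝ :=
  fun k => I.Blam * Real.exp (θ k) / (1 + ∑ k', Real.exp (θ k'))

variable {ℱ : Set (𝒳 → ℝ)}

/-- The parameter `θ` used in iteration `t + 1`. -/
def theta (I : AlgInput 𝒳 n) (η : ℝ) (best : (Fin 3 → ℝ) → ℱ) : ℕ → Fin 3 → ℝ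
  | 0 => 0
  | t + 1 =>
    let lam := I.weights (I.theta η best t)
    I.theta η best t +
      η • I.viol (I.bestXi lam) (I.dispHat (best lam)) (I.costHat (best lam))

/-- The multipliers of iteration `t + 1`. -/
def lamAt (I : AlgInput 𝒳 n) (η : ℝ) (best : (Fin 3 → ℝ) → ℱ) (t : ℕ) : Fin 3 → ℝ :=
  I.weights (I.theta η best t)

/-- The uniform distribution on the predictors `f_1, …, f_{t+1}` of the first `t + 1`
iterations: `Q̂` after iteration `t + 1`, viewed as a distribution over `ℱ`. -/
def QHat (I : AlgInput 𝒳 n) (η : ℝ) (best : (Fin 3 → ℝ) → ℱ) (t : ℕ) : PMF ℱ :=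
  (PMF.uniformOfFintype (Fin (t + 1))).map fun s => best (I.lamAt η best s)

/-- The average slack after iteration `t + 1`. -/
def xiHat (I : AlgInput 𝒳 n) (η : ℝ) (best : (Fin 3 → ℝ) → ℱ) (t : ℕ) : ℝ :=
  (1 / ((t : ℝ) + 1)) * ∑ s ∈ Finset.range (t + 1), I.bestXi (I.lamAt η best s)

/-- The average multipliers after iteration `t + 1`. -/
def lamHat (I : AlgInput 𝒳 n) (η : ℝ) (best : (Fin 3 → ℝ) → ℱ) (t : ℕ) : Fin 3 → ℝ :=
  (1 / ((t : ℝ) + 1)) • ∑ s ∈ Finset.range (t + 1), I.lamAt η best s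

/-- `disp^(Q)` and `cost^(Q)` for `Q ∈ Δ(ℱ)`. -/
def dispHatQ (I : AlgInput 𝒳 n) (Q : PMF ℱ) : ℝ := mix Q fun f => I.dispHat f
def costHatQ (I : AlgInput 𝒳 n) (Q : PMF ℱ) : ℝ := mix Q fun f => I.costHat f

/-- `ν_{t+1}`: the duality gap after iteration `t + 1`. -/
def gap (I : AlgInput 𝒳 n) (η : ℝ) (best : (Fin 3 → ℝ) → ℱ) (t : ℕ) : ℝ :=
  let ξ := I.xiHat η best t
  let d := I.dispHatQ (I.QHat η best t)
  let c := I.costHatQ (I.QHat η best t)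
  let lam := I.lamHat η best t
  let L := I.lagrangian ξ d c lam
  let Lupper := I.lagrangian ξ d c (I.bestLam (I.viol ξ d c))
  let Llower := I.lagrangian (I.bestXi lam) (I.dispHat (best lam)) (I.costHat (best lam)) lam
  max (L - Llower) (Lupper - L)

/-- The algorithm stops after exactly `t + 1` iterations. -/
def StopsAt (I : AlgInput 𝒳 n) (η : ℝ) (best : (Fin 3 → ℝ) → ℱ) (t : ℕ) : Prop :=
  I.gap η best t ≤ I.nu ∧ ∀ s < t, I.nu < I.gap η best s

/-- The value returned when the algorithm stops after iteration `t + 1`; `none` is `null`. -/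
def output (I : AlgInput 𝒳 n) (η : ℝ) (best : (Fin 3 → ℝ) → ℱ) (t : ℕ) : Option (PMF ℱ) :=
  open Classical in
  if I.costHatQ (I.QHat η best t) ≤ I.epsHat + (I.Bxi + 2 * I.nu) / I.Blam
  then some (I.QHat η best t) else none

end AlgInput

/-- The modified training data `(Xᵢ, Aᵢ, μ(Xᵢ))`. -/
def modifiedData {𝒳 : Type*} {n : ℕ} (μ : 𝒳 → ℝ) (s : Fin n → Obs 𝒳) :
    Fin n → 𝒳 × Fin 2 × ℝ :=
  fun i => (featX (s i), attrA (s i), μ (featX (s i)))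

/-- The number of observations with `Aᵢ ∈ T`. -/
def groupCount {𝒳 : Type*} {n : ℕ} (T : Set (Fin 2)) (s : Fin n → Obs 𝒳) : ℕ :=
  Set.ncard {i | attrA (s i) ∈ T}

/-- The input of the algorithm on the modified training data, with empirical tolerance
`ε̂ = ε - ĉ₀ + C' n^{-φ} - C'' n^{-1/2}`, `ν = c_ν n^{-φ}` and `B_λ = c_B n^φ`. -/
def selectiveInput {𝒳 : Type*} {n : ℕ} (μ : 𝒳 → ℝ) (β : Fin 2 → ℝ)
    (S : Fin 2 → Set (Fin 2)) (g : 𝒳 → ℝ → ℝ) (l : ℝ → ℝ → ℝ) (ε Bxi φ cν cB : ℝ)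
    (C' C'' : ℝ) (N : ℕ) (cover : Finset ℝ) (s : Fin n → Obs 𝒳) : AlgInput 𝒳 n where
  data := modifiedData μ s
  β := β
  S := S
  g := g
  l := l
  N := N
  cover := cover
  epsHat := ε - c0Hat l N cover (modifiedData μ s) + C' * (n : ℝ) ^ (-φ)
    - C'' * (n : ℝ) ^ (-(1 / 2) : ℝ)
  Blam := cB * (n : ℝ) ^ φ
  Bxi := Bxi
  nu := cν * (n : ℝ) ^ (-φ)

/-- The factor hidden in `Õ(·)`: a constant times a power of `1 + ln n + ln(1/δ)`. -/
def polylog (K : ℝ) (p n : ℕ) (δ : ℝ) : ℝ := K * (1 + Real.log n + Real.log (1 / δ)) ^ p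

end FairRashomon

end

/-!
Integrating the increments of the loss over the grid of thresholds gives `l y u`, up to an error
of order `1 / N`, as a fixed term plus a cost that is linear in the classifiers `1 {z ≤ u}`. The
empirical problem is therefore a zero-sum game, linear in a distribution over `ℋ`, between a
learner who best-responds and an exponentiated-gradient adversary. The regret bound for
exponential weights makes the averaged play a `ν`-approximate saddle point after `O(B_λ² ρ² / ν²)`
rounds, and such a point violates the constraints by at most `(B_ξ + 2ν) / B_λ`.

Symmetrization and McDiarmid's inequality bound the deviations of the sample averages uniformly
over `ℋ`, for the whole sample and, conditionally on the attributes, for each group. The tolerance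
`ε̂` is such that a nearly optimal feasible distribution, which is fixed before sampling and so
needs only Hoeffding's inequality, remains feasible on the sample; comparing the saddle point with
it gives both guarantees.
-/

open scoped BigOperators

noncomputable section

namespace FairRashomon

/-! ### Averages over random signs -/

section Signs

variable {ι κ : Type*} [Fintype ι]

/-- The sign `±1` encoded by a Boolean, as in the definition of `rademacher`. -/
def rsign (b : Bool) : ℝ := if b then 1 else -1

/-- `sup_k |∑ᵢ σᵢ x_k(i)|`: the largest signed sum over a family of vectors. -/
def signSup (x : κ → ι → ℝ) (σ : ι → Bool) : ℝ := ⨆ k, |∑ i, rsign (σ i) * x k i|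

/-- `E_σ sup_k |∑ᵢ σᵢ x_k(i)|` for independent uniform signs: the unnormalized empirical Rademacher
complexity of a family of vectors. -/
def signMean [DecidableEq ι] (x : κ → ι → ℝ) : ℝ := 𝔼 σ : ι → Bool, signSup x σ

theorem abs_rsign (b : Bool) : |rsign b| = 1 := by cases b <;> simp [rsign]

theorem half_add_exp_le {t a b c : ℝ} (h : |a - b| ≤ c) :
    (Real.exp (t * a) + Real.exp (t * b)) / 2 ≤
      Real.exp (t * ((a + b) / 2) + t ^ 2 / 8 * c ^ 2) := by
  have hcosh : (Real.exp (t * a) + Real.exp (t * b)) / 2 =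
      Real.exp (t * ((a + b) / 2)) * Real.cosh (t * ((a - b) / 2)) := by
    rw [Real.cosh_eq, mul_div_assoc', mul_add, ← Real.exp_add, ← Real.exp_add]
    congr 3 <;> ring
  have hsq : (a - b) ^ 2 ≤ c ^ 2 := sq_le_sq' (abs_le.1 h).1 (abs_le.1 h).2
  rw [hcosh, Real.exp_add]
  gcongr
  refine (Real.cosh_le_exp_half_sq _).trans (Real.exp_le_exp.2 ?_)
  nlinarith [mul_le_mul_of_nonneg_left hsq (sq_nonneg t)]

theorem expect_bool_cons (n : ℕ) (G : (Fin (n + 1) → Bool) → ℝ) :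
    𝔼 σ, G σ = 𝔼 σ : Fin n → Bool, (G (Fin.cons true σ) + G (Fin.cons false σ)) / 2 := by
  have hsum : ∑ σ, G σ = ∑ σ : Fin n → Bool, (G (Fin.cons true σ) + G (Fin.cons false σ)) := by
    rw [← (Fin.consEquiv fun _ => Bool).sum_comp, Fintype.sum_prod_type]
    simp [Finset.sum_add_distrib, Fin.consEquiv]
  rw [Fintype.expect_eq_sum_div_card, Fintype.expect_eq_sum_div_card, hsum, ← Finset.sum_div,
    div_div]
  simp [pow_succ, mul_comm]

theorem expect_exp_le_of_bounded_differences_fin (t : ℝ) {n : ℕ} (F : (Fin n → Bool) → ℝ)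
    (c : Fin n → ℝ) (hF : ∀ σ i b, |F σ - F (Function.update σ i b)| ≤ c i) :
    𝔼 σ, Real.exp (t * F σ) ≤ Real.exp (t * 𝔼 σ, F σ + t ^ 2 / 8 * ∑ i, c i ^ 2) := by
  induction n with
  | zero => simp
  | succ n ih =>
    let M : (Fin n → Bool) → ℝ := fun σ => (F (Fin.cons true σ) + F (Fin.cons false σ)) / 2
    have hM : ∀ σ i b, |M σ - M (Function.update σ i b)| ≤ c i.succ := by
      intro σ i b
      have htrue := hF (Fin.cons true σ) i.succ b
      have hfalse := hF (Fin.cons false σ) i.succ b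
      rw [← Fin.cons_update] at htrue hfalse
      rw [abs_le] at *
      constructor <;> simp only [M] <;> linarith [htrue.1, htrue.2, hfalse.1, hfalse.2]
    have hfirst (σ : Fin n → Bool) : |F (Fin.cons true σ) - F (Fin.cons false σ)| ≤ c 0 := by
      simpa only [Fin.update_cons_zero] using hF (Fin.cons true σ) 0 false
    rw [expect_bool_cons n fun σ => Real.exp (t * F σ), expect_bool_cons n F, Fin.sum_univ_succ]
    calc 𝔼 σ : Fin n → Bool,
          (Real.exp (t * F (Fin.cons true σ)) + Real.exp (t * F (Fin.cons false σ))) / 2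
        ≤ 𝔼 σ, Real.exp (t * M σ) * Real.exp (t ^ 2 / 8 * c 0 ^ 2) := by
          gcongr with σ
          rw [← Real.exp_add]
          exact half_add_exp_le (hfirst σ)
      _ = (𝔼 σ, Real.exp (t * M σ)) * Real.exp (t ^ 2 / 8 * c 0 ^ 2) :=
          (Finset.expect_mul ..).symm
      _ ≤ Real.exp (t * 𝔼 σ, M σ + t ^ 2 / 8 * ∑ i : Fin n, c i.succ ^ 2) *
            Real.exp (t ^ 2 / 8 * c 0 ^ 2) := by
          gcongr
          exact ih M _ hM
      _ = Real.exp (t * 𝔼 σ, M σ + t ^ 2 / 8 * (c 0 ^ 2 + ∑ i : Fin n, c i.succ ^ 2)) := by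
          rw [← Real.exp_add]
          ring_nf

theorem abs_sum_rsign_mul_le (σ : ι → Bool) {y : ι → ℝ} (hy : ∀ i, |y i| ≤ 1) :
    |∑ i, rsign (σ i) * y i| ≤ Fintype.card ι := by
  calc |∑ i, rsign (σ i) * y i| ≤ ∑ i, |rsign (σ i) * y i| := Finset.abs_sum_le_sum_abs _ _
    _ ≤ ∑ _i : ι, (1 : ℝ) := by
        gcongr with i
        rw [abs_mul, abs_rsign, one_mul]
        exact hy i
    _ = Fintype.card ι := by simp

theorem signSup_nonneg (x : κ → ι → ℝ) (σ : ι → Bool) : 0 ≤ signSup x σ :=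
  Real.iSup_nonneg fun _ => abs_nonneg _

theorem le_signSup {x : κ → ι → ℝ} (hx : ∀ k i, |x k i| ≤ 1) (σ : ι → Bool) (k : κ) :
    |∑ i, rsign (σ i) * x k i| ≤ signSup x σ :=
  le_ciSup (f := fun k => |∑ i, rsign (σ i) * x k i|)
    ⟨Fintype.card ι, Set.forall_mem_range.2 fun k => abs_sum_rsign_mul_le σ (hx k)⟩ k

variable [DecidableEq ι]

theorem expect_exp_le_of_bounded_differences (t : ℝ) (F : (ι → Bool) → ℝ) (c : ι → ℝ)
    (hF : ∀ σ i b, |F σ - F (Function.update σ i b)| ≤ c i) :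
    𝔼 σ, Real.exp (t * F σ) ≤ Real.exp (t * 𝔼 σ, F σ + t ^ 2 / 8 * ∑ i, c i ^ 2) := by
  let e := Fintype.equivFin ι
  let E : (ι → Bool) ≃ (Fin (Fintype.card ι) → Bool) := e.arrowCongr (Equiv.refl Bool)
  have h := expect_exp_le_of_bounded_differences_fin t (fun σ => F (σ ∘ e)) (c ∘ e.symm)
    fun σ i b => by
      simpa only [Function.update_comp_equiv, Function.comp_apply] using hF (σ ∘ e) (e.symm i) b
  have hcomp (σ : ι → Bool) : E σ ∘ e = σ := by ext i; simp [E, Equiv.arrowCongr]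
  rw [← Fintype.expect_equiv E (fun σ => Real.exp (t * F σ)) _ fun σ => by rw [hcomp],
    ← Fintype.expect_equiv E F _ fun σ => by rw [hcomp]] at h
  simpa only [Function.comp_apply, e.symm.sum_comp fun i => c i ^ 2] using h

theorem signSup_le_update_add {x : κ → ι → ℝ} (hx : ∀ k i, |x k i| ≤ 1) (σ : ι → Bool) (j : ι)
    (b : Bool) : signSup x σ ≤ signSup x (Function.update σ j b) + 2 := by
  refine Real.iSup_le (fun k => ?_) (add_nonneg (signSup_nonneg _ _) two_pos.le)
  have hdiff : |∑ i, rsign (σ i) * x k i - ∑ i, rsign (Function.update σ j b i) * x k i| ≤ 2 := by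
    rw [← Finset.sum_sub_distrib, Finset.sum_eq_single_of_mem j (Finset.mem_univ j)
      fun i _ hi => by rw [Function.update_of_ne hi, sub_self]]
    refine (abs_sub _ _).trans ?_
    simp only [abs_mul, abs_rsign, one_mul]
    linarith [hx k j]
  linarith [le_signSup hx (Function.update σ j b) k, abs_sub_abs_le_abs_sub
    (∑ i, rsign (σ i) * x k i) (∑ i, rsign (Function.update σ j b i) * x k i)]

theorem expect_exp_signSup_le {x : κ → ι → ℝ} (hx : ∀ k i, |x k i| ≤ 1) (t : ℝ) :
    𝔼 σ, Real.exp (t * signSup x σ) ≤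
      Real.exp (t * signMean x + Fintype.card ι * (t ^ 2 / 2)) := by
  have hdiff (σ : ι → Bool) (j : ι) (b : Bool) :
      |signSup x σ - signSup x (Function.update σ j b)| ≤ 2 := by
    have hback := signSup_le_update_add hx (Function.update σ j b) j (σ j)
    rw [Function.update_idem, Function.update_eq_self] at hback
    rw [abs_le]
    constructor <;> linarith [signSup_le_update_add hx σ j b]
  refine (expect_exp_le_of_bounded_differences t (signSup x) (fun _ => 2) hdiff).trans_eq ?_
  simp only [signMean, Finset.sum_const, Finset.card_univ, nsmul_eq_mul]
  ring_nf

theorem convexOn_signMean_mul {x : κ → ι → ℝ} (hx : ∀ k i, |x k i| ≤ 1) :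
    ConvexOn ℝ {w : ι → ℝ | ∀ i, |w i| ≤ 1} fun w => signMean fun k i => w i * x k i := by
  have hbound {w : ι → ℝ} (hw : ∀ i, |w i| ≤ 1) (k : κ) (i : ι) : |w i * x k i| ≤ 1 := by
    rw [abs_mul]
    exact mul_le_one₀ (hw i) (abs_nonneg _) (hx k i)
  have hconvex : Convex ℝ {w : ι → ℝ | ∀ i, |w i| ≤ 1} := by
    have hcube : {w : ι → ℝ | ∀ i, |w i| ≤ 1} = Set.univ.pi fun _ => Set.Icc (-1 : ℝ) 1 := by
      ext w
      simp only [Set.mem_ofPred_eq, abs_le, Set.mem_univ_pi, Set.mem_Icc]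
    rw [hcube]
    exact convex_pi fun _ _ => convex_Icc _ _
  refine ⟨hconvex, fun w hw v hv a b ha hb _ => ?_⟩
  simp only [signMean, smul_eq_mul, Finset.mul_expect, ← Finset.expect_add_distrib]
  gcongr with σ
  refine Real.iSup_le (fun k => ?_) (add_nonneg (mul_nonneg ha (signSup_nonneg _ _))
    (mul_nonneg hb (signSup_nonneg _ _)))
  have hlin : ∑ i, rsign (σ i) * ((a • w + b • v) i * x k i) =
      a * ∑ i, rsign (σ i) * (w i * x k i) + b * ∑ i, rsign (σ i) * (v i * x k i) := by
    rw [Finset.mul_sum, Finset.mul_sum, ← Finset.sum_add_distrib]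
    refine Finset.sum_congr rfl fun i _ => ?_
    simp only [Pi.add_apply, Pi.smul_apply, smul_eq_mul]
    ring
  rw [hlin]
  refine (abs_add_le _ _).trans ?_
  rw [abs_mul, abs_mul, abs_of_nonneg ha, abs_of_nonneg hb]
  gcongr
  exacts [le_signSup (hbound hw) σ k, le_signSup (hbound hv) σ k]

theorem signMean_sign_mul {v : ι → ℝ} (hv : ∀ i, v i = -1 ∨ v i = 1) (x : κ → ι → ℝ) :
    signMean (fun k i => v i * x k i) = signMean x := by
  let flip : (ι → Bool) ≃ (ι → Bool) :=
    Equiv.piCongrRight fun i => if v i = 1 then Equiv.refl Bool else Equiv.boolNot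
  have hflip (σ : ι → Bool) (i : ι) : rsign (flip σ i) = rsign (σ i) * v i := by
    rcases hv i with h | h
    · have hne : v i ≠ 1 := by rw [h]; norm_num
      simp only [flip, Equiv.piCongrRight_apply, Pi.map_apply, if_neg hne]
      cases σ i <;> simp [rsign, h]
    · simp [flip, h]
  refine Fintype.expect_equiv flip _ _ fun σ => ?_
  simp only [signSup, hflip, mul_assoc]

/-- A convex function on the cube is dominated by its values at the vertices, and there the weights
only permute the signs. -/
theorem signMean_mul_le {x : κ → ι → ℝ} (hx : ∀ k i, |x k i| ≤ 1) {w : ι → ℝ}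
    (hw : ∀ i, |w i| ≤ 1) : signMean (fun k i => w i * x k i) ≤ signMean x := by
  have hmem : w ∈ convexHull ℝ (Set.univ.pi fun _ : ι => ({-1, 1} : Set ℝ)) := by
    refine mem_convexHull_pi fun i _ => ?_
    rw [convexHull_pair, segment_eq_Icc (by norm_num)]
    exact abs_le.1 (hw i)
  have hvertex : (Set.univ.pi fun _ : ι => ({-1, 1} : Set ℝ)) ⊆ {w | ∀ i, |w i| ≤ 1} := by
    intro v hv i
    rcases hv i trivial with h | h <;> simp [Set.mem_singleton_iff.1 h]
  obtain ⟨v, hv, hle⟩ := (convexOn_signMean_mul hx).exists_ge_of_mem_convexHull hvertex hmem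
  exact hle.trans_eq (signMean_sign_mul (fun i => hv i trivial) x)

theorem le_rademacher {U : Type*} {𝒢 : Set (U → ℝ)} (h𝒢 : ∀ g ∈ 𝒢, ∀ u, |g u| ≤ 1) {m : ℕ}
    (u : Fin m → U) :
    (1 / (m : ℝ)) * signMean (fun (g : 𝒢) i => (g : U → ℝ) (u i)) ≤ rademacher 𝒢 m := by
  have hterm (u : Fin m → U) : (1 / (2 : ℝ) ^ m) * ∑ σ : Fin m → Bool,
      ⨆ g : 𝒢, |(1 / (m : ℝ)) * ∑ i, (if σ i then (1 : ℝ) else -1) * (g : U → ℝ) (u i)| =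
      (1 / (m : ℝ)) * signMean (fun (g : 𝒢) i => (g : U → ℝ) (u i)) := by
    rw [signMean, Fintype.expect_eq_sum_div_card]
    simp only [abs_mul, abs_of_nonneg (by positivity : (0 : ℝ) ≤ 1 / m), signSup, rsign,
      ← Real.mul_iSup_of_nonneg (by positivity : (0 : ℝ) ≤ 1 / m), ← Finset.mul_sum]
    simp
    ring
  have hbdd : BddAbove (Set.range fun u : Fin m → U =>
      (1 / (m : ℝ)) * signMean (fun (g : 𝒢) i => (g : U → ℝ) (u i))) := by
    refine ⟨1 / (m : ℝ) * m, Set.forall_mem_range.2 fun u => ?_⟩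
    gcongr
    refine Finset.expect_le Finset.univ_nonempty fun σ _ => Real.iSup_le (fun g => ?_) (by simp)
    simpa using abs_sum_rsign_mul_le σ fun i => h𝒢 g g.2 (u i)
  unfold rademacher
  simp only [hterm]
  exact le_ciSup hbdd u

theorem signMean_le_card_mul_rademacher [Nonempty ι] {U : Type*} {𝒢 : Set (U → ℝ)}
    (h𝒢 : ∀ g ∈ 𝒢, ∀ u, |g u| ≤ 1) (G : κ → U → ℝ) (hG : ∀ k, G k ∈ 𝒢) (u : ι → U) :
    signMean (fun k i => G k (u i)) ≤ Fintype.card ι * rademacher 𝒢 (Fintype.card ι) := by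
  let e := Fintype.equivFin ι
  have hcard : (0 : ℝ) < Fintype.card ι := by exact_mod_cast Fintype.card_pos
  have hreindex : signMean (fun k i => G k (u i)) ≤
      signMean (fun (g : 𝒢) i => (g : U → ℝ) (u (e.symm i))) := by
    rw [signMean, Fintype.expect_equiv (e.arrowCongr (Equiv.refl Bool)) _
      (fun σ => signSup (fun k i => G k (u i)) (σ ∘ e)) fun σ => by
        congr 1; ext i; simp [Equiv.arrowCongr]]
    refine Finset.expect_le_expect fun σ _ => Real.iSup_le (fun k => ?_) (signSup_nonneg _ _)
    rw [← e.symm.sum_comp]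
    simpa using le_signSup (x := fun (g : 𝒢) i => (g : U → ℝ) (u (e.symm i)))
      (fun g i => h𝒢 g g.2 _) σ ⟨G k, hG k⟩
  have hrad := le_rademacher h𝒢 (u ∘ e.symm)
  rw [one_div, inv_mul_le_iff₀ hcard] at hrad
  exact hreindex.trans hrad

end Signs

/-! ### Uniform deviations of sample means -/

section Symmetrization

variable {ι κ Ω : Type*} [Fintype ι]

/-- `sup_k |∑ᵢ (h_k(sᵢ) - E h_k)|`: the largest deviation of the sums over the sample `s` from
their means. -/
def uniformDeviation [MeasurableSpace Ω] (ν : Measure Ω) (h : κ → Ω → ℝ) (s : ι → Ω) : ℝ :=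
  ⨆ k, |∑ i, (h k (s i) - ∫ x, h k x ∂ν)|

/-- `sup_k |∑ᵢ (h_k(sᵢ) - h_k(s'ᵢ))|` for a sample paired with an independent copy (the ghost
sample), `p i = (sᵢ, s'ᵢ)`. -/
def ghostDeviation (h : κ → Ω → ℝ) (p : ι → Ω × Ω) : ℝ :=
  ⨆ k, |∑ i, (h k (p i).1 - h k (p i).2)|

/-- Exchanges the two coordinates when the sign encoded by the Boolean is `-1`. -/
def signSwap (b : Bool) : Ω × Ω → Ω × Ω := if b then id else Prod.swap

theorem abs_sum_sub_le {u v : ι → ℝ} (hu : ∀ i, |u i| ≤ 1) (hv : ∀ i, |v i| ≤ 1) :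
    |∑ i, (u i - v i)| ≤ 2 * Fintype.card ι := by
  calc |∑ i, (u i - v i)| ≤ ∑ i, |u i - v i| := Finset.abs_sum_le_sum_abs _ _
    _ ≤ ∑ _i : ι, (2 : ℝ) := by
        gcongr with i
        linarith [abs_sub (u i) (v i), hu i, hv i]
    _ = 2 * Fintype.card ι := by simp [mul_comm]

section Bounded

variable {h : κ → Ω → ℝ}

theorem le_ghostDeviation (hb : ∀ k x, |h k x| ≤ 1) (p : ι → Ω × Ω) (k : κ) :
    |∑ i, (h k (p i).1 - h k (p i).2)| ≤ ghostDeviation h p :=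
  le_ciSup (f := fun k => |∑ i, (h k (p i).1 - h k (p i).2)|)
    ⟨2 * Fintype.card ι, Set.forall_mem_range.2 fun k =>
      abs_sum_sub_le (fun i => hb k (p i).1) fun i => hb k (p i).2⟩ k

theorem ghostDeviation_mem_Icc (hb : ∀ k x, |h k x| ≤ 1) (p : ι → Ω × Ω) :
    ghostDeviation h p ∈ Set.Icc (0 : ℝ) (2 * Fintype.card ι) :=
  ⟨Real.iSup_nonneg fun _ => abs_nonneg _,
    Real.iSup_le (fun k => abs_sum_sub_le (fun _ => hb k _) fun _ => hb k _) (by positivity)⟩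

/-- Exchanging the paired points along `σ` multiplies the `i`-th difference by the `i`-th sign. -/
theorem ghostDeviation_signSwap_le (hb : ∀ k x, |h k x| ≤ 1) (p : ι → Ω × Ω)
    (σ : ι → Bool) :
    ghostDeviation h (fun i => signSwap (σ i) (p i)) ≤
      signSup (fun k i => h k (p i).1) σ + signSup (fun k i => h k (p i).2) σ := by
  refine Real.iSup_le (fun k => ?_) (add_nonneg (signSup_nonneg _ _) (signSup_nonneg _ _))
  have hswap : ∑ i, (h k (signSwap (σ i) (p i)).1 - h k (signSwap (σ i) (p i)).2) =
      ∑ i, rsign (σ i) * h k (p i).1 - ∑ i, rsign (σ i) * h k (p i).2 := by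
    rw [← Finset.sum_sub_distrib]
    refine Finset.sum_congr rfl fun i _ => ?_
    cases σ i <;> simp [signSwap, rsign]
    ring
  rw [hswap]
  exact (abs_sub _ _).trans (add_le_add
    (le_signSup (x := fun k i => h k (p i).1) (fun k i => hb k _) σ k)
    (le_signSup (x := fun k i => h k (p i).2) (fun k i => hb k _) σ k))

theorem expect_exp_ghostDeviation_signSwap_le [DecidableEq ι] (hb : ∀ k x, |h k x| ≤ 1)
    {R t : ℝ} (ht : 0 ≤ t) (hR : ∀ u : ι → Ω, signMean (fun k i => h k (u i)) ≤ R)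
    (p : ι → Ω × Ω) :
    𝔼 σ : ι → Bool, Real.exp (t * ghostDeviation h fun i => signSwap (σ i) (p i)) ≤
      Real.exp (2 * t * R + 2 * Fintype.card ι * t ^ 2) := by
  have hhalf (u : ι → Ω) : 𝔼 σ, Real.exp (2 * t * signSup (fun k i => h k (u i)) σ) ≤
      Real.exp (2 * t * R + 2 * Fintype.card ι * t ^ 2) := by
    refine (expect_exp_signSup_le (fun k i => hb k (u i)) (2 * t)).trans (Real.exp_le_exp.2 ?_)
    nlinarith [mul_le_mul_of_nonneg_left (hR u) ht]
  have hamgm (a b : ℝ) : Real.exp (t * (a + b)) ≤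
      (Real.exp (2 * t * a) + Real.exp (2 * t * b)) / 2 := by
    have hsq (c : ℝ) : Real.exp (2 * t * c) = Real.exp (t * c) ^ 2 := by
      rw [← Real.exp_nat_mul]
      push_cast
      ring_nf
    rw [mul_add, Real.exp_add, hsq, hsq]
    linarith [two_mul_le_add_sq (Real.exp (t * a)) (Real.exp (t * b))]
  calc 𝔼 σ : ι → Bool, Real.exp (t * ghostDeviation h fun i => signSwap (σ i) (p i))
      ≤ 𝔼 σ, (Real.exp (2 * t * signSup (fun k i => h k (p i).1) σ) +
          Real.exp (2 * t * signSup (fun k i => h k (p i).2) σ)) / 2 := by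
        gcongr with σ
        refine le_trans ?_ (hamgm _ _)
        gcongr
        exact ghostDeviation_signSwap_le hb p σ
    _ ≤ Real.exp (2 * t * R + 2 * Fintype.card ι * t ^ 2) := by
        rw [← Finset.expect_div, Finset.expect_add_distrib]
        linarith [hhalf fun i => (p i).1, hhalf fun i => (p i).2]

end Bounded

section Measurability

variable [MeasurableSpace Ω] [Countable κ] {h : κ → Ω → ℝ}

theorem measurable_ghostDeviation (hm : ∀ k, Measurable (h k)) :
    Measurable fun p : ι → Ω × Ω => ghostDeviation h p := by
  refine Measurable.iSup fun k => Measurable.abs (Finset.measurable_fun_sum _ fun i _ => ?_)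
  exact ((hm k).comp (measurable_pi_apply i).fst).sub ((hm k).comp (measurable_pi_apply i).snd)

theorem measurable_uniformDeviation (hm : ∀ k, Measurable (h k)) (ν : Measure Ω) :
    Measurable fun s : ι → Ω => uniformDeviation ν h s := by
  refine Measurable.iSup fun k => Measurable.abs (Finset.measurable_fun_sum _ fun i _ => ?_)
  exact ((hm k).comp (measurable_pi_apply i)).sub_const _

end Measurability

theorem measurePreserving_signSwap [MeasurableSpace Ω] (ν : Measure Ω) [SFinite ν] (b : Bool) :
    MeasurePreserving (signSwap b) (ν.prod ν) (ν.prod ν) := by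
  cases b
  · exact Measure.measurePreserving_swap
  · exact MeasurePreserving.id _

section Probability

variable [MeasurableSpace Ω] (ν : Measure Ω) [IsProbabilityMeasure ν] {h : κ → Ω → ℝ}

theorem abs_integral_le_one (hb : ∀ k x, |h k x| ≤ 1) (k : κ) : |∫ x, h k x ∂ν| ≤ 1 := by
  simpa using norm_integral_le_of_norm_le_const (μ := ν) (f := h k) (ae_of_all _ (hb k))

theorem le_uniformDeviation (hb : ∀ k x, |h k x| ≤ 1) (s : ι → Ω) (k : κ) :
    |∑ i, (h k (s i) - ∫ x, h k x ∂ν)| ≤ uniformDeviation ν h s :=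
  le_ciSup (f := fun k => |∑ i, (h k (s i) - ∫ x, h k x ∂ν)|)
    ⟨2 * Fintype.card ι, Set.forall_mem_range.2 fun k =>
      abs_sum_sub_le (fun i => hb k (s i)) fun _ => abs_integral_le_one ν hb k⟩ k

theorem uniformDeviation_mem_Icc (hb : ∀ k x, |h k x| ≤ 1) (s : ι → Ω) :
    uniformDeviation ν h s ∈ Set.Icc (0 : ℝ) (2 * Fintype.card ι) :=
  ⟨Real.iSup_nonneg fun _ => abs_nonneg _, Real.iSup_le
    (fun k => abs_sum_sub_le (fun _ => hb k _) fun _ => abs_integral_le_one ν hb k)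
    (by positivity)⟩

variable [Countable κ]

theorem uniformDeviation_le_integral_ghostDeviation (hm : ∀ k, Measurable (h k))
    (hb : ∀ k x, |h k x| ≤ 1) (s : ι → Ω) :
    uniformDeviation ν h s ≤
      ∫ s', ghostDeviation h (fun i => (s i, s' i)) ∂(Measure.pi fun _ : ι => ν) := by
  refine Real.iSup_le (fun k => ?_)
    (integral_nonneg fun s' => (ghostDeviation_mem_Icc hb _).1)
  have hcoord (i : ι) : Integrable (fun s' : ι → Ω => h k (s' i)) (Measure.pi fun _ => ν) :=
    Integrable.of_bound ((hm k).comp (measurable_pi_apply i)).aestronglyMeasurable 1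
      (ae_of_all _ fun _ => hb k _)
  have hdiff (i : ι) : Integrable (fun s' : ι → Ω => h k (s i) - h k (s' i))
      (Measure.pi fun _ => ν) := (integrable_const _).sub (hcoord i)
  have hterm (i : ι) : ∫ s' : ι → Ω, (h k (s i) - h k (s' i)) ∂(Measure.pi fun _ => ν) =
      h k (s i) - ∫ x, h k x ∂ν := by
    rw [integral_sub (integrable_const _) (hcoord i),
      integral_comp_eval (μ := fun _ : ι => ν) (hm k).aestronglyMeasurable]
    simp
  have hghost : Integrable (fun s' : ι → Ω => ghostDeviation h fun i => (s i, s' i))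
      (Measure.pi fun _ => ν) :=
    Integrable.of_mem_Icc 0 (2 * Fintype.card ι)
      ((measurable_ghostDeviation hm).comp (by fun_prop)).aemeasurable
      (ae_of_all _ fun _ => ghostDeviation_mem_Icc hb _)
  simp only [← hterm]
  rw [← integral_finsetSum _ fun i _ => hdiff i]
  exact abs_integral_le_integral_abs.trans (integral_mono_of_nonneg
    (ae_of_all _ fun _ => abs_nonneg _) hghost
    (ae_of_all _ fun s' => le_ghostDeviation hb (fun i => (s i, s' i)) k))

/-- Jensen's inequality, after replacing the means by averages over a ghost sample. -/
theorem integral_exp_uniformDeviation_le_ghostDeviation (hm : ∀ k, Measurable (h k))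
    (hb : ∀ k x, |h k x| ≤ 1) {t : ℝ} (ht : 0 ≤ t) :
    ∫ s, Real.exp (t * uniformDeviation ν h s) ∂(Measure.pi fun _ : ι => ν) ≤
      ∫ p, Real.exp (t * ghostDeviation h p) ∂(Measure.pi fun _ : ι => ν.prod ν) := by
  have hsplit := measurePreserving_arrowProdEquivProdArrow Ω Ω ι (fun _ => ν) (fun _ => ν)
  set e := MeasurableEquiv.arrowProdEquivProdArrow Ω Ω ι
  have hint : Integrable
      (fun q : (ι → Ω) × (ι → Ω) => Real.exp (t * ghostDeviation h (e.symm q)))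
      ((Measure.pi fun _ => ν).prod (Measure.pi fun _ => ν)) :=
    integrable_exp_mul_of_mem_Icc
      ((measurable_ghostDeviation hm).comp e.symm.measurable).aemeasurable
      (ae_of_all _ fun _ => ghostDeviation_mem_Icc hb _)
  rw [← (hsplit.symm e).integral_comp e.symm.measurableEmbedding, integral_prod _ hint]
  refine integral_mono_of_nonneg (ae_of_all _ fun s => (Real.exp_pos _).le)
    hint.integral_prod_left (ae_of_all _ fun s => ?_)
  have hmeas : Measurable fun s' : ι → Ω => ghostDeviation h fun i => (s i, s' i) :=
    (measurable_ghostDeviation hm).comp (by fun_prop)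
  have hmem (s' : ι → Ω) := ghostDeviation_mem_Icc hb fun i => (s i, s' i)
  calc Real.exp (t * uniformDeviation ν h s)
      ≤ Real.exp (∫ s', t * ghostDeviation h (fun i => (s i, s' i))
          ∂(Measure.pi fun _ : ι => ν)) := by
        rw [integral_const_mul]
        gcongr
        exact uniformDeviation_le_integral_ghostDeviation ν hm hb s
    _ ≤ ∫ s', Real.exp (t * ghostDeviation h fun i => (s i, s' i))
          ∂(Measure.pi fun _ : ι => ν) :=
        convexOn_exp.map_integral_le Real.continuous_exp.continuousOn isClosed_univ (by simp)
          ((Integrable.of_mem_Icc _ _ hmeas.aemeasurable (ae_of_all _ hmem)).const_mul t)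
          (integrable_exp_mul_of_mem_Icc hmeas.aemeasurable (ae_of_all _ hmem))

variable [DecidableEq ι] {R : ℝ}

/-- The pairs are exchangeable, so the random signs can be inserted without changing the law. -/
theorem integral_exp_uniformDeviation_le (hm : ∀ k, Measurable (h k))
    (hb : ∀ k x, |h k x| ≤ 1)
    (hR : ∀ u : ι → Ω, signMean (fun k i => h k (u i)) ≤ R) {t : ℝ} (ht : 0 ≤ t) :
    ∫ s, Real.exp (t * uniformDeviation ν h s) ∂(Measure.pi fun _ : ι => ν) ≤
      Real.exp (2 * t * R + 2 * Fintype.card ι * t ^ 2) := by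
  have hswap (σ : ι → Bool) : MeasurePreserving (fun (p : ι → Ω × Ω) i => signSwap (σ i) (p i))
      (Measure.pi fun _ => ν.prod ν) (Measure.pi fun _ => ν.prod ν) :=
    measurePreserving_pi _ _ fun i => measurePreserving_signSwap ν (σ i)
  have hmeas := measurable_ghostDeviation (ι := ι) hm
  have hint (σ : ι → Bool) : Integrable
      (fun p : ι → Ω × Ω => Real.exp (t * ghostDeviation h fun i => signSwap (σ i) (p i)))
      (Measure.pi fun _ => ν.prod ν) :=
    integrable_exp_mul_of_mem_Icc (hmeas.comp (hswap σ).measurable).aemeasurable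
      (ae_of_all _ fun _ => ghostDeviation_mem_Icc hb _)
  have hinv (σ : ι → Bool) : ∫ p, Real.exp (t * ghostDeviation h fun i => signSwap (σ i) (p i))
      ∂(Measure.pi fun _ : ι => ν.prod ν) =
      ∫ p, Real.exp (t * ghostDeviation h p) ∂(Measure.pi fun _ : ι => ν.prod ν) := by
    conv_rhs => rw [← (hswap σ).map_eq]
    rw [integral_map (hswap σ).measurable.aemeasurable
      (hmeas.const_mul t).exp.aestronglyMeasurable]
  refine (integral_exp_uniformDeviation_le_ghostDeviation ν hm hb ht).trans ?_
  calc ∫ p, Real.exp (t * ghostDeviation h p) ∂(Measure.pi fun _ : ι => ν.prod ν)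
      = ∫ p, 𝔼 σ : ι → Bool, Real.exp (t * ghostDeviation h fun i => signSwap (σ i) (p i))
          ∂(Measure.pi fun _ : ι => ν.prod ν) := by
        simp only [Fintype.expect_eq_sum_div_card]
        rw [integral_div, integral_finsetSum _ fun σ _ => hint σ]
        simp [hinv]
    _ ≤ ∫ _p, Real.exp (2 * t * R + 2 * Fintype.card ι * t ^ 2)
          ∂(Measure.pi fun _ : ι => ν.prod ν) :=
        integral_mono_of_nonneg
          (ae_of_all _ fun p => Finset.expect_nonneg fun σ _ => (Real.exp_pos _).le)
          (integrable_const _) (ae_of_all _ (expect_exp_ghostDeviation_signSwap_le hb ht hR))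
    _ = Real.exp (2 * t * R + 2 * Fintype.card ι * t ^ 2) := by simp

theorem measure_uniformDeviation_ge_le [Nonempty ι] (hm : ∀ k, Measurable (h k))
    (hb : ∀ k x, |h k x| ≤ 1)
    (hR : ∀ u : ι → Ω, signMean (fun k i => h k (u i)) ≤ R) {τ : ℝ} (hτ : 0 ≤ τ) :
    (Measure.pi fun _ : ι => ν) {s | 2 * R + τ ≤ uniformDeviation ν h s} ≤
      ENNReal.ofReal (Real.exp (-τ ^ 2 / (8 * Fintype.card ι))) := by
  have : (0 : ℝ) < Fintype.card ι := by exact_mod_cast Fintype.card_pos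
  -- the minimizer of the exponent `2 * card ι * t ^ 2 - t * τ`
  set t := τ / (4 * Fintype.card ι)
  have ht : 0 ≤ t := by positivity
  have hint : Integrable (fun s => Real.exp (t * uniformDeviation ν h s))
      (Measure.pi fun _ : ι => ν) :=
    integrable_exp_mul_of_mem_Icc (measurable_uniformDeviation hm ν).aemeasurable
      (ae_of_all _ (uniformDeviation_mem_Icc ν hb))
  rw [← ofReal_measureReal]
  gcongr
  calc (Measure.pi fun _ : ι => ν).real {s | 2 * R + τ ≤ uniformDeviation ν h s}
      ≤ Real.exp (-t * (2 * R + τ)) * Real.exp (2 * t * R + 2 * Fintype.card ι * t ^ 2) := by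
        refine (measure_ge_le_exp_mul_mgf _ ht hint).trans ?_
        gcongr
        exact integral_exp_uniformDeviation_le ν hm hb hR ht
    _ = Real.exp (-τ ^ 2 / (8 * Fintype.card ι)) := by
        rw [← Real.exp_add]
        congr 1
        simp only [t]
        field_simp
        ring

end Probability

end Symmetrization

section ThresholdDeviation

variable {ι Ω 𝒳 : Type*} [Fintype ι]

theorem abs_thr_le_one (f : 𝒳 → ℝ) (x : 𝒳) (z : ℝ) : |thr f x z| ≤ 1 := by
  unfold thr
  split_ifs <;> simp

theorem thr_nonneg (f : 𝒳 → ℝ) (x : 𝒳) (z : ℝ) : 0 ≤ thr f x z := by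
  unfold thr
  split_ifs <;> simp

theorem abs_mul_thr_le_one {a : ℝ} (ha : |a| ≤ 1) (f : 𝒳 → ℝ) (x : 𝒳) (z : ℝ) :
    |a * thr f x z| ≤ 1 := by
  rw [abs_mul]
  exact mul_le_one₀ ha (abs_nonneg _) (abs_thr_le_one f x z)

theorem measurable_thr [MeasurableSpace 𝒳] {f : 𝒳 → ℝ} (hf : Measurable f) (z : ℝ) :
    Measurable fun x => thr f x z := by
  unfold thr
  exact Measurable.ite (measurableSet_le measurable_const hf) measurable_const measurable_const

theorem signMean_mul_thr_le [Nonempty ι] [DecidableEq ι] {ℱ : Set (𝒳 → ℝ)} {κ : Type*}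
    {G : κ → 𝒳 → ℝ} (hG : ∀ k, G k ∈ ℱ) {w : ι → ℝ} (hw : ∀ i, |w i| ≤ 1) {z : ℝ}
    (hz : z ∈ Set.Icc (0 : ℝ) 1) (x : ι → 𝒳) :
    signMean (fun k i => w i * thr (G k) (x i) z) ≤
      Fintype.card ι * rademacher (thrClass ℱ) (Fintype.card ι) := by
  refine (signMean_mul_le (fun k i => abs_thr_le_one (G k) (x i) z) hw).trans ?_
  refine signMean_le_card_mul_rademacher ?_
    (fun k (u : 𝒳 × Set.Icc (0 : ℝ) 1) => thr (G k) u.1 u.2)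
    (fun k => Set.mem_image_of_mem _ (hG k)) fun i => (x i, ⟨z, hz⟩)
  rintro _ ⟨f, -, rfl⟩ u
  exact abs_thr_le_one f u.1 u.2

variable [MeasurableSpace Ω] [MeasurableSpace 𝒳] (ν : Measure Ω) [IsProbabilityMeasure ν]
  {X : Ω → 𝒳} {w : Ω → ℝ} {z : ℝ}

theorem tendsto_sum_thr_sub_integral (hX : Measurable X) (hw : Measurable w)
    (hw1 : ∀ o, |w o| ≤ 1) {f : 𝒳 → ℝ} {G : ℕ → 𝒳 → ℝ} (hG : ∀ k, Measurable (G k))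
    (hlim : ∀ x, ∀ᶠ k in Filter.atTop, (z ≤ G k x ↔ z ≤ f x)) (s : ι → Ω) :
    Filter.Tendsto (fun k => ∑ i, (w (s i) * thr (G k) (X (s i)) z -
        ∫ o, w o * thr (G k) (X o) z ∂ν)) Filter.atTop
      (nhds (∑ i, (w (s i) * thr f (X (s i)) z - ∫ o, w o * thr f (X o) z ∂ν))) := by
  have hpoint (o : Ω) : Filter.Tendsto (fun k => w o * thr (G k) (X o) z) Filter.atTop
      (nhds (w o * thr f (X o) z)) := by
    refine tendsto_const_nhds.congr' ?_
    filter_upwards [hlim (X o)] with k hk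
    simp only [thr, hk]
  have hmean : Filter.Tendsto (fun k => ∫ o, w o * thr (G k) (X o) z ∂ν) Filter.atTop
      (nhds (∫ o, w o * thr f (X o) z ∂ν)) :=
    tendsto_integral_of_dominated_convergence (fun _ => (1 : ℝ))
      (fun k => (hw.mul ((measurable_thr (hG k) z).comp hX)).aestronglyMeasurable)
      (integrable_const _) (fun k => ae_of_all _ fun o => abs_mul_thr_le_one (hw1 o) _ _ _)
      (ae_of_all _ hpoint)
  exact tendsto_finsetSum _ fun i _ => (hpoint (s i)).sub hmean

variable [Nonempty ι] {ℱ : Set (𝒳 → ℝ)}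

theorem measure_thr_deviation_le (hℱ : ∀ f ∈ ℱ, Measurable f) (hℱm : PointwiseMeasurable ℱ)
    (hX : Measurable X) (hw : Measurable w) (hw1 : ∀ o, |w o| ≤ 1) (hz : z ∈ Set.Icc (0 : ℝ) 1)
    {r τ : ℝ} (hr : rademacher (thrClass ℱ) (Fintype.card ι) ≤ r) (hτ : 0 ≤ τ) :
    (Measure.pi fun _ : ι => ν) {s | ∃ f ∈ ℱ, 2 * (Fintype.card ι * r) + τ <
      |∑ i, (w (s i) * thr f (X (s i)) z - ∫ o, w o * thr f (X o) z ∂ν)|} ≤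
      ENNReal.ofReal (Real.exp (-τ ^ 2 / (8 * Fintype.card ι))) := by
  classical
  obtain ⟨𝒢, h𝒢, hcount, happrox⟩ := hℱm
  have := hcount.to_subtype
  let h : 𝒢 → Ω → ℝ := fun g o => w o * thr g (X o) z
  have hm (g : 𝒢) : Measurable (h g) := hw.mul ((measurable_thr (hℱ g (h𝒢 g.2)) z).comp hX)
  have hb (g : 𝒢) (o : Ω) : |h g o| ≤ 1 := abs_mul_thr_le_one (hw1 o) _ _ _
  have hcomplexity (u : ι → Ω) : signMean (fun g i => h g (u i)) ≤ Fintype.card ι * r :=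
    (signMean_mul_thr_le (fun g : 𝒢 => h𝒢 g.2) (fun i => hw1 (u i)) hz _).trans (by gcongr)
  refine (measure_mono ?_).trans (measure_uniformDeviation_ge_le ν hm hb hcomplexity hτ)
  rintro s ⟨f, hf, hlt⟩
  obtain ⟨G, hG, hlim⟩ := happrox f hf z hz
  have hconv := (tendsto_sum_thr_sub_integral ν hX hw hw1 (fun k => hℱ _ (h𝒢 (hG k))) hlim s).abs
  obtain ⟨k, hk⟩ := (hconv.eventually_const_lt hlt).exists
  exact hk.le.trans (le_uniformDeviation ν hb s ⟨G k, hG k⟩)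

theorem measure_thr_mean_deviation_le (hℱ : ∀ f ∈ ℱ, Measurable f)
    (hℱm : PointwiseMeasurable ℱ) (hX : Measurable X) (hw : Measurable w)
    (hw1 : ∀ o, |w o| ≤ 1) (hz : z ∈ Set.Icc (0 : ℝ) 1) {C φ : ℝ} (hφ : φ ≤ 1 / 2)
    (hR : ∀ m : ℕ, 1 ≤ m → rademacher (thrClass ℱ) m ≤ C * (m : ℝ) ^ (-φ)) {δ : ℝ}
    (hδ0 : 0 < δ) :
    (Measure.pi fun _ : ι => ν) {s | ∃ f ∈ ℱ,
      (2 * C + √(8 * Real.log (1 / δ))) * (Fintype.card ι : ℝ) ^ (-φ) <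
      |(1 / (Fintype.card ι : ℝ)) * ∑ i, w (s i) * thr f (X (s i)) z -
        ∫ o, w o * thr f (X o) z ∂ν|} ≤ ENNReal.ofReal δ := by
  rcases le_or_gt 1 δ with hδ1 | hδ1
  · exact prob_le_one.trans (ENNReal.one_le_ofReal.2 hδ1)
  set m : ℝ := (Fintype.card ι : ℝ)
  have hm1 : 1 ≤ m := Nat.one_le_cast.2 Fintype.card_pos
  have hm0 : 0 < m := zero_lt_one.trans_le hm1
  set L := √(8 * Real.log (1 / δ))
  have hL : L ^ 2 = 8 * Real.log (1 / δ) :=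
    Real.sq_sqrt (mul_nonneg (by norm_num) (Real.log_nonneg (one_le_one_div hδ0 hδ1.le)))
  have htail := measure_thr_deviation_le (ι := ι) ν hℱ hℱm hX hw hw1 hz (hR _ Fintype.card_pos)
    (τ := √m * L) (by positivity)
  have hexp : -(√m * L) ^ 2 / (8 * m) = Real.log δ := by
    rw [mul_pow, Real.sq_sqrt hm0.le, hL, one_div, Real.log_inv]
    field_simp
  rw [show (Fintype.card ι : ℝ) = m from rfl, hexp, Real.exp_log hδ0] at htail
  refine (measure_mono ?_).trans htail
  rintro s ⟨f, hf, hlt⟩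
  refine ⟨f, hf, ?_⟩
  have hsqrt : √m ≤ m * m ^ (-φ) := by
    rw [Real.sqrt_eq_rpow, ← Real.rpow_one_add' hm0.le (by linarith)]
    exact Real.rpow_le_rpow_of_exponent_le hm1 (by linarith)
  have hscale : |∑ i, (w (s i) * thr f (X (s i)) z - ∫ o, w o * thr f (X o) z ∂ν)| =
      m * |(1 / m) * ∑ i, w (s i) * thr f (X (s i)) z - ∫ o, w o * thr f (X o) z ∂ν| := by
    rw [← abs_of_pos hm0, ← abs_mul, abs_of_pos hm0, mul_sub, ← mul_assoc,
      mul_one_div_cancel hm0.ne', one_mul, Finset.sum_sub_distrib]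
    simp [m]
  rw [hscale]
  nlinarith [mul_lt_mul_of_pos_left hlt hm0,
    mul_le_mul_of_nonneg_right hsqrt (Real.sqrt_nonneg (8 * Real.log (1 / δ)))]

end ThresholdDeviation

section Hits

variable {ι Ω : Type*} [Fintype ι]

open Classical in
/-- The indices of the observations that fall into `E`, on which the conditional mean given `E` is
estimated. -/
noncomputable def hits (E : Set Ω) (s : ι → Ω) : Finset ι := {i | s i ∈ E}

theorem mem_hits {E : Set Ω} {s : ι → Ω} {i : ι} : i ∈ hits E s ↔ s i ∈ E := by simp [hits]

variable [MeasurableSpace Ω] (P : Measure Ω) {E : Set Ω}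

theorem pi_inter_pi_univ [IsFiniteMeasure P] (hE : MeasurableSet E) (hPE : P E ≠ 0)
    (B : Set (ι → Ω)) :
    (Measure.pi fun _ => P) (B ∩ Set.univ.pi fun _ => E) =
      P E ^ Fintype.card ι * (Measure.pi fun _ => P[|E]) B := by
  have hrestrict : (Measure.pi fun _ : ι => P.restrict E) =
      (P E ^ Fintype.card ι) • Measure.pi fun _ : ι => P[|E] := by
    refine Measure.pi_eq fun t ht => ?_
    simp only [Measure.smul_apply, Measure.pi_pi, smul_eq_mul]
    rw [← Finset.card_univ, ← Finset.prod_const, ← Finset.prod_mul_distrib]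
    refine Finset.prod_congr rfl fun i _ => ?_
    rw [cond_apply hE, ← mul_assoc, ENNReal.mul_inv_cancel hPE (measure_ne_top _ _), one_mul,
      Measure.restrict_apply (ht i), Set.inter_comm]
  rw [← Measure.restrict_apply' (MeasurableSet.univ_pi fun _ => hE), Measure.restrict_pi_pi,
    hrestrict, Measure.smul_apply, smul_eq_mul]

/-- Given which indices hit `E`, the observations there are an i.i.d. sample from `P[|E]`. -/
theorem measure_hits_le [IsProbabilityMeasure P] (hE : MeasurableSet E) (hPE : P E ≠ 0)
    (B : ∀ T : Finset ι, Set (T → Ω)) {δ : ENNReal}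
    (hB : ∀ T : Finset ι, (Measure.pi fun _ : T => P[|E]) (B T) ≤ δ) :
    (Measure.pi fun _ : ι => P) {s | (fun i : hits E s => s i) ∈ B (hits E s)} ≤ δ := by
  classical
  have hsub : {s : ι → Ω | (fun i : hits E s => s i) ∈ B (hits E s)} ⊆
      ⋃ T : Finset ι, (MeasurableEquiv.piEquivPiSubtypeProd (fun _ : ι => Ω) (· ∈ T)) ⁻¹'
        ((B T ∩ Set.univ.pi fun _ => E) ×ˢ (Set.univ.pi fun _ => Eᶜ)) := fun s hs =>
    Set.mem_iUnion.2 ⟨hits E s, ⟨hs, fun i _ => mem_hits (s := s).1 i.2⟩,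
      fun i _ h => i.2 (mem_hits (s := s).2 h)⟩
  have hfix (T : Finset ι) : (Measure.pi fun _ : ι => P)
      ((MeasurableEquiv.piEquivPiSubtypeProd (fun _ : ι => Ω) (· ∈ T)) ⁻¹'
        ((B T ∩ Set.univ.pi fun _ => E) ×ˢ (Set.univ.pi fun _ => Eᶜ))) ≤
      δ * (P E ^ T.card * P Eᶜ ^ (Fintype.card ι - T.card)) := by
    have hbox : (Measure.pi fun _ : T => P) (B T ∩ Set.univ.pi fun _ => E) ≤
        P E ^ T.card * δ := by
      rw [pi_inter_pi_univ P hE hPE, Fintype.card_coe]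
      gcongr
      exact hB T
    rw [(measurePreserving_piEquivPiSubtypeProd (fun _ : ι => P) (· ∈ T)).measure_preimage_equiv,
      Measure.prod_prod, Measure.pi_pi, Finset.prod_const, Finset.card_univ,
      Fintype.card_subtype_compl, Fintype.card_coe, ← mul_assoc, mul_comm δ]
    gcongr
    convert! hbox
  refine (measure_mono hsub).trans ((measure_iUnion_le _).trans ?_)
  rw [tsum_fintype]
  refine (Finset.sum_le_sum fun T _ => hfix T).trans_eq ?_
  rw [← Finset.mul_sum, Fintype.sum_pow_mul_eq_add_pow, measure_add_measure_compl hE,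
    measure_univ, one_pow, mul_one]

end Hits

/-! ### Randomized prediction functions -/

section Mix

variable {α : Type*} (Q : PMF α) {v w : α → ℝ} {b c : ℝ}

theorem summable_toReal_mul (hv : ∀ f, |v f| ≤ b) : Summable fun f => (Q f).toReal * v f := by
  refine Summable.of_norm_bounded ((ENNReal.summable_toReal Q.tsum_coe_ne_top).mul_right b)
    fun f => ?_
  rw [norm_mul, Real.norm_of_nonneg ENNReal.toReal_nonneg]
  exact mul_le_mul_of_nonneg_left (hv f) ENNReal.toReal_nonneg

theorem mix_const (b : ℝ) : mix Q (fun _ => b) = b := by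
  unfold mix
  rw [tsum_mul_right, ← ENNReal.tsum_toReal_eq fun f => Q.apply_ne_top f, Q.tsum_coe]
  simp

theorem mix_mono (hv : ∀ f, |v f| ≤ b) (hw : ∀ f, |w f| ≤ c) (h : ∀ f, v f ≤ w f) :
    mix Q v ≤ mix Q w :=
  (summable_toReal_mul Q hv).tsum_le_tsum
    (fun f => mul_le_mul_of_nonneg_left (h f) ENNReal.toReal_nonneg) (summable_toReal_mul Q hw)

theorem mix_add (hv : ∀ f, |v f| ≤ b) (hw : ∀ f, |w f| ≤ c) :
    mix Q (fun f => v f + w f) = mix Q v + mix Q w := by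
  unfold mix
  rw [← (summable_toReal_mul Q hv).tsum_add (summable_toReal_mul Q hw)]
  simp only [mul_add]

theorem mix_const_mul (v : α → ℝ) (b : ℝ) : mix Q (fun f => b * v f) = b * mix Q v := by
  unfold mix
  rw [← tsum_mul_left]
  simp only [mul_left_comm]

theorem mix_sub (hv : ∀ f, |v f| ≤ b) (hw : ∀ f, |w f| ≤ c) :
    mix Q (fun f => v f - w f) = mix Q v - mix Q w := by
  unfold mix
  rw [← (summable_toReal_mul Q hv).tsum_sub (summable_toReal_mul Q hw)]
  simp only [mul_sub]

theorem abs_mix_le (hv : ∀ f, |v f| ≤ b) : |mix Q v| ≤ b := by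
  have hconst (r : ℝ) (_ : α) : |r| ≤ |r| := le_rfl
  rw [abs_le]
  constructor
  · rw [← mix_const Q (-b)]
    exact mix_mono Q (hconst _) hv fun f => (abs_le.1 (hv f)).1
  · rw [← mix_const Q b]
    exact mix_mono Q hv (hconst _) fun f => (abs_le.1 (hv f)).2

theorem abs_mix_sub_mix_le {e : ℝ} (hv : ∀ f, |v f| ≤ b) (hw : ∀ f, |w f| ≤ c)
    (h : ∀ f, |v f - w f| ≤ e) : |mix Q v - mix Q w| ≤ e := by
  rw [← mix_sub Q hv hw]
  exact abs_mix_le Q h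

theorem mix_map {τ : Type*} [Fintype τ] (p : PMF τ) (g : τ → α) (v : α → ℝ) :
    mix (p.map g) v = ∑ s, (p s).toReal * v (g s) := by
  classical
  have hterm (f : α) : ((p.map g) f).toReal * v f =
      ∑ s, if f = g s then (p s).toReal * v f else 0 := by
    rw [PMF.map_apply, tsum_fintype, ENNReal.toReal_sum fun s _ => by
      split_ifs
      exacts [p.apply_ne_top s, ENNReal.zero_ne_top], Finset.sum_mul]
    refine Finset.sum_congr rfl fun s _ => ?_
    split_ifs <;> simp
  have hsummable (s : τ) : Summable fun f => if f = g s then (p s).toReal * v f else 0 :=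
    (hasSum_ite_eq (g s) ((p s).toReal * v (g s))).summable.congr fun f => by
      split_ifs with h
      exacts [by rw [h], rfl]
  unfold mix
  simp only [hterm]
  rw [Summable.tsum_finsetSum fun s _ => hsummable s]
  simp only [tsum_ite_eq]

end Mix

/-! ### Exponentiated gradient updates -/

section ExponentiatedGradient

variable {α : Type*} [Fintype α]

/-- Hoeffding's lemma for a distribution on a finite set. -/
theorem sum_mul_exp_le {p x : α → ℝ} (hp : ∀ a, 0 ≤ p a) (hp1 : ∑ a, p a = 1) {r : ℝ}
    (hr : 0 ≤ r) (hx : ∀ a, |x a| ≤ r) :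
    ∑ a, p a * Real.exp (x a) ≤ Real.exp (∑ a, p a * x a + r ^ 2 / 2) := by
  let _ : MeasurableSpace α := ⊤
  have hsum : ∑ a, ENNReal.ofReal (p a) = 1 := by
    rw [← ENNReal.ofReal_sum_of_nonneg fun a _ => hp a, hp1, ENNReal.ofReal_one]
  set Q : PMF α := PMF.ofFintype (fun a => ENNReal.ofReal (p a)) hsum
  have hint (y : α → ℝ) : ∫ a, y a ∂Q.toMeasure = ∑ a, p a * y a := by
    rw [PMF.integral_eq_sum]
    simp [Q, ENNReal.toReal_ofReal (hp _)]
  have hmgf := (hasSubgaussianMGF_of_mem_Icc (μ := Q.toMeasure) (X := x) (a := -r) (b := r)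
    measurable_from_top.aemeasurable (ae_of_all _ fun a => abs_le.1 (hx a))).mgf_le 1
  have hparam : (((‖r - -r‖₊ / 2) ^ 2 : NNReal) : ℝ) = r ^ 2 := by
    push_cast
    rw [Real.norm_of_nonneg (by linarith)]
    ring
  rw [mgf, hint, hint, hparam] at hmgf
  simp only [one_mul, one_pow, mul_one, Real.exp_sub, mul_div_assoc', ← Finset.sum_div] at hmgf
  rwa [div_le_iff₀ (Real.exp_pos _), ← Real.exp_add, add_comm] at hmgf

/-- The potential `1 + ∑_k exp θ_k` of the exponentiated gradient updates; the `1` belongs to the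
unused part of the budget `‖λ‖₁ ≤ B`. -/
def expPotential (θ : α → ℝ) : ℝ := 1 + ∑ k, Real.exp (θ k)

/-- The weights `exp θ_k / (1 + ∑_k' exp θ_k')` of the exponentiated gradient updates. -/
def expWeight (θ : α → ℝ) (k : α) : ℝ := Real.exp (θ k) / expPotential θ

theorem one_le_expPotential (θ : α → ℝ) : 1 ≤ expPotential θ :=
  le_add_of_nonneg_right (Finset.sum_nonneg fun _ _ => (Real.exp_pos _).le)

theorem expPotential_pos (θ : α → ℝ) : 0 < expPotential θ :=
  zero_lt_one.trans_le (one_le_expPotential θ)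

theorem le_log_expPotential (θ : α → ℝ) (k : α) : θ k ≤ Real.log (expPotential θ) := by
  rw [Real.le_log_iff_exp_le (expPotential_pos θ)]
  refine (Finset.single_le_sum (f := fun k => Real.exp (θ k)) (fun k _ => (Real.exp_pos _).le)
    (Finset.mem_univ k)).trans ?_
  exact le_add_of_nonneg_left zero_le_one

theorem expWeight_nonneg (θ : α → ℝ) (k : α) : 0 ≤ expWeight θ k :=
  div_nonneg (Real.exp_pos _).le (expPotential_pos θ).le

theorem one_div_expPotential_add_sum_expWeight (θ : α → ℝ) :
    1 / expPotential θ + ∑ k, expWeight θ k = 1 := by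
  simp only [expWeight]
  rw [← Finset.sum_div, ← add_div]
  exact div_self (expPotential_pos θ).ne'

theorem sum_expWeight_le_one (θ : α → ℝ) : ∑ k, expWeight θ k ≤ 1 := by
  linarith [one_div_expPotential_add_sum_expWeight θ, one_div_pos.2 (expPotential_pos θ)]

theorem expPotential_add_le (θ : α → ℝ) {u : α → ℝ} {r : ℝ} (hr : 0 ≤ r) (hu : ∀ k, |u k| ≤ r) :
    expPotential (θ + u) ≤
      expPotential θ * Real.exp (∑ k, expWeight θ k * u k + r ^ 2 / 2) := by
  have hZ := expPotential_pos θ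
  have hsplit : expPotential (θ + u) =
      expPotential θ * (1 / expPotential θ + ∑ k, expWeight θ k * Real.exp (u k)) := by
    rw [mul_add, mul_one_div_cancel hZ.ne', Finset.mul_sum, expPotential]
    refine congrArg (1 + ·) (Finset.sum_congr rfl fun k _ => ?_)
    rw [Pi.add_apply, Real.exp_add, expWeight, ← mul_assoc, mul_div_cancel₀ _ hZ.ne']
  have hoeffding := sum_mul_exp_le (α := Option α)
    (p := fun a => a.elim (1 / expPotential θ) (expWeight θ)) (x := fun a => a.elim 0 u)
    (Option.rec (one_div_pos.2 hZ).le (expWeight_nonneg θ))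
    (by simpa only [Fintype.sum_option, Option.elim] using
      one_div_expPotential_add_sum_expWeight θ) hr
    (Option.rec (by simpa using hr) hu)
  simp only [Fintype.sum_option, Option.elim, Real.exp_zero, mul_one, mul_zero,
    zero_add] at hoeffding
  rw [hsplit]
  gcongr

variable {η r : ℝ} {θ v : ℕ → α → ℝ}

theorem log_expPotential_le (hη : 0 ≤ η) (hr : 0 ≤ r) (h0 : θ 0 = 0)
    (hstep : ∀ t, θ (t + 1) = θ t + η • v t) (hv : ∀ t k, |v t k| ≤ r) (T : ℕ) :
    Real.log (expPotential (θ T)) ≤ Real.log (1 + Fintype.card α) +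
      (η * ∑ t ∈ Finset.range T, ∑ k, expWeight (θ t) k * v t k + T * ((η * r) ^ 2 / 2)) := by
  induction T with
  | zero => simp [expPotential, h0]
  | succ T ih =>
    have hu (k : α) : |(η • v T) k| ≤ η * r := by
      rw [Pi.smul_apply, smul_eq_mul, abs_mul, abs_of_nonneg hη]
      exact mul_le_mul_of_nonneg_left (hv T k) hη
    have hlog := Real.log_le_log (expPotential_pos _)
      (expPotential_add_le (θ T) (mul_nonneg hη hr) hu)
    rw [← hstep, Real.log_mul (expPotential_pos _).ne' (Real.exp_pos _).ne', Real.log_exp] at hlog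
    simp only [Pi.smul_apply, smul_eq_mul, mul_left_comm _ η, ← Finset.mul_sum] at hlog
    rw [Finset.sum_range_succ, mul_add]
    push_cast
    linarith

theorem exponentiated_gradient_regret (hη : 0 < η) (hr : 0 ≤ r) (h0 : θ 0 = 0)
    (hstep : ∀ t, θ (t + 1) = θ t + η • v t) (hv : ∀ t k, |v t k| ≤ r) {B : ℝ} {lam : α → ℝ}
    (hlam : ∀ k, 0 ≤ lam k) (hB : ∑ k, lam k ≤ B) (T : ℕ) :
    ∑ t ∈ Finset.range T, ∑ k, lam k * v t k ≤
      B * ∑ t ∈ Finset.range T, ∑ k, expWeight (θ t) k * v t k +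
        B * Real.log (1 + Fintype.card α) / η + T * (η * r ^ 2 * B / 2) := by
  have hθ (k : α) : θ T k = η * ∑ t ∈ Finset.range T, v t k := by
    induction T with
    | zero => simp [h0]
    | succ T ih =>
      rw [hstep, Finset.sum_range_succ, mul_add, ← ih]
      simp
  have hB0 : 0 ≤ B := (Finset.sum_nonneg fun k _ => hlam k).trans hB
  refine le_of_mul_le_mul_left ?_ hη
  calc η * ∑ t ∈ Finset.range T, ∑ k, lam k * v t k = ∑ k, lam k * θ T k := by
        rw [Finset.sum_comm, Finset.mul_sum]
        refine Finset.sum_congr rfl fun k _ => ?_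
        rw [hθ, ← Finset.mul_sum]
        ring
    _ ≤ ∑ k, lam k * Real.log (expPotential (θ T)) := by
        gcongr with k
        exacts [hlam k, le_log_expPotential (θ T) k]
    _ ≤ B * Real.log (expPotential (θ T)) := by
        rw [← Finset.sum_mul]
        gcongr
        exact Real.log_nonneg (one_le_expPotential (θ T))
    _ ≤ B * (Real.log (1 + Fintype.card α) +
          (η * ∑ t ∈ Finset.range T, ∑ k, expWeight (θ t) k * v t k +
            T * ((η * r) ^ 2 / 2))) := by
        gcongr
        exact log_expPotential_le hη.le hr h0 hstep hv T
    _ = η * (B * ∑ t ∈ Finset.range T, ∑ k, expWeight (θ t) k * v t k +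
          B * Real.log (1 + Fintype.card α) / η + T * (η * r ^ 2 * B / 2)) := by
        field_simp
        ring

end ExponentiatedGradient

/-! ### The saddle point algorithm -/

namespace AlgInput

variable {𝒳 : Type*} {n : ℕ} {ℱ : Set (𝒳 → ℝ)} (I : AlgInput 𝒳 n)

/-- The multiplier vectors available to the `λ`-player: `λ ≥ 0` and `‖λ‖₁ ≤ B_λ`. -/
def Feasible (lam : Fin 3 → ℝ) : Prop := (∀ k, 0 ≤ lam k) ∧ ∑ k, lam k ≤ I.Blam

theorem lagrangian_eq (ξ d c : ℝ) (lam : Fin 3 → ℝ) :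
    I.lagrangian ξ d c lam =
      ξ * (1 - lam 0 - lam 1) + ((lam 0 - lam 1) * d + lam 2 * c) - lam 2 * I.epsHat := by
  simp only [lagrangian, viol, Fin.sum_univ_three, Matrix.cons_val_zero, Matrix.cons_val_one,
    Matrix.cons_val]
  ring

theorem bestXi_mem (hB : 0 ≤ I.Bxi) (lam : Fin 3 → ℝ) : I.bestXi lam ∈ Set.Icc 0 I.Bxi := by
  unfold bestXi
  split_ifs <;> simp [hB]

theorem bestXi_mul_le (lam : Fin 3 → ℝ) {ξ : ℝ} (hξ : ξ ∈ Set.Icc 0 I.Bxi) :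
    I.bestXi lam * (1 - lam 0 - lam 1) ≤ ξ * (1 - lam 0 - lam 1) := by
  unfold bestXi
  split_ifs with h
  · exact mul_le_mul_of_nonpos_right hξ.2 h.le
  · rw [zero_mul]
    exact mul_nonneg hξ.1 (not_lt.1 h)

/-- The Lagrangian with multipliers `lam'`, at the best response of the `(ξ, h)`-player to
`lam`. -/
def responseLagrangian (best : (Fin 3 → ℝ) → ℱ) (lam lam' : Fin 3 → ℝ) : ℝ :=
  I.lagrangian (I.bestXi lam) (I.dispHat (best lam)) (I.costHat (best lam)) lam'

variable {I} {η : ℝ} {best : (Fin 3 → ℝ) → ℱ} {lam : Fin 3 → ℝ}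

theorem responseLagrangian_self_le (hbest : I.IsBestH ℱ best) (hlam : I.Feasible lam) {ξ : ℝ}
    (hξ : ξ ∈ Set.Icc 0 I.Bxi) (f : ℱ) :
    I.responseLagrangian best lam lam ≤ I.lagrangian ξ (I.dispHat f) (I.costHat f) lam := by
  rw [responseLagrangian, lagrangian_eq, lagrangian_eq]
  linarith [I.bestXi_mul_le lam hξ, hbest lam hlam.1 hlam.2 f]

theorem responseLagrangian_self_le_mix (hbest : I.IsBestH ℱ best) (hlam : I.Feasible lam) {ξ : ℝ}
    (hξ : ξ ∈ Set.Icc 0 I.Bxi) {bd bc : ℝ} (hd : ∀ f : ℱ, |I.dispHat f| ≤ bd)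
    (hc : ∀ f : ℱ, |I.costHat f| ≤ bc) (Q : PMF ℱ) :
    I.responseLagrangian best lam lam ≤ I.lagrangian ξ (I.dispHatQ Q) (I.costHatQ Q) lam := by
  have hd' (f : ℱ) : |(lam 0 - lam 1) * I.dispHat f| ≤ |lam 0 - lam 1| * bd := by
    rw [abs_mul]
    exact mul_le_mul_of_nonneg_left (hd f) (abs_nonneg _)
  have hc' (f : ℱ) : |lam 2 * I.costHat f| ≤ |lam 2| * bc := by
    rw [abs_mul]
    exact mul_le_mul_of_nonneg_left (hc f) (abs_nonneg _)
  have hpoint (f : ℱ) : I.responseLagrangian best lam lam - ξ * (1 - lam 0 - lam 1) +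
      lam 2 * I.epsHat ≤ (lam 0 - lam 1) * I.dispHat f + lam 2 * I.costHat f := by
    have hf := responseLagrangian_self_le hbest hlam hξ f
    rw [I.lagrangian_eq ξ] at hf
    linarith
  have hmix := mix_mono Q (fun _ => le_rfl)
    (fun f => (abs_add_le _ _).trans (add_le_add (hd' f) (hc' f))) hpoint
  rw [mix_const, mix_add Q hd' hc', mix_const_mul, mix_const_mul] at hmix
  rw [lagrangian_eq, dispHatQ, costHatQ]
  linarith

theorem Feasible.sum_mul_le (hlam : I.Feasible lam) {v : Fin 3 → ℝ} {b : ℝ} (hv : ∀ k, v k ≤ b)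
    (hb : 0 ≤ b) : ∑ k, lam k * v k ≤ I.Blam * b :=
  calc ∑ k, lam k * v k ≤ ∑ k, lam k * b :=
        Finset.sum_le_sum fun k _ => mul_le_mul_of_nonneg_left (hv k) (hlam.1 k)
    _ ≤ I.Blam * b := by
        rw [← Finset.sum_mul]
        exact mul_le_mul_of_nonneg_right hlam.2 hb

theorem Feasible.sum_mul_le_bestLam (hlam : I.Feasible lam) (v : Fin 3 → ℝ) :
    ∑ k, lam k * v k ≤ ∑ k, I.bestLam v k * v k := by
  unfold bestLam
  split_ifs with hneg h0 h1
  · simpa using hlam.sum_mul_le hneg le_rfl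
  all_goals
    push Not at hneg
    obtain ⟨i, hi⟩ := hneg
  · have hmax : ∀ k, v k ≤ v 0 := Fin.forall_fin_succ.2 ⟨le_rfl, by simpa [Fin.forall_fin_two]⟩
    simpa [Fin.sum_univ_three] using hlam.sum_mul_le hmax (hi.le.trans (hmax i))
  · have hmax : ∀ k, v k ≤ v 1 := by
      simp only [Fin.forall_fin_succ, Fin.forall_fin_zero]
      grind
    simpa [Fin.sum_univ_three] using hlam.sum_mul_le hmax (hi.le.trans (hmax i))
  · have hmax : ∀ k, v k ≤ v 2 := by
      simp only [Fin.forall_fin_succ, Fin.forall_fin_zero]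
      grind
    simpa [Fin.sum_univ_three] using hlam.sum_mul_le hmax (hi.le.trans (hmax i))

theorem feasible_single (hB : 0 ≤ I.Blam) (k : Fin 3) : I.Feasible (Pi.single k I.Blam) := by
  refine ⟨fun j => ?_, by simp⟩
  rw [Pi.single_apply]
  split_ifs
  exacts [hB, le_rfl]

theorem bestLam_feasible (hB : 0 ≤ I.Blam) (v : Fin 3 → ℝ) : I.Feasible (I.bestLam v) := by
  unfold bestLam
  split_ifs
  · exact ⟨fun _ => le_rfl, by simpa using hB⟩
  all_goals
    refine ⟨fun k => ?_, by simp [Fin.sum_univ_three]⟩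
    fin_cases k <;> simp [hB]

theorem weights_apply (θ : Fin 3 → ℝ) (k : Fin 3) :
    I.weights θ k = I.Blam * expWeight θ k :=
  mul_div_assoc _ _ _

theorem weights_feasible (hB : 0 ≤ I.Blam) (θ : Fin 3 → ℝ) : I.Feasible (I.weights θ) := by
  simp only [Feasible, weights_apply, ← Finset.mul_sum]
  exact ⟨fun k => mul_nonneg hB (expWeight_nonneg θ k),
    mul_le_of_le_one_right hB (sum_expWeight_le_one θ)⟩

section Run

theorem average_const (t : ℕ) (b : ℝ) :
    (1 / ((t : ℝ) + 1)) * ∑ _s ∈ Finset.range (t + 1), b = b := by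
  rw [Finset.sum_const, Finset.card_range, nsmul_eq_mul, Nat.cast_succ, ← mul_assoc,
    one_div_mul_cancel (Nat.cast_add_one_ne_zero t), one_mul]

variable (I) (η) (best)

theorem mix_QHat (t : ℕ) (v : ℱ → ℝ) : mix (I.QHat η best t) v =
    (1 / ((t : ℝ) + 1)) * ∑ s ∈ Finset.range (t + 1), v (best (I.lamAt η best s)) := by
  have hmap : I.QHat η best t = (PMF.uniformOfFintype (Fin (t + 1))).map
      fun s : Fin (t + 1) => best (I.lamAt η best s) := by
    -- In `QHat` the index is coerced to `ℕ` inside the monad, which hides a `PMF.bind`.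
    change PMF.map _ (PMF.bind _ fun a => PMF.pure _) = _
    rw [PMF.map_bind]
    simp only [PMF.pure_map]
    exact PMF.bind_pure_comp _ _
  rw [hmap, mix_map, ← Fin.sum_univ_eq_sum_range (fun s => v (best (I.lamAt η best s))),
    Finset.mul_sum]
  simp [ENNReal.toReal_add]

theorem lagrangian_average (t : ℕ) (lam : Fin 3 → ℝ) :
    I.lagrangian (I.xiHat η best t) (I.dispHatQ (I.QHat η best t)) (I.costHatQ (I.QHat η best t))
      lam = (1 / ((t : ℝ) + 1)) * ∑ s ∈ Finset.range (t + 1),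
        I.responseLagrangian best (I.lamAt η best s) lam := by
  simp only [responseLagrangian, lagrangian_eq]
  rw [Finset.sum_sub_distrib, mul_sub (1 / _), average_const]
  simp only [dispHatQ, costHatQ, mix_QHat, xiHat, Finset.sum_add_distrib, ← Finset.sum_mul,
    ← Finset.mul_sum]
  ring

theorem lagrangian_lamHat (t : ℕ) (ξ d c : ℝ) :
    I.lagrangian ξ d c (I.lamHat η best t) = (1 / ((t : ℝ) + 1)) * ∑ s ∈ Finset.range (t + 1),
      I.lagrangian ξ d c (I.lamAt η best s) := by
  simp only [lagrangian, lamHat, Pi.smul_apply, smul_eq_mul, Finset.sum_apply,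
    Finset.sum_add_distrib, mul_add, average_const]
  rw [Finset.sum_comm]
  simp only [← Finset.sum_mul, mul_assoc, ← Finset.mul_sum]

variable {I}

theorem lamHat_feasible (hB : 0 ≤ I.Blam) (t : ℕ) : I.Feasible (I.lamHat η best t) := by
  have hlam (s : ℕ) : I.Feasible (I.lamAt η best s) := weights_feasible hB _
  have ht : 0 ≤ 1 / ((t : ℝ) + 1) := by positivity
  simp only [Feasible, lamHat, Pi.smul_apply, smul_eq_mul, Finset.sum_apply]
  refine ⟨fun k => mul_nonneg ht (Finset.sum_nonneg fun s _ => (hlam s).1 k), ?_⟩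
  rw [← Finset.mul_sum, Finset.sum_comm, ← average_const t I.Blam]
  exact mul_le_mul_of_nonneg_left (Finset.sum_le_sum fun s _ => (hlam s).2) ht

theorem xiHat_mem (hB : 0 ≤ I.Bxi) (t : ℕ) : I.xiHat η best t ∈ Set.Icc 0 I.Bxi := by
  have ht : 0 ≤ 1 / ((t : ℝ) + 1) := by positivity
  refine ⟨mul_nonneg ht (Finset.sum_nonneg fun s _ => (bestXi_mem I hB _).1), ?_⟩
  rw [← average_const t I.Bxi]
  exact mul_le_mul_of_nonneg_left (Finset.sum_le_sum fun s _ => (bestXi_mem I hB _).2) ht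

variable {η best}

theorem responseLagrangian_lamHat_le (hbest : I.IsBestH ℱ best) (hBl : 0 ≤ I.Blam)
    (hBx : 0 ≤ I.Bxi) (t : ℕ) :
    I.responseLagrangian best (I.lamHat η best t) (I.lamHat η best t) ≤
      I.lagrangian (I.xiHat η best t) (I.dispHatQ (I.QHat η best t))
        (I.costHatQ (I.QHat η best t)) (I.lamHat η best t) := by
  rw [lagrangian_average, ← average_const t (I.responseLagrangian best _ _)]
  gcongr
  exact responseLagrangian_self_le hbest (lamHat_feasible η best hBl t) (bestXi_mem I hBx _) _

theorem sum_responseLagrangian_le (hBx : 0 ≤ I.Bxi) (hη : 0 < η)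
    {r : ℝ} (hr0 : 0 ≤ r) (hr : ∀ (f : ℱ), ∀ ξ ∈ Set.Icc (0 : ℝ) I.Bxi, ∀ k,
      |I.viol ξ (I.dispHat f) (I.costHat f) k| ≤ r) (hlam : I.Feasible lam) (T : ℕ) :
    ∑ s ∈ Finset.range T, I.responseLagrangian best (I.lamAt η best s) lam ≤
      ∑ s ∈ Finset.range T, I.responseLagrangian best (I.lamAt η best s) (I.lamAt η best s) +
        I.Blam * Real.log 4 / η + T * (η * r ^ 2 * I.Blam / 2) := by
  have hregret := exponentiated_gradient_regret (θ := I.theta η best) hη hr0 rfl (fun _ => rfl)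
    (fun s => hr (best (I.lamAt η best s)) _ (bestXi_mem I hBx _)) hlam.1 hlam.2 T
  have hcard : (1 : ℝ) + Fintype.card (Fin 3) = 4 := by norm_num
  simp only [Finset.mul_sum, ← mul_assoc, ← weights_apply, hcard] at hregret
  simp only [responseLagrangian, lagrangian, lamAt, Finset.sum_add_distrib]
  linarith

theorem lagrangian_bestLam_le (hbest : I.IsBestH ℱ best) (hBl : 0 ≤ I.Blam) (hBx : 0 ≤ I.Bxi)
    (hη : 0 < η) {r : ℝ} (hr0 : 0 ≤ r) (hr : ∀ (f : ℱ), ∀ ξ ∈ Set.Icc (0 : ℝ) I.Bxi, ∀ k,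
      |I.viol ξ (I.dispHat f) (I.costHat f) k| ≤ r) (hlam : I.Feasible lam) (t : ℕ) :
    I.lagrangian (I.xiHat η best t) (I.dispHatQ (I.QHat η best t)) (I.costHatQ (I.QHat η best t))
      lam ≤ I.responseLagrangian best (I.lamHat η best t) (I.lamHat η best t) +
        (I.Blam * Real.log 4 / (η * (t + 1)) + η * r ^ 2 * I.Blam / 2) := by
  have hresponse : ∑ s ∈ Finset.range (t + 1),
      I.responseLagrangian best (I.lamAt η best s) (I.lamAt η best s) ≤
        ∑ s ∈ Finset.range (t + 1),
          I.responseLagrangian best (I.lamHat η best t) (I.lamAt η best s) :=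
    Finset.sum_le_sum fun s _ => responseLagrangian_self_le hbest (weights_feasible hBl _)
      (bestXi_mem I hBx _) _
  calc _ ≤ (1 / ((t : ℝ) + 1)) * (∑ s ∈ Finset.range (t + 1),
          I.responseLagrangian best (I.lamHat η best t) (I.lamAt η best s) +
        I.Blam * Real.log 4 / η + (t + 1 : ℕ) * (η * r ^ 2 * I.Blam / 2)) := by
        rw [lagrangian_average]
        gcongr
        exact (sum_responseLagrangian_le hBx hη hr0 hr hlam _).trans (by gcongr)
    _ = _ := by
        simp only [responseLagrangian]
        rw [lagrangian_lamHat]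
        push_cast
        field_simp
        ring

theorem gap_le (hbest : I.IsBestH ℱ best) (hBl : 0 ≤ I.Blam) (hBx : 0 ≤ I.Bxi) (hη : 0 < η)
    {r : ℝ} (hr0 : 0 ≤ r) (hr : ∀ (f : ℱ), ∀ ξ ∈ Set.Icc (0 : ℝ) I.Bxi, ∀ k,
      |I.viol ξ (I.dispHat f) (I.costHat f) k| ≤ r) (t : ℕ) :
    I.gap η best t ≤ I.Blam * Real.log 4 / (η * (t + 1)) + η * r ^ 2 * I.Blam / 2 := by
  have hlower := responseLagrangian_lamHat_le (η := η) hbest hBl hBx t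
  have hupper {lam} (hlam : I.Feasible lam) :=
    lagrangian_bestLam_le hbest hBl hBx hη hr0 hr hlam t
  have hlamHat := hupper (lamHat_feasible η best hBl t)
  refine max_le ?_ ?_
  · exact sub_le_iff_le_add'.2 hlamHat
  · exact sub_le_iff_le_add'.2 ((hupper (bestLam_feasible hBl _)).trans (by gcongr))

theorem exists_stopsAt (hbest : I.IsBestH ℱ best) (hBl : 0 < I.Blam) (hBx : 0 ≤ I.Bxi)
    (hnu : 0 < I.nu) {r : ℝ} (hr0 : 0 < r) (hη : η = I.nu / (2 * r ^ 2 * I.Blam))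
    (hr : ∀ (f : ℱ), ∀ ξ ∈ Set.Icc (0 : ℝ) I.Bxi, ∀ k,
      |I.viol ξ (I.dispHat f) (I.costHat f) k| ≤ r) :
    ∃ t : ℕ, I.StopsAt η best t ∧
      ((t + 1 : ℕ) : ℝ) ≤ 4 * r ^ 2 * I.Blam ^ 2 * Real.log 4 / I.nu ^ 2 + 1 := by
  classical
  have hη0 : 0 < η := by rw [hη]; positivity
  set X := 4 * r ^ 2 * I.Blam ^ 2 * Real.log 4 / I.nu ^ 2 with hX
  have hgap : I.gap η best ⌊X⌋₊ ≤ I.nu := by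
    have hstep : η * r ^ 2 * I.Blam / 2 = I.nu / 4 := by
      rw [hη]
      field_simp
      norm_num
    have hcount : I.Blam * Real.log 4 / (η * ((⌊X⌋₊ : ℝ) + 1)) ≤ I.nu / 2 := by
      have hηX : I.Blam * Real.log 4 = I.nu / 2 * (η * X) := by
        rw [hX, hη]
        field_simp
        norm_num
      rw [div_le_iff₀ (by positivity), hηX]
      gcongr
      exact (Nat.lt_floor_add_one X).le
    linarith [gap_le hbest hBl.le hBx hη0 hr0.le hr ⌊X⌋₊]
  have hex : ∃ t, I.gap η best t ≤ I.nu := ⟨_, hgap⟩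
  refine ⟨Nat.find hex, ⟨Nat.find_spec hex, fun s hs => not_le.1 (Nat.find_min hex hs)⟩, ?_⟩
  have hfind : (Nat.find hex : ℝ) ≤ ⌊X⌋₊ := Nat.cast_le.2 (Nat.find_min' hex hgap)
  have hfloor : (⌊X⌋₊ : ℝ) ≤ X := Nat.floor_le (by positivity)
  push_cast
  linarith

theorem lagrangian_le_abs_dispHatQ {Q : PMF ℱ} (hlam : I.Feasible lam)
    (hQ : I.costHatQ Q ≤ I.epsHat) :
    I.lagrangian |I.dispHatQ Q| (I.dispHatQ Q) (I.costHatQ Q) lam ≤ |I.dispHatQ Q| := by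
  have hpos := mul_le_mul_of_nonneg_left (le_abs_self (I.dispHatQ Q)) (hlam.1 0)
  have hneg := mul_le_mul_of_nonneg_left (neg_abs_le (I.dispHatQ Q)) (hlam.1 1)
  have hcost := mul_le_mul_of_nonneg_left hQ (hlam.1 2)
  rw [lagrangian_eq]
  linarith

theorem saddle_value_le (hbest : I.IsBestH ℱ best) (hBl : 0 ≤ I.Blam)
    (hd : ∀ f : ℱ, |I.dispHat f| ≤ I.Bxi) {bc : ℝ} (hc : ∀ f : ℱ, |I.costHat f| ≤ bc)
    {t : ℕ} (hgap : I.gap η best t ≤ I.nu) {Q : PMF ℱ} (hQ : I.costHatQ Q ≤ I.epsHat)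
    (hlam : I.Feasible lam) :
    I.lagrangian (I.xiHat η best t) (I.dispHatQ (I.QHat η best t)) (I.costHatQ (I.QHat η best t))
      lam ≤ |I.dispHatQ Q| + 2 * I.nu := by
  obtain ⟨hlower, hupper⟩ := max_le_iff.1 hgap
  have hlamHat := lamHat_feasible η best hBl t
  have hQresponse := responseLagrangian_self_le_mix hbest hlamHat
    ⟨abs_nonneg _, abs_mix_le Q hd⟩ hd hc Q
  have hQvalue := lagrangian_le_abs_dispHatQ hlamHat hQ
  have hbestLam := hlam.sum_mul_le_bestLam (I.viol (I.xiHat η best t)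
    (I.dispHatQ (I.QHat η best t)) (I.costHatQ (I.QHat η best t)))
  simp only [responseLagrangian, dispHatQ, costHatQ, lagrangian] at *
  linarith

theorem saddle_guarantee (hbest : I.IsBestH ℱ best) (hBl : 0 < I.Blam) (hBx : 0 ≤ I.Bxi)
    (hd : ∀ f : ℱ, |I.dispHat f| ≤ I.Bxi) {bc : ℝ} (hc : ∀ f : ℱ, |I.costHat f| ≤ bc)
    {t : ℕ} (hgap : I.gap η best t ≤ I.nu) {Q : PMF ℱ} (hQ : I.costHatQ Q ≤ I.epsHat) :
    I.costHatQ (I.QHat η best t) ≤ I.epsHat + (I.Bxi + 2 * I.nu) / I.Blam ∧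
    |I.dispHatQ (I.QHat η best t)| ≤
      |I.dispHatQ Q| + 2 * I.nu + (I.Bxi + 2 * I.nu) / I.Blam := by
  have hvalue {lam} (hlam : I.Feasible lam) := saddle_value_le hbest hBl.le hd hc hgap hQ hlam
  have hQ_le : |I.dispHatQ Q| ≤ I.Bxi := abs_mix_le Q hd
  have hξ : I.xiHat η best t ≤ |I.dispHatQ Q| + 2 * I.nu := by
    simpa [lagrangian] using hvalue ⟨fun _ => le_rfl, by simpa using hBl.le⟩
  have hviol (k : Fin 3) : I.viol (I.xiHat η best t) (I.dispHatQ (I.QHat η best t))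
      (I.costHatQ (I.QHat η best t)) k ≤ (I.Bxi + 2 * I.nu) / I.Blam := by
    have hk := hvalue (feasible_single hBl.le k)
    simp only [lagrangian, Pi.single_apply, ite_mul, zero_mul, Finset.sum_ite_eq',
      Finset.mem_univ, if_true] at hk
    rw [le_div_iff₀ hBl]
    linarith [(xiHat_mem η best hBx t).1]
  have hplus := hviol 0
  have hminus := hviol 1
  have hcost := hviol 2
  simp only [viol, Matrix.cons_val_zero, Matrix.cons_val_one, Matrix.cons_val]
    at hplus hminus hcost
  exact ⟨by linarith, abs_le.2 ⟨by linarith, by linarith⟩⟩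

end Run

end AlgInput

/-! ### Discretization -/

theorem abs_mean_le {ι : Type*} {s : Finset ι} {m : ℕ} (hs : s.card = m) {v : ι → ℝ} {e : ℝ}
    (he : 0 ≤ e) (hv : ∀ i ∈ s, |v i| ≤ e) : |(1 / (m : ℝ)) * ∑ i ∈ s, v i| ≤ e := by
  rw [abs_mul, abs_of_nonneg (by positivity), one_div_mul_eq_div]
  refine div_le_of_le_mul₀ m.cast_nonneg he ((Finset.abs_sum_le_sum_abs _ _).trans ?_)
  rw [mul_comm, ← nsmul_eq_mul, ← hs]
  exact Finset.sum_le_card_nsmul s _ e hv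

/-- A `[0,1]`-valued loss on `[0,1]²` that is 1-Lipschitz in the `ℓ₁`-norm. -/
structure UnitLipschitzLoss (l : ℝ → ℝ → ℝ) : Prop where
  mem_Icc : ∀ y ∈ Set.Icc (0 : ℝ) 1, ∀ u ∈ Set.Icc (0 : ℝ) 1, l y u ∈ Set.Icc (0 : ℝ) 1
  lipschitz : ∀ y ∈ Set.Icc (0 : ℝ) 1, ∀ y' ∈ Set.Icc (0 : ℝ) 1,
    ∀ u ∈ Set.Icc (0 : ℝ) 1, ∀ u' ∈ Set.Icc (0 : ℝ) 1, |l y u - l y' u'| ≤ |y - y'| + |u - u'|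

theorem lowerY_spec {N : ℕ} {cover : Finset ℝ} {y : ℝ}
    (h : ∃ t ∈ cover, |y - t| ≤ 1 / (2 * (N : ℝ))) :
    lowerY N cover y ∈ cover ∧ |y - lowerY N cover y| ≤ 1 / (2 * (N : ℝ)) :=
  Set.Nonempty.csInf_mem (s := {t : ℝ | t ∈ cover ∧ |y - t| ≤ 1 / (2 * (N : ℝ))}) h
    (cover.finite_toSet.subset fun _ ht => ht.1)

section Grid

variable {N : ℕ} {y : ℝ}

theorem floor_mul_le (hy : y ≤ 1) : ⌊N * y⌋₊ ≤ N :=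
  Nat.floor_le_of_le (mul_le_of_le_one_right N.cast_nonneg hy)

theorem floor_mul_div_le (hN : 0 < N) (hy : 0 ≤ y) : (⌊N * y⌋₊ : ℝ) / N ≤ y := by
  rw [div_le_iff₀' (Nat.cast_pos.2 hN)]
  exact Nat.floor_le (by positivity)

theorem le_floor_mul_div_add (hN : 0 < N) : y ≤ (⌊N * y⌋₊ : ℝ) / N + 1 / N := by
  rw [← add_div, le_div_iff₀' (Nat.cast_pos.2 hN)]
  exact (Nat.lt_floor_add_one _).le

theorem sum_mul_thr_grid {𝒳 : Type*} (hN : 0 < N) {f : 𝒳 → ℝ} {x : 𝒳}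
    (hf : f x ∈ Set.Icc (0 : ℝ) 1) (a : ℕ → ℝ) :
    ∑ j ∈ Finset.Icc 1 N, a j * thr f x ((j : ℝ) / N) = ∑ j ∈ Finset.Icc 1 ⌊N * f x⌋₊, a j := by
  have hthr (j : ℕ) : (j : ℝ) / N ≤ f x ↔ j ≤ ⌊N * f x⌋₊ := by
    rw [Nat.le_floor_iff (mul_nonneg N.cast_nonneg hf.1), div_le_iff₀' (Nat.cast_pos.2 hN)]
  have hfloor : ⌊N * f x⌋₊ ≤ N := floor_mul_le hf.2
  simp only [thr, hthr, mul_ite, mul_one, mul_zero, ← Finset.sum_filter]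
  congr 1
  ext j
  simp only [Finset.mem_filter, Finset.mem_Icc]
  omega

theorem abs_grid_mean_sub_le {𝒳 : Type*} (hN : 0 < N) {f : 𝒳 → ℝ} {x : 𝒳}
    (hf : f x ∈ Set.Icc (0 : ℝ) 1) :
    |(1 / (N : ℝ)) * ∑ j ∈ Finset.Icc 1 N, thr f x ((j : ℝ) / N) - f x| ≤ 1 / N := by
  have hcount := sum_mul_thr_grid hN hf fun _ => 1
  simp only [one_mul, Finset.sum_const, Nat.card_Icc, nsmul_eq_mul, mul_one,
    Nat.add_sub_cancel] at hcount
  rw [hcount, one_div_mul_eq_div, abs_sub_comm,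
    abs_of_nonneg (sub_nonneg.2 (floor_mul_div_le hN hf.1)), sub_le_iff_le_add']
  exact le_floor_mul_div_add hN

theorem sum_costWeight_grid (l : ℝ → ℝ → ℝ) (y : ℝ) {K : ℕ} (hK : K ≤ N) :
    (1 / (N : ℝ)) * ∑ j ∈ Finset.Icc 1 K, costWeight l N y ((j : ℝ) / N) =
      l y (min ((K : ℝ) / N + 1 / (2 * (N : ℝ))) 1) - l y (1 / (2 * (N : ℝ))) := by
  induction K with
  | zero =>
    have hhalf : 1 / (2 * (N : ℝ)) ≤ 1 := by
      rw [one_div]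
      exact_mod_cast Nat.cast_inv_le_one (2 * N)
    rw [Nat.cast_zero, zero_div, zero_add, min_eq_left hhalf]
    simp
  | succ K ih =>
    have hN : (0 : ℝ) < N := Nat.cast_pos.2 (by omega)
    have hle : ((K + 1 : ℕ) : ℝ) / N ≤ 1 := (div_le_one hN).2 (Nat.cast_le.2 hK)
    have hpred : (K : ℝ) / N + 1 / (2 * (N : ℝ)) = ((K + 1 : ℕ) : ℝ) / N - 1 / (2 * (N : ℝ)) := by
      push_cast
      field_simp
      ring
    have hmin : min ((K : ℝ) / N + 1 / (2 * (N : ℝ))) 1 =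
        ((K + 1 : ℕ) : ℝ) / N - 1 / (2 * (N : ℝ)) := by
      rw [hpred]
      exact min_eq_left ((sub_le_self _ (by positivity)).trans hle)
    rw [Finset.sum_Icc_succ_top (by omega), mul_add, ih (by omega), hmin, costWeight, ← mul_assoc,
      one_div_mul_cancel hN.ne']
    ring

theorem grid_mem_Icc (hN : 0 < N) {j : ℕ} (hj : j ∈ Finset.Icc 1 N) :
    (j : ℝ) / N ∈ Set.Icc (1 / (2 * (N : ℝ))) 1 := by
  have hN' : (0 : ℝ) < N := Nat.cast_pos.2 hN
  obtain ⟨hj1, hjN⟩ := Finset.mem_Icc.1 hj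
  refine ⟨?_, (div_le_one hN').2 (Nat.cast_le.2 hjN)⟩
  have hj1' : (1 : ℝ) ≤ j := Nat.one_le_cast.2 hj1
  gcongr
  linarith

end Grid

namespace UnitLipschitzLoss

variable {l : ℝ → ℝ → ℝ} {N : ℕ} {y : ℝ}

theorem measurable (hl : UnitLipschitzLoss l) {Ω : Type*} [MeasurableSpace Ω] {y u : Ω → ℝ}
    (hy : Measurable y) (hu : Measurable u) (hy1 : ∀ o, y o ∈ Set.Icc (0 : ℝ) 1)
    (hu1 : ∀ o, u o ∈ Set.Icc (0 : ℝ) 1) : Measurable fun o => l (y o) (u o) := by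
  have hcont : Continuous fun p : Set.Icc (0 : ℝ) 1 × Set.Icc (0 : ℝ) 1 => l p.1 p.2 := by
    refine (LipschitzWith.of_dist_le_mul (K := 2) fun p q => ?_).continuous
    have hfst : |(p.1 : ℝ) - q.1| ≤ dist p q := le_max_left _ _
    have hsnd : |(p.2 : ℝ) - q.2| ≤ dist p q := le_max_right _ _
    rw [Real.dist_eq, NNReal.coe_two]
    linarith [hl.lipschitz _ p.1.2 _ q.1.2 _ p.2.2 _ q.2.2]
  exact hcont.measurable.comp ((hy.subtype_mk (h := hy1)).prodMk (hu.subtype_mk (h := hu1)))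

theorem abs_sub_le_right (hl : UnitLipschitzLoss l) (hy : y ∈ Set.Icc (0 : ℝ) 1) {u u' : ℝ}
    (hu : u ∈ Set.Icc (0 : ℝ) 1) (hu' : u' ∈ Set.Icc (0 : ℝ) 1) : |l y u - l y u'| ≤ |u - u'| := by
  simpa using hl.lipschitz y hy y hy u hu u' hu'

theorem abs_sub_le_left (hl : UnitLipschitzLoss l) {y' u : ℝ} (hy : y ∈ Set.Icc (0 : ℝ) 1)
    (hy' : y' ∈ Set.Icc (0 : ℝ) 1) (hu : u ∈ Set.Icc (0 : ℝ) 1) : |l y u - l y' u| ≤ |y - y'| := by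
  simpa using hl.lipschitz y hy y' hy' u hu u hu

theorem abs_costWeight_le (hl : UnitLipschitzLoss l) (hN : 0 < N) (hy : y ∈ Set.Icc (0 : ℝ) 1)
    {z : ℝ} (hz : z ∈ Set.Icc (1 / (2 * (N : ℝ))) 1) : |costWeight l N y z| ≤ 1 := by
  have hN' : (0 : ℝ) < N := Nat.cast_pos.2 hN
  set a := 1 / (2 * (N : ℝ)) with ha
  have ha0 : 0 < a := by positivity
  have hupper : min (z + a) 1 ∈ Set.Icc (0 : ℝ) 1 :=
    ⟨le_min (by linarith [hz.1]) zero_le_one, min_le_right _ _⟩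
  have hlower : z - a ∈ Set.Icc (0 : ℝ) 1 := ⟨sub_nonneg.2 hz.1, by linarith [hz.2]⟩
  have hwidth : |min (z + a) 1 - (z - a)| ≤ 2 * a := by
    have hle : z - a ≤ min (z + a) 1 := le_min (by linarith) hlower.2
    rw [abs_of_nonneg (sub_nonneg.2 hle)]
    linarith [min_le_left (z + a) 1]
  rw [costWeight, abs_mul, abs_of_pos hN']
  calc (N : ℝ) * |l y (min (z + a) 1) - l y (z - a)| ≤ N * (2 * a) := by
        gcongr
        exact (hl.abs_sub_le_right hy hupper hlower).trans hwidth
    _ = 1 := by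
        rw [ha]
        field_simp

theorem abs_discretized_sub_le (hl : UnitLipschitzLoss l) (hN : 0 < N)
    (hy : y ∈ Set.Icc (0 : ℝ) 1) {𝒳 : Type*} {f : 𝒳 → ℝ} {x : 𝒳} (hf : f x ∈ Set.Icc (0 : ℝ) 1) :
    |l y (1 / (2 * (N : ℝ))) + (1 / (N : ℝ)) * ∑ j ∈ Finset.Icc 1 N,
      costWeight l N y ((j : ℝ) / N) * thr f x ((j : ℝ) / N) - l y (f x)| ≤
      1 / (2 * (N : ℝ)) := by
  set a := 1 / (2 * (N : ℝ)) with ha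
  have ha0 : 0 < a := by positivity
  have hstep : 1 / (N : ℝ) = 2 * a := by
    rw [ha]
    field_simp
  have hle := floor_mul_div_le hN hf.1
  have hge := le_floor_mul_div_add (y := f x) hN
  rw [hstep] at hge
  rw [sum_mul_thr_grid hN hf, sum_costWeight_grid l y (floor_mul_le hf.2), ← ha,
    add_sub_cancel]
  set u := (⌊N * f x⌋₊ : ℝ) / N
  have hu : 0 ≤ u := by positivity
  refine (hl.abs_sub_le_right hy ⟨le_min (by linarith) zero_le_one, min_le_right _ _⟩ hf).trans ?_
  have hlower : f x - a ≤ min (u + a) 1 := le_min (by linarith) (by linarith [hf.2])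
  have hupper : min (u + a) 1 ≤ u + a := min_le_left _ _
  rw [abs_le]
  constructor <;> linarith

end UnitLipschitzLoss

namespace AlgInput

theorem gridThr_mem {𝒳 : Type*} {n : ℕ} {I : AlgInput 𝒳 n} (f : 𝒳 → ℝ) (x : 𝒳) :
    I.gridThr f x ∈ Set.Icc (0 : ℝ) 1 :=
  ⟨mul_nonneg (by positivity) (Finset.sum_nonneg fun _ _ => thr_nonneg _ _ _),
    (le_abs_self _).trans (abs_mean_le (Nat.card_Icc 1 I.N) zero_le_one
      fun _ _ => abs_thr_le_one _ _ _)⟩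

/-- The standing assumptions on the input of the algorithm: outcomes, covers and predictions lie
in `[0,1]`, the cover is fine enough, the weights are nonnegative, and `Bxi` bounds the
disparity. -/
structure Regular {𝒳 : Type*} {n : ℕ} (I : AlgInput 𝒳 n) (ℱ : Set (𝒳 → ℝ)) : Prop where
  N_pos : 0 < I.N
  loss : UnitLipschitzLoss I.l
  outcome : ∀ i, (I.data i).2.2 ∈ Set.Icc (0 : ℝ) 1
  cover_mem : ∀ t ∈ I.cover, t ∈ Set.Icc (0 : ℝ) 1
  covered : ∀ i, ∃ t ∈ I.cover, |(I.data i).2.2 - t| ≤ 1 / (2 * (I.N : ℝ))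
  weight : ∀ x, ∀ m ∈ Set.Icc (0 : ℝ) 1, 0 ≤ I.g x m
  disp : ∀ u ∈ Set.Icc (0 : ℝ) 1, ∀ v ∈ Set.Icc (0 : ℝ) 1, |I.β 0 * u + I.β 1 * v| ≤ I.Bxi
  pred : ∀ f ∈ ℱ, ∀ x, f x ∈ Set.Icc (0 : ℝ) 1

namespace Regular

variable {𝒳 : Type*} {n : ℕ} {I : AlgInput 𝒳 n} {ℱ : Set (𝒳 → ℝ)}

theorem lowerY_mem (h : I.Regular ℱ) (i : Fin n) :
    lowerY I.N I.cover (I.data i).2.2 ∈ Set.Icc (0 : ℝ) 1 :=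
  h.cover_mem _ (lowerY_spec (h.covered i)).1

theorem abs_costHat_le (h : I.Regular ℱ) (f : 𝒳 → ℝ) : |I.costHat f| ≤ 1 :=
  abs_mean_le (Finset.card_fin n) zero_le_one fun i _ =>
    abs_mean_le (Nat.card_Icc 1 I.N) zero_le_one fun _ hj =>
      abs_mul_thr_le_one (h.loss.abs_costWeight_le h.N_pos (h.lowerY_mem i)
        (grid_mem_Icc h.N_pos hj)) _ _ _

theorem abs_costHat_add_c0Hat_sub_le (h : I.Regular ℱ) {f : 𝒳 → ℝ} (hf : f ∈ ℱ) :
    |I.costHat f + c0Hat I.l I.N I.cover I.data -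
      (1 / (n : ℝ)) * ∑ i, I.l (I.data i).2.2 (f (I.data i).1)| ≤ 1 / I.N := by
  rw [costHat, c0Hat, ← mul_add, ← mul_sub, ← Finset.sum_add_distrib, ← Finset.sum_sub_distrib]
  refine abs_mean_le (Finset.card_fin n) (by positivity) fun i _ => ?_
  have hdiscretized := h.loss.abs_discretized_sub_le h.N_pos (h.lowerY_mem i)
    (h.pred f hf (I.data i).1)
  have hround := h.loss.abs_sub_le_left (h.lowerY_mem i) (h.outcome i)
    (h.pred f hf (I.data i).1)
  rw [abs_sub_comm (lowerY _ _ _)] at hround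
  rw [add_comm (_ * _)]
  refine (abs_sub_le _ _ _).trans ((add_le_add hdiscretized
    (hround.trans (lowerY_spec (h.covered i)).2)).trans_eq ?_)
  have hN : (I.N : ℝ) ≠ 0 := Nat.cast_ne_zero.2 h.N_pos.ne'
  field_simp
  norm_num

theorem groupWeight_nonneg (h : I.Regular ℱ) (a : Fin 2) (i : Fin n) :
    0 ≤ I.groupWeight a i :=
  Set.indicator_nonneg (fun _ _ => h.weight _ _ (h.outcome i)) _

theorem groupMean_mem (h : I.Regular ℱ) (f : 𝒳 → ℝ) (a : Fin 2) :
    (∑ i, I.groupWeight a i * I.gridThr f (I.data i).1) / ∑ i, I.groupWeight a i ∈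
      Set.Icc (0 : ℝ) 1 := by
  have hpos : 0 ≤ ∑ i, I.groupWeight a i := Finset.sum_nonneg fun i _ => h.groupWeight_nonneg a i
  refine ⟨div_nonneg (Finset.sum_nonneg fun i _ => mul_nonneg (h.groupWeight_nonneg a i)
    (gridThr_mem f _).1) hpos, div_le_one_of_le₀ (Finset.sum_le_sum fun i _ => ?_) hpos⟩
  exact mul_le_of_le_one_right (h.groupWeight_nonneg a i) (gridThr_mem f _).2

theorem abs_dispHat_le (h : I.Regular ℱ) (f : 𝒳 → ℝ) : |I.dispHat f| ≤ I.Bxi := by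
  rw [dispHat, Fin.sum_univ_two]
  exact h.disp _ (h.groupMean_mem f 0) _ (h.groupMean_mem f 1)

theorem abs_viol_le (h : I.Regular ℱ) (f : 𝒳 → ℝ) {ξ : ℝ}
    (hξ : ξ ∈ Set.Icc (0 : ℝ) I.Bxi) (k : Fin 3) :
    |I.viol ξ (I.dispHat f) (I.costHat f) k| ≤ 2 * I.Bxi + 1 + |I.epsHat| := by
  have hdisp := abs_le.1 (h.abs_dispHat_le f)
  have hcost := abs_sub (I.costHat f) I.epsHat
  have hcost1 := h.abs_costHat_le f
  have heps := abs_nonneg I.epsHat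
  have hξ0 := hξ.1
  have hξB := hξ.2
  fin_cases k
  · simp only [viol, Fin.reduceFinMk, Matrix.cons_val, abs_le]
    constructor <;> linarith
  · simp only [viol, Fin.reduceFinMk, Matrix.cons_val, abs_le]
    constructor <;> linarith
  · simp only [viol, Fin.reduceFinMk, Matrix.cons_val]
    linarith

theorem abs_viol_le_rho (h : I.Regular ℱ) (f : ℱ) (ξ : ℝ)
    (hξ : ξ ∈ Set.Icc (0 : ℝ) I.Bxi) (k : Fin 3) :
    |I.viol ξ (I.dispHat f) (I.costHat f) k| ≤ I.rho ℱ :=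
  le_ciSup (f := fun p : ℱ × Set.Icc (0 : ℝ) I.Bxi × Fin 3 =>
      |I.viol p.2.1 (I.dispHat p.1) (I.costHat p.1) p.2.2|)
    ⟨2 * I.Bxi + 1 + |I.epsHat|, Set.forall_mem_range.2 fun p => h.abs_viol_le _ p.2.1.2 _⟩
    (f, ⟨ξ, hξ⟩, k)

theorem rho_le (h : I.Regular ℱ) (f : ℱ) (hB : 0 ≤ I.Bxi) :
    I.rho ℱ ≤ 2 * I.Bxi + 1 + |I.epsHat| := by
  have : Nonempty (ℱ × Set.Icc (0 : ℝ) I.Bxi × Fin 3) := ⟨(f, ⟨0, le_rfl, hB⟩, 0)⟩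
  exact ciSup_le fun p => h.abs_viol_le _ p.2.1.2 _

theorem rho_pos (h : I.Regular ℱ) (f : ℱ) (hB : 0 < I.Bxi) : 0 < I.rho ℱ := by
  have hzero := (abs_le.1 (h.abs_viol_le_rho f 0 ⟨le_rfl, hB.le⟩ 0)).2
  have hmax := (abs_le.1 (h.abs_viol_le_rho f I.Bxi ⟨hB.le, le_rfl⟩ 0)).1
  simp only [viol, Matrix.cons_val_zero] at hzero hmax
  linarith

end Regular

end AlgInput

/-! ### Empirical loss and disparity -/

theorem abs_le_one_of_mem_Icc {a : ℝ} (ha : a ∈ Set.Icc (0 : ℝ) 1) : |a| ≤ 1 :=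
  abs_le.2 ⟨by linarith [ha.1], ha.2⟩

section SampleError

variable {Ω ι : Type*} [MeasurableSpace Ω] [Fintype ι] (ν : Measure Ω) (s : ι → Ω) {u v : Ω → ℝ}

/-- The sample mean of `v` minus its expectation. -/
def sampleError (v : Ω → ℝ) : ℝ :=
  (1 / (Fintype.card ι : ℝ)) * ∑ i, v (s i) - ∫ o, v o ∂ν

theorem sampleError_add (hu : Integrable u ν) (hv : Integrable v ν) :
    sampleError ν s (fun o => u o + v o) = sampleError ν s u + sampleError ν s v := by
  rw [sampleError, integral_add hu hv, Finset.sum_add_distrib, sampleError, sampleError]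
  ring

theorem sampleError_const_mul_sum {κ : Type*} {T : Finset κ} {t : κ → Ω → ℝ}
    (ht : ∀ j ∈ T, Integrable (t j) ν) (c : ℝ) :
    sampleError ν s (fun o => c * ∑ j ∈ T, t j o) = c * ∑ j ∈ T, sampleError ν s (t j) := by
  simp only [sampleError]
  rw [integral_const_mul, integral_finsetSum _ ht, Finset.sum_sub_distrib, ← Finset.mul_sum,
    ← Finset.mul_sum, Finset.sum_comm]
  ring

theorem abs_sampleError_mean_le {κ : Type*} {T : Finset κ} {m : ℕ} (hT : T.card = m)
    {t : κ → Ω → ℝ} (ht : ∀ j ∈ T, Integrable (t j) ν) {D : ℝ} (hD : 0 ≤ D)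
    (htD : ∀ j ∈ T, |sampleError ν s (t j)| ≤ D) :
    |sampleError ν s (fun o => (1 / (m : ℝ)) * ∑ j ∈ T, t j o)| ≤ D := by
  rw [sampleError_const_mul_sum ν s ht]
  exact abs_mean_le hT hD htD

theorem abs_integral_sub_integral_le [IsProbabilityMeasure ν] (hu : Integrable u ν)
    (hv : Integrable v ν) {e : ℝ} (h : ∀ o, |u o - v o| ≤ e) :
    |∫ o, u o ∂ν - ∫ o, v o ∂ν| ≤ e := by
  rw [← integral_sub hu hv]
  simpa using norm_integral_le_of_norm_le_const (μ := ν) (f := fun o => u o - v o) (ae_of_all _ h)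

theorem abs_sampleError_sub_sampleError_le [IsProbabilityMeasure ν] (hu : Integrable u ν)
    (hv : Integrable v ν) {e : ℝ} (he : 0 ≤ e) (h : ∀ o, |u o - v o| ≤ e) :
    |sampleError ν s v - sampleError ν s u| ≤ 2 * e := by
  have hmean : |(1 / (Fintype.card ι : ℝ)) * ∑ i, v (s i) -
      (1 / (Fintype.card ι : ℝ)) * ∑ i, u (s i)| ≤ e := by
    rw [← mul_sub, ← Finset.sum_sub_distrib]
    refine abs_mean_le Finset.card_univ he fun i _ => ?_
    rw [abs_sub_comm]
    exact h _
  have hint := abs_integral_sub_integral_le ν hu hv h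
  rw [sampleError, sampleError, sub_sub_sub_comm, two_mul]
  refine (abs_sub _ _).trans (add_le_add hmean ?_)
  rwa [abs_sub_comm]

end SampleError

section Grid

variable {𝒳 Ω ι : Type*} [MeasurableSpace Ω] [Fintype ι] {ℱ : Set (𝒳 → ℝ)}
  {N : ℕ} {X : Ω → 𝒳} {ν : Measure Ω} {D : ℝ} {s : ι → Ω} {f : 𝒳 → ℝ}

/-- At every grid point and uniformly over `ℱ`, weighted sample means of the threshold
classifiers are within `D` of their expectations. The point `j = 0`, where every classifier
is `1`, is included to control the sample means of the weights themselves. -/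
def UniformOnGrid (ℱ : Set (𝒳 → ℝ)) (N : ℕ) (w : ℕ → Ω → ℝ) (X : Ω → 𝒳) (ν : Measure Ω) (D : ℝ)
    (s : ι → Ω) : Prop :=
  ∀ j ≤ N, ∀ f ∈ ℱ, |sampleError ν s fun o => w j o * thr f (X o) ((j : ℝ) / N)| ≤ D

/-- A width such that, with probability at least `1 - δ`, all means of `m` observations in
`UniformOnGrid` are this close to their expectations; `C` and `φ` are the constants of the
Rademacher complexity bound, and `δ` is split among the `N + 1` grid points. -/
def devWidth (C φ δ : ℝ) (N m : ℕ) : ℝ :=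
  (2 * C + √(8 * Real.log (1 / (δ / (N + 1))))) * (m : ℝ) ^ (-φ)

theorem measure_not_uniformOnGrid_le [MeasurableSpace 𝒳] [Nonempty ι]
    [IsProbabilityMeasure ν] (hℱ : ∀ f ∈ ℱ, Measurable f) (hℱm : PointwiseMeasurable ℱ) {C φ : ℝ}
    (hφ : φ ≤ 1 / 2) (hR : ∀ m : ℕ, 1 ≤ m → rademacher (thrClass ℱ) m ≤ C * (m : ℝ) ^ (-φ))
    (hX : Measurable X) {w : ℕ → Ω → ℝ} (hw : ∀ j ≤ N, Measurable (w j))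
    (hw1 : ∀ j ≤ N, ∀ o, |w j o| ≤ 1) {δ : ℝ} (hδ0 : 0 < δ) :
    (Measure.pi fun _ : ι => ν)
      {s | ¬ UniformOnGrid ℱ N w X ν (devWidth C φ δ N (Fintype.card ι)) s} ≤
      ENNReal.ofReal δ := by
  classical
  set D := devWidth C φ δ N (Fintype.card ι)
  have hunion : {s : ι → Ω | ¬ UniformOnGrid ℱ N w X ν D s} ⊆ ⋃ j ∈ Finset.range (N + 1),
      {s | ∃ f ∈ ℱ, D < |sampleError ν s fun o => w j o * thr f (X o) ((j : ℝ) / N)|} := by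
    intro s hs
    simp only [UniformOnGrid, Set.mem_ofPred_eq, not_forall, not_le] at hs
    obtain ⟨j, hj, f, hf, hlt⟩ := hs
    exact Set.mem_biUnion (Finset.mem_coe.2 (Finset.mem_range_succ_iff.2 hj)) ⟨f, hf, hlt⟩
  refine (measure_mono hunion).trans ((measure_biUnion_finset_le _ _).trans ?_)
  calc _ ≤ ∑ j ∈ Finset.range (N + 1), ENNReal.ofReal (δ / (N + 1)) := by
        refine Finset.sum_le_sum fun j hj => ?_
        have hjN : j ≤ N := Finset.mem_range_succ_iff.1 hj
        exact measure_thr_mean_deviation_le ν hℱ hℱm hX (hw j hjN) (hw1 j hjN)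
          ⟨by positivity, div_le_one_of_le₀ (Nat.cast_le.2 hjN) (by positivity)⟩ hφ hR
          (by positivity)
    _ = ENNReal.ofReal δ := by
        rw [Finset.sum_const, Finset.card_range, nsmul_eq_mul, ← ENNReal.ofReal_natCast,
          ← ENNReal.ofReal_mul (by positivity), Nat.cast_add_one,
          mul_div_cancel₀ _ (by positivity)]

theorem UniformOnGrid.nonneg {w : ℕ → Ω → ℝ} (hs : UniformOnGrid ℱ N w X ν D s) (hf : f ∈ ℱ) :
    0 ≤ D :=
  (abs_nonneg _).trans (hs 0 N.zero_le f hf)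

theorem thr_grid_zero {x : 𝒳} (hf : f x ∈ Set.Icc (0 : ℝ) 1) :
    thr f x (((0 : ℕ) : ℝ) / N) = 1 := by
  simp [thr, hf.1]

theorem integrable_mul_thr [MeasurableSpace 𝒳] [IsFiniteMeasure ν] (hX : Measurable X)
    {w : Ω → ℝ} (hw : Measurable w) (hw1 : ∀ o, |w o| ≤ 1) (hf : Measurable f) (z : ℝ) :
    Integrable (fun o => w o * thr f (X o) z) ν :=
  Integrable.of_bound (hw.mul ((measurable_thr hf z).comp hX)).aestronglyMeasurable 1
    (ae_of_all _ fun o => abs_mul_thr_le_one (hw1 o) _ _ _)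

end Grid

section Loss

variable {𝒳 Ω ι : Type*} {l : ℝ → ℝ → ℝ} {N : ℕ} {y : Ω → ℝ}

/-- Weights of the threshold classifiers in the discretized loss. By `thr_grid_zero`, the
constant term `l(y, 1/(2N))` is carried by the grid point `0`. -/
def lossWeight (l : ℝ → ℝ → ℝ) (N : ℕ) (y : Ω → ℝ) (j : ℕ) (o : Ω) : ℝ :=
  if j = 0 then l (y o) (1 / (2 * (N : ℝ))) else costWeight l N (y o) ((j : ℝ) / N)

theorem half_grid_mem (hN : 0 < N) : 1 / (2 * (N : ℝ)) ∈ Set.Icc (0 : ℝ) 1 := by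
  have hgrid := grid_mem_Icc hN (Finset.mem_Icc.2 ⟨le_rfl, hN⟩)
  exact ⟨by positivity, hgrid.1.trans hgrid.2⟩

theorem abs_lossWeight_le (hl : UnitLipschitzLoss l) (hN : 0 < N)
    (hy : ∀ o, y o ∈ Set.Icc (0 : ℝ) 1) {j : ℕ} (hj : j ≤ N) (o : Ω) :
    |lossWeight l N y j o| ≤ 1 := by
  rw [lossWeight]
  split_ifs with h
  · exact abs_le_one_of_mem_Icc (hl.mem_Icc _ (hy o) _ (half_grid_mem hN))
  · exact hl.abs_costWeight_le hN (hy o)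
      (grid_mem_Icc hN (Finset.mem_Icc.2 ⟨Nat.one_le_iff_ne_zero.2 h, hj⟩))

variable [MeasurableSpace Ω]

theorem measurable_lossWeight (hl : UnitLipschitzLoss l) (hN : 0 < N) (hym : Measurable y)
    (hy : ∀ o, y o ∈ Set.Icc (0 : ℝ) 1) {j : ℕ} (hj : j ≤ N) :
    Measurable (lossWeight l N y j) := by
  have hloss (u : ℝ) (hu : u ∈ Set.Icc (0 : ℝ) 1) : Measurable fun o => l (y o) u :=
    hl.measurable hym measurable_const hy fun _ => hu
  unfold lossWeight
  split_ifs with h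
  · exact hloss _ (half_grid_mem hN)
  · have hz := grid_mem_Icc hN (Finset.mem_Icc.2 ⟨Nat.one_le_iff_ne_zero.2 h, hj⟩)
    have hhalf := half_grid_mem hN
    refine ((hloss _ ⟨le_min ?_ zero_le_one, min_le_right _ _⟩).sub
      (hloss _ ⟨sub_nonneg.2 hz.1, ?_⟩)).const_mul _
    · exact add_nonneg (hhalf.1.trans hz.1) hhalf.1
    · exact (sub_le_self _ hhalf.1).trans hz.2

theorem UnitLipschitzLoss.integrable (hl : UnitLipschitzLoss l) (ν : Measure Ω)
    [IsFiniteMeasure ν] {u : Ω → ℝ} (hym : Measurable y) (hum : Measurable u)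
    (hy : ∀ o, y o ∈ Set.Icc (0 : ℝ) 1) (hu : ∀ o, u o ∈ Set.Icc (0 : ℝ) 1) :
    Integrable (fun o => l (y o) (u o)) ν :=
  .of_mem_Icc 0 1 (hl.measurable hym hum hy hu).aemeasurable
    (ae_of_all _ fun o => hl.mem_Icc _ (hy o) _ (hu o))

theorem UnitLipschitzLoss.abs_integral_le (hl : UnitLipschitzLoss l) {ν : Measure Ω}
    [IsProbabilityMeasure ν] {u : Ω → ℝ} (hy : ∀ᵐ o ∂ν, y o ∈ Set.Icc (0 : ℝ) 1)
    (hu : ∀ o, u o ∈ Set.Icc (0 : ℝ) 1) : |∫ o, l (y o) (u o) ∂ν| ≤ 1 := by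
  have hbound : ∀ᵐ o ∂ν, ‖l (y o) (u o)‖ ≤ 1 := by
    filter_upwards [hy] with o ho
    exact abs_le_one_of_mem_Icc (hl.mem_Icc _ ho _ (hu o))
  simpa using norm_integral_le_of_norm_le_const hbound

theorem UnitLipschitzLoss.abs_sampleError_le [MeasurableSpace 𝒳] [Fintype ι]
    (hl : UnitLipschitzLoss l) (hN : 0 < N) {ν : Measure Ω} [IsProbabilityMeasure ν]
    (hym : Measurable y) (hy : ∀ o, y o ∈ Set.Icc (0 : ℝ) 1) {X : Ω → 𝒳} (hX : Measurable X)
    {ℱ : Set (𝒳 → ℝ)} {D : ℝ} {s : ι → Ω} (hs : UniformOnGrid ℱ N (lossWeight l N y) X ν D s)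
    {f : 𝒳 → ℝ} (hf : f ∈ ℱ) (hfm : Measurable f) (hf1 : ∀ x, f x ∈ Set.Icc (0 : ℝ) 1) :
    |sampleError ν s fun o => l (y o) (f (X o))| ≤ 2 * D + 1 / N := by
  set t : ℕ → Ω → ℝ := fun j o => lossWeight l N y j o * thr f (X o) ((j : ℝ) / N)
  have ht (j : ℕ) (hj : j ≤ N) : Integrable (t j) ν :=
    integrable_mul_thr hX (measurable_lossWeight hl hN hym hy hj) (abs_lossWeight_le hl hN hy hj)
      hfm _
  have ht1 (j : ℕ) (hj : j ∈ Finset.Icc 1 N) : Integrable (t j) ν := ht j (Finset.mem_Icc.1 hj).2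
  have hmean : Integrable (fun o => (1 / (N : ℝ)) * ∑ j ∈ Finset.Icc 1 N, t j o) ν :=
    (integrable_finsetSum _ ht1).const_mul _
  have hround (o : Ω) : |t 0 o + (1 / (N : ℝ)) * ∑ j ∈ Finset.Icc 1 N, t j o -
      l (y o) (f (X o))| ≤ 1 / (2 * (N : ℝ)) := by
    have hsum : ∑ j ∈ Finset.Icc 1 N, t j o = ∑ j ∈ Finset.Icc 1 N,
        costWeight l N (y o) ((j : ℝ) / N) * thr f (X o) ((j : ℝ) / N) :=
      Finset.sum_congr rfl fun j hj => by
        simp only [t, lossWeight, if_neg (Nat.one_le_iff_ne_zero.1 (Finset.mem_Icc.1 hj).1)]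
    rw [hsum]
    simpa only [t, lossWeight, if_true, thr_grid_zero (hf1 _), mul_one]
      using hl.abs_discretized_sub_le hN (hy o) (hf1 (X o))
  have hdiscretized : |sampleError ν s fun o =>
      t 0 o + (1 / (N : ℝ)) * ∑ j ∈ Finset.Icc 1 N, t j o| ≤ D + D := by
    rw [sampleError_add ν s (ht 0 N.zero_le) hmean]
    exact (abs_add_le _ _).trans (add_le_add (hs 0 N.zero_le f hf)
      (abs_sampleError_mean_le ν s (Nat.card_Icc 1 N) ht1 (hs.nonneg hf)
        fun j hj => hs j (Finset.mem_Icc.1 hj).2 f hf))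
  have hdiff := abs_sampleError_sub_sampleError_le ν s ((ht 0 N.zero_le).add hmean)
    (hl.integrable ν hym (hfm.comp hX) hy fun o => hf1 (X o)) (half_grid_mem hN).1 hround
  calc _ ≤ _ := sub_le_iff_le_add'.1 ((abs_sub_abs_le_abs_sub _ _).trans hdiff)
    _ ≤ (D + D) + 2 * (1 / (2 * (N : ℝ))) := add_le_add_left hdiscretized _
    _ = 2 * D + 1 / N := by ring

end Loss

section Disparity

variable {𝒳 Ω ι : Type*} [MeasurableSpace Ω] {ν : Measure Ω} {w : Ω → ℝ}
  {X : Ω → 𝒳} {f : 𝒳 → ℝ}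

theorem abs_div_sub_div_le {A B A' B' e₁ e₂ ω : ℝ} (hA : 0 ≤ A) (hAB : A ≤ B)
    (hω : 0 < ω) (hB' : ω ≤ B') (hAA' : |A - A'| ≤ e₁) (hBB' : |B - B'| ≤ e₂) :
    |A / B - A' / B'| ≤ (e₁ + e₂) / ω := by
  have hB'0 : 0 < B' := hω.trans_le hB'
  have hsplit : A / B - A' / B' = ((A - A') + A / B * (B' - B)) / B' := by
    rcases (hA.trans hAB).eq_or_lt with hB | hB
    · rw [← hB, div_zero, zero_mul, add_zero, hA.antisymm' (hB ▸ hAB), zero_sub, zero_sub, neg_div]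
    · field_simp
      ring
  have hquot : |A / B| ≤ 1 := by
    rw [abs_of_nonneg (div_nonneg hA (hA.trans hAB))]
    exact div_le_one_of_le₀ hAB (hA.trans hAB)
  rw [hsplit, abs_div, abs_of_pos hB'0]
  refine div_le_div₀ (add_nonneg ((abs_nonneg _).trans hAA') ((abs_nonneg _).trans hBB')) ?_ hω hB'
  refine (abs_add_le _ _).trans (add_le_add hAA' ?_)
  rw [abs_mul, abs_sub_comm B']
  exact (mul_le_of_le_one_left (abs_nonneg _) hquot).trans hBB'

theorem integral_mul_div_integral_mem_Icc [IsFiniteMeasure ν] (hw : Measurable w)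
    (hw1 : ∀ o, w o ∈ Set.Icc (0 : ℝ) 1) (hf1 : ∀ x, f x ∈ Set.Icc (0 : ℝ) 1) :
    (∫ o, w o * f (X o) ∂ν) / ∫ o, w o ∂ν ∈ Set.Icc (0 : ℝ) 1 := by
  have hmass : 0 ≤ ∫ o, w o ∂ν := integral_nonneg fun o => (hw1 o).1
  have hmul (o : Ω) : 0 ≤ w o * f (X o) := mul_nonneg (hw1 o).1 (hf1 _).1
  exact ⟨div_nonneg (integral_nonneg hmul) hmass, div_le_one_of_le₀
    (integral_mono_of_nonneg (ae_of_all _ hmul) (.of_mem_Icc 0 1 hw.aemeasurable (ae_of_all _ hw1))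
      (ae_of_all _ fun o => mul_le_of_le_one_right (hw1 o).1 (hf1 _).2)) hmass⟩

variable [MeasurableSpace 𝒳] [IsProbabilityMeasure ν] [Fintype ι] {ℱ : Set (𝒳 → ℝ)} {N : ℕ}
  {D : ℝ} {s : ι → Ω}

theorem abs_mean_mul_grid_sub_integral_le (hN : 0 < N) (hw : Measurable w)
    (hw1 : ∀ o, w o ∈ Set.Icc (0 : ℝ) 1) (hX : Measurable X)
    (hs : UniformOnGrid ℱ N (fun _ => w) X ν D s) (hf : f ∈ ℱ) (hfm : Measurable f)
    (hf1 : ∀ x, f x ∈ Set.Icc (0 : ℝ) 1) :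
    |(1 / (Fintype.card ι : ℝ)) * ∑ i, w (s i) *
        ((1 / (N : ℝ)) * ∑ j ∈ Finset.Icc 1 N, thr f (X (s i)) ((j : ℝ) / N)) -
      ∫ o, w o * f (X o) ∂ν| ≤ D + 1 / N := by
  have hw1' (o : Ω) : |w o| ≤ 1 := abs_le_one_of_mem_Icc (hw1 o)
  set t : ℕ → Ω → ℝ := fun j o => w o * thr f (X o) ((j : ℝ) / N) with ht
  have hti (j : ℕ) : Integrable (t j) ν := integrable_mul_thr hX hw hw1' hfm _
  have hwt (o : Ω) : w o * ((1 / (N : ℝ)) * ∑ j ∈ Finset.Icc 1 N, thr f (X o) ((j : ℝ) / N)) =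
      (1 / (N : ℝ)) * ∑ j ∈ Finset.Icc 1 N, t j o := by
    rw [ht, ← Finset.mul_sum, mul_left_comm]
  have hround (o : Ω) :
      |(1 / (N : ℝ)) * ∑ j ∈ Finset.Icc 1 N, t j o - w o * f (X o)| ≤ 1 / N := by
    rw [← hwt, ← mul_sub, abs_mul]
    exact (mul_le_of_le_one_left (abs_nonneg _) (hw1' o)).trans
      (abs_grid_mean_sub_le hN (hf1 _))
  have hwf : Integrable (fun o => w o * f (X o)) ν :=
    .of_mem_Icc 0 1 (hw.mul (hfm.comp hX)).aemeasurable (ae_of_all _ fun o =>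
      ⟨mul_nonneg (hw1 o).1 (hf1 _).1, mul_le_one₀ (hw1 o).2 (hf1 _).1 (hf1 _).2⟩)
  have hmean : |sampleError ν s fun o => (1 / (N : ℝ)) * ∑ j ∈ Finset.Icc 1 N, t j o| ≤ D :=
    abs_sampleError_mean_le ν s (Nat.card_Icc 1 N) (fun j _ => hti j) (hs.nonneg hf)
      fun j hj => hs j (Finset.mem_Icc.1 hj).2 f hf
  simp only [hwt]
  exact (abs_sub_le _ _ _).trans (add_le_add hmean (abs_integral_sub_integral_le ν
    ((integrable_finsetSum _ fun j _ => hti j).const_mul _) hwf hround))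

theorem abs_ratio_sub_le [Nonempty ι] (hN : 0 < N) (hw : Measurable w)
    (hw1 : ∀ o, w o ∈ Set.Icc (0 : ℝ) 1) (hX : Measurable X) {ω : ℝ} (hω : 0 < ω)
    (hωw : ω ≤ ∫ o, w o ∂ν) (hs : UniformOnGrid ℱ N (fun _ => w) X ν D s) (hf : f ∈ ℱ)
    (hfm : Measurable f) (hf1 : ∀ x, f x ∈ Set.Icc (0 : ℝ) 1) :
    |(∑ i, w (s i) *
        ((1 / (N : ℝ)) * ∑ j ∈ Finset.Icc 1 N, thr f (X (s i)) ((j : ℝ) / N))) / ∑ i, w (s i) -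
      (∫ o, w o * f (X o) ∂ν) / ∫ o, w o ∂ν| ≤ (2 * D + 1 / N) / ω := by
  set gridMean : 𝒳 → ℝ := fun x => (1 / (N : ℝ)) * ∑ j ∈ Finset.Icc 1 N, thr f x ((j : ℝ) / N)
  have hgrid0 (x : 𝒳) : 0 ≤ gridMean x :=
    mul_nonneg (by positivity) (Finset.sum_nonneg fun _ _ => thr_nonneg _ _ _)
  have hgrid1 (x : 𝒳) : gridMean x ≤ 1 := (le_abs_self _).trans
    (abs_mean_le (Nat.card_Icc 1 N) zero_le_one fun _ _ => abs_thr_le_one _ _ _)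
  have hmass : |sampleError ν s w| ≤ D := by
    simpa only [thr_grid_zero (hf1 _), mul_one] using hs 0 N.zero_le f hf
  have hratio := abs_div_sub_div_le
    (mul_nonneg (by positivity) (Finset.sum_nonneg fun i _ => mul_nonneg (hw1 _).1 (hgrid0 _)))
    (mul_le_mul_of_nonneg_left (Finset.sum_le_sum fun i _ =>
      mul_le_of_le_one_right (hw1 _).1 (hgrid1 _)) (by positivity)) hω hωw
    (abs_mean_mul_grid_sub_integral_le hN hw hw1 hX hs hf hfm hf1) hmass
  rw [mul_div_mul_left _ _ (one_div_ne_zero (Nat.cast_ne_zero.2 Fintype.card_ne_zero))] at hratio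
  exact hratio.trans_eq (by ring)

end Disparity

section Groups

variable {𝒳 : Type*} {n : ℕ}

theorem AlgInput.sum_groupWeight_mul {I : AlgInput 𝒳 n} {μ : 𝒳 → ℝ} {s : Fin n → Obs 𝒳}
    (hI : I.data = modifiedData μ s) (a : Fin 2) (v : 𝒳 → ℝ) :
    ∑ i, I.groupWeight a i * v (I.data i).1 =
      ∑ i : hits (attrA ⁻¹' I.S a) s, I.g (featX (s i)) (μ (featX (s i))) * v (featX (s i)) := by
  classical
  rw [Finset.sum_coe_sort (hits (attrA ⁻¹' I.S a) s)
    fun i => I.g (featX (s i)) (μ (featX (s i))) * v (featX (s i)), hits, Finset.sum_filter]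
  refine Finset.sum_congr rfl fun i _ => ?_
  simp only [groupWeight, hI, modifiedData, Set.indicator_apply, Set.mem_preimage, ite_mul,
    zero_mul]

theorem groupCount_eq_card_hits (T : Set (Fin 2)) (s : Fin n → Obs 𝒳) :
    groupCount T s = (hits (attrA ⁻¹' T) s).card := by
  rw [groupCount, ← Set.ncard_coe_finset]
  congr 1
  ext i
  simp [mem_hits]

end Groups

/-! ### Sample means of randomized prediction functions -/

section MixSampleError

variable {α Ω ι : Type*} (Q : PMF α) [MeasurableSpace Ω] {v : α → Ω → ℝ} {b : ℝ}

theorem mix_sum {T : Finset ι} {u : ι → α → ℝ} (hu : ∀ i f, |u i f| ≤ b) :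
    mix Q (fun f => ∑ i ∈ T, u i f) = ∑ i ∈ T, mix Q (u i) := by
  simp only [mix, Finset.mul_sum]
  exact Summable.tsum_finsetSum fun i _ => summable_toReal_mul Q (hu i)

theorem mix_eq_tsum_support (u : α → ℝ) : mix Q u = ∑' f : Q.support, (Q f).toReal * u f := by
  refine (tsum_subtype_eq_of_support_subset fun f hf => ?_).symm
  rw [PMF.mem_support_iff]
  intro h0
  simp [h0] at hf

theorem measurable_mix (hv : ∀ f, Measurable (v f)) : Measurable fun o => mix Q (v · o) := by
  have := Q.support_countable.to_subtype
  simp only [mix_eq_tsum_support]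
  exact Measurable.tsum fun f => (hv f).const_mul _

variable (P : Measure Ω) [IsProbabilityMeasure P]

theorem integral_mix (hv : ∀ f, Measurable (v f)) (hb : ∀ f o, |v f o| ≤ b) :
    ∫ o, mix Q (v · o) ∂P = mix Q fun f => ∫ o, v f o ∂P := by
  have := Q.support_countable.to_subtype
  have hint (f : α) : Integrable (v f) P :=
    .of_bound (hv f).aestronglyMeasurable b (ae_of_all _ (hb f))
  have hnorm (f : α) : |∫ o, ‖v f o‖ ∂P| ≤ b := by
    rw [abs_of_nonneg (integral_nonneg fun o => norm_nonneg _)]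
    calc _ ≤ ∫ _, b ∂P := integral_mono (hint f).norm (integrable_const b) (hb f)
      _ = b := by simp
  simp only [mix_eq_tsum_support]
  rw [← integral_tsum_of_summable_integral_norm
    (F := fun (f : Q.support) o => (Q f).toReal * v f o) (fun f => (hint f).const_mul _)]
  · simp only [integral_const_mul]
  · simp only [norm_mul, Real.norm_of_nonneg ENNReal.toReal_nonneg, integral_const_mul]
    exact (summable_toReal_mul Q hnorm).subtype _

variable [Fintype ι]

theorem mix_sampleError (hv : ∀ f, Measurable (v f)) (hb : ∀ f o, |v f o| ≤ b) (s : ι → Ω) :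
    mix Q (fun f => sampleError P s (v f)) = sampleError P s fun o => mix Q (v · o) := by
  have hmean (f : α) : |(1 / (Fintype.card ι : ℝ)) * ∑ i, v f (s i)| ≤ |b| :=
    abs_mean_le Finset.card_univ (abs_nonneg b) fun i _ => (hb f _).trans (le_abs_self b)
  have hint (f : α) : |∫ o, v f o ∂P| ≤ b := by
    simpa using norm_integral_le_of_norm_le_const (μ := P) (f := v f) (C := b) (ae_of_all _ (hb f))
  simp only [sampleError]
  rw [mix_sub Q hmean hint, mix_const_mul, mix_sum Q fun i f => hb f (s i), integral_mix Q P hv hb]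

variable [Nonempty ι] {t : ℝ}

theorem measure_lt_sampleError_le {V : Ω → ℝ} (hV : Measurable V)
    (hV1 : ∀ o, V o ∈ Set.Icc (0 : ℝ) 1) (ht : 0 ≤ t) :
    (Measure.pi fun _ : ι => P) {s | t < sampleError P s V} ≤
      ENNReal.ofReal (Real.exp (-(2 * Fintype.card ι * t ^ 2))) := by
  have hcard : (0 : ℝ) < Fintype.card ι := Nat.cast_pos.2 Fintype.card_pos
  set Pι := Measure.pi fun _ : ι => P
  have hindep : iIndepFun (fun i (s : ι → Ω) => V (s i) - ∫ o, V o ∂P) Pι :=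
    iIndepFun_pi (X := fun _ o => V o - ∫ o, V o ∂P) fun _ => (hV.sub_const _).aemeasurable
  have hmean (i : ι) : ∫ s, V (s i) ∂Pι = ∫ o, V o ∂P :=
    integral_comp_eval (μ := fun _ : ι => P) hV.aestronglyMeasurable
  have hsub (i : ι) : HasSubgaussianMGF (fun s : ι → Ω => V (s i) - ∫ o, V o ∂P)
      ((‖(1 : ℝ) - 0‖₊ / 2) ^ 2) Pι := by
    rw [← hmean i]
    exact hasSubgaussianMGF_of_mem_Icc (hV.comp (measurable_pi_apply i)).aemeasurable
      (ae_of_all _ fun s => hV1 _)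
  have hsum := HasSubgaussianMGF.measure_sum_ge_le_of_iIndepFun hindep (s := Finset.univ)
    (fun i _ => hsub i) (mul_nonneg hcard.le ht)
  rw [← ofReal_measureReal]
  refine ENNReal.ofReal_le_ofReal ((measureReal_mono fun s hs => ?_).trans (hsum.trans_eq ?_))
  · have hs' : t < sampleError P s V := hs
    rw [sampleError, one_div_mul_eq_div, lt_sub_iff_add_lt', lt_div_iff₀ hcard] at hs'
    simp only [Set.mem_ofPred_eq, Finset.sum_sub_distrib, Finset.sum_const, Finset.card_univ,
      nsmul_eq_mul]
    linarith
  · congr 1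
    simp
    field_simp

theorem measure_lt_mix_sampleError_le (hv : ∀ f, Measurable (v f))
    (hv1 : ∀ f o, v f o ∈ Set.Icc (0 : ℝ) 1) (ht : 0 ≤ t) :
    (Measure.pi fun _ : ι => P) {s | t < mix Q fun f => sampleError P s (v f)} ≤
      ENNReal.ofReal (Real.exp (-(2 * Fintype.card ι * t ^ 2))) := by
  have hv_abs (f : α) (o : Ω) : |v f o| ≤ 1 := abs_le_one_of_mem_Icc (hv1 f o)
  simp only [mix_sampleError Q P hv hv_abs]
  refine measure_lt_sampleError_le P (measurable_mix Q hv) (fun o => ⟨?_, ?_⟩) ht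
  · exact tsum_nonneg fun f => mul_nonneg ENNReal.toReal_nonneg (hv1 f o).1
  · exact (le_abs_self _).trans (abs_mix_le Q fun f => hv_abs f o)

end MixSampleError

/-! ### Disparity measures conditioning on the outcome -/

section CondIndep

variable {Ω : Type*} {m mΩ : MeasurableSpace Ω} {P : Measure Ω} {U V : Set Ω} {h q : Ω → ℝ} {b : ℝ}

theorem integral_mul_condExp [IsFiniteMeasure P] (hm : m ≤ mΩ) (hh : StronglyMeasurable[m] h)
    (hb : ∀ o, |h o| ≤ b) {u : Ω → ℝ} (hu : Integrable u P) :
    ∫ o, h o * (P[u | m]) o ∂P = ∫ o, h o * u o ∂P := by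
  have hhu : Integrable (fun o => h o * u o) P :=
    hu.bdd_mul (hh.mono hm).aestronglyMeasurable (ae_of_all _ hb)
  rw [← integral_condExp hm (f := fun o => h o * u o)]
  exact integral_congr_ae (condExp_mul_of_stronglyMeasurable_left hh hhu hu).symm

theorem setIntegral_eq_integral_mul_indicator (hU : MeasurableSet U) (h : Ω → ℝ) :
    ∫ o in U, h o ∂P = ∫ o, h o * U.indicator (fun _ => (1 : ℝ)) o ∂P := by
  rw [← integral_indicator hU]
  refine integral_congr_ae (ae_of_all _ fun o => ?_)
  by_cases ho : o ∈ U <;> simp [ho]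

theorem setIntegral_inter_eq [IsFiniteMeasure P] (hm : m ≤ mΩ) (hU : MeasurableSet U)
    (hV : MeasurableSet V)
    (hind : P[(U ∩ V).indicator (fun _ => (1 : ℝ)) | m] =ᵐ[P]
      P[U.indicator (fun _ => (1 : ℝ)) | m] * P[V.indicator (fun _ => (1 : ℝ)) | m])
    (hq : StronglyMeasurable[m] q) (hq1 : ∀ o, |q o| ≤ 1)
    (hqV : P[V.indicator (fun _ => (1 : ℝ)) | m] =ᵐ[P] q)
    (hh : StronglyMeasurable[m] h) (hb : ∀ o, |h o| ≤ b) :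
    ∫ o in U ∩ V, h o ∂P = ∫ o in U, q o * h o ∂P := by
  have hqh (o : Ω) : |q o * h o| ≤ b := by
    rw [abs_mul]
    exact (mul_le_of_le_one_left (abs_nonneg _) (hq1 o)).trans (hb o)
  have hone {W : Set Ω} (hW : MeasurableSet W) : Integrable (W.indicator fun _ => (1 : ℝ)) P :=
    (integrable_const 1).indicator hW
  rw [setIntegral_eq_integral_mul_indicator (hU.inter hV),
    setIntegral_eq_integral_mul_indicator hU, ← integral_mul_condExp hm hh hb (hone (hU.inter hV)),
    ← integral_mul_condExp hm (h := fun o => q o * h o) (hq.mul hh) hqh (hone hU)]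
  refine integral_congr_ae ?_
  filter_upwards [hind, hqV] with o ho hqo
  rw [ho, Pi.mul_apply, hqo]
  ring

theorem integral_cond_eq (P : Measure Ω) (U : Set Ω) (h : Ω → ℝ) :
    ∫ o, h o ∂P[|U] = (P.real U)⁻¹ * ∫ o in U, h o ∂P := by
  rw [ProbabilityTheory.cond, integral_smul_measure, smul_eq_mul, ENNReal.toReal_inv,
    measureReal_def]

theorem integral_cond_inter_eq [IsFiniteMeasure P] (hm : m ≤ mΩ) (hU : MeasurableSet U)
    (hV : MeasurableSet V)
    (hind : P[(U ∩ V).indicator (fun _ => (1 : ℝ)) | m] =ᵐ[P]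
      P[U.indicator (fun _ => (1 : ℝ)) | m] * P[V.indicator (fun _ => (1 : ℝ)) | m])
    (hq : StronglyMeasurable[m] q) (hq1 : ∀ o, |q o| ≤ 1)
    (hqV : P[V.indicator (fun _ => (1 : ℝ)) | m] =ᵐ[P] q)
    (hh : StronglyMeasurable[m] h) (hb : ∀ o, |h o| ≤ b) :
    (∫ o, q o * h o ∂P[|U]) / ∫ o, q o ∂P[|U] = ∫ o, h o ∂P[|U ∩ V] := by
  have hmass : P.real (U ∩ V) = ∫ o in U, q o ∂P := by
    simpa using setIntegral_inter_eq hm hU hV hind hq hq1 hqV (h := fun _ => 1) (b := 1)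
      stronglyMeasurable_const (by simp)
  simp only [integral_cond_eq]
  rw [setIntegral_inter_eq hm hU hV hind hq hq1 hqV hh hb, hmass]
  rcases eq_or_ne (P U) 0 with hPU | hPU
  · simp [Measure.restrict_eq_zero.2 hPU]
  · rw [mul_div_mul_left _ _ (inv_ne_zero ((measureReal_ne_zero_iff (measure_ne_top P U)).2 hPU)),
      div_eq_inv_mul]

end CondIndep

section DisparityMeasures

variable {𝒳 : Type*} [MeasurableSpace 𝒳] {P : Measure (Obs 𝒳)} {μ f : 𝒳 → ℝ}
  {S : Fin 2 → Set (Fin 2)} {β : Fin 2 → ℝ}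

theorem measurable_featX : Measurable (featX : Obs 𝒳 → 𝒳) := measurable_fst

theorem measurable_attrA : Measurable (attrA : Obs 𝒳 → Fin 2) :=
  measurable_fst.comp measurable_snd

theorem measurable_outY : Measurable (outY : Obs 𝒳 → ℝ) :=
  measurable_snd.comp (measurable_snd.comp measurable_snd)

theorem sigmaX_le : sigmaX 𝒳 ≤ (inferInstance : MeasurableSpace (Obs 𝒳)) :=
  measurable_featX.comap_le

theorem disparity_one_eq_disparityOn [IsFiniteMeasure P] :
    disparity P μ (fun _ _ => 1) S β f = disparityOn P (fun a => {o | attrA o ∈ S a}) β f := by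
  refine Finset.sum_congr rfl fun a _ => congrArg (β a * ·) ?_
  change _ = ∫ o, f (featX o) ∂P[|attrA ⁻¹' S a]
  simp only [one_mul]
  by_cases hPa : P (attrA ⁻¹' S a) = 0
  · rw [cond_eq_zero_of_meas_eq_zero hPa]
    simp
  · have := cond_isProbabilityMeasure hPa
    simp

theorem disparity_eq_disparityOn_outcome [IsFiniteMeasure P] (hind : CondIndepGivenX P attrA outY)
    {g : 𝒳 → ℝ → ℝ} (hg : Measurable fun x => g x (μ x)) (hg1 : ∀ x, |g x (μ x)| ≤ 1) {e : ℝ}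
    (hge : P[(outY ⁻¹' {e}).indicator (fun _ => (1 : ℝ)) | sigmaX 𝒳] =ᵐ[P]
      fun o => g (featX o) (μ (featX o)))
    (hf : Measurable f) {b : ℝ} (hb : ∀ x, |f x| ≤ b) :
    disparity P μ g S β f =
      disparityOn P (fun a => {o | outY o = e ∧ attrA o ∈ S a}) β f := by
  have hcomp {h : 𝒳 → ℝ} (hh : Measurable h) :
      StronglyMeasurable[sigmaX 𝒳] fun o : Obs 𝒳 => h (featX o) :=
    (hh.comp (comap_measurable featX)).stronglyMeasurable
  refine Finset.sum_congr rfl fun a _ => congrArg (β a * ·) ?_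
  have hevent : {o : Obs 𝒳 | outY o = e ∧ attrA o ∈ S a} = attrA ⁻¹' S a ∩ outY ⁻¹' {e} :=
    Set.ext fun o => and_comm
  beta_reduce
  rw [hevent]
  exact integral_cond_inter_eq sigmaX_le (measurable_attrA .of_discrete)
    (measurable_outY (measurableSet_singleton e))
    (hind _ _ .of_discrete (measurableSet_singleton e)) (hcomp hg) (fun o => hg1 _) hge
    (hcomp hf) fun o => hb _

theorem condExp_outcome_one (hμ : IsRegression P μ) (hY : ∀ᵐ o ∂P, outY o = 0 ∨ outY o = 1) :
    P[(outY ⁻¹' {1}).indicator (fun _ => (1 : ℝ)) | sigmaX 𝒳] =ᵐ[P] fun o => μ (featX o) := by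
  refine (condExp_congr_ae ?_).trans hμ.ae_eq.symm
  filter_upwards [hY] with o ho
  rcases ho with h | h <;> simp [Set.indicator, h]

theorem condExp_outcome_zero [IsFiniteMeasure P] (hμ : IsRegression P μ)
    (hY : ∀ᵐ o ∂P, outY o = 0 ∨ outY o = 1) :
    P[(outY ⁻¹' {0}).indicator (fun _ => (1 : ℝ)) | sigmaX 𝒳] =ᵐ[P]
      fun o => 1 - μ (featX o) := by
  have hYint : Integrable outY P := by
    refine .of_mem_Icc 0 1 measurable_outY.aemeasurable ?_
    filter_upwards [hY] with o ho
    rcases ho with h | h <;> simp [h]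
  have hindicator : (outY ⁻¹' {0}).indicator (fun _ => (1 : ℝ)) =ᵐ[P] (fun _ => 1) - outY := by
    filter_upwards [hY] with o ho
    rcases ho with h | h <;> simp [Set.indicator, h]
  have hsub := condExp_sub (μ := P) (integrable_const (1 : ℝ)) hYint (sigmaX 𝒳)
  filter_upwards [condExp_congr_ae (m := sigmaX 𝒳) hindicator, hsub, hμ.ae_eq] with o h₁ h₂ h₃
  rw [h₁, h₂, h₃, Pi.sub_apply, condExp_const sigmaX_le]

end DisparityMeasures

/-! ### Losses that are convex in the outcome -/

section ConvexLoss

variable {l : ℝ → ℝ → ℝ}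

theorem UnitLipschitzLoss.continuousOn_left (hl : UnitLipschitzLoss l) {u : ℝ}
    (hu : u ∈ Set.Icc (0 : ℝ) 1) : ContinuousOn (fun y => l y u) (Set.Icc 0 1) := by
  refine (LipschitzOnWith.of_dist_le_mul (K := 1) fun y hy y' hy' => ?_).continuousOn
  simpa [Real.dist_eq] using hl.lipschitz y hy y' hy' u hu u hu

theorem integral_loss_condExp_le {Ω 𝒳 : Type*} [MeasurableSpace Ω] [MeasurableSpace 𝒳]
    {P : Measure Ω} [IsFiniteMeasure P] (hl : UnitLipschitzLoss l)
    (hconv : ∀ u ∈ Set.Icc (0 : ℝ) 1, ConvexOn ℝ (Set.Icc (0 : ℝ) 1) fun y => l y u)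
    {X : Ω → 𝒳} (hX : Measurable X) {Y : Ω → Set.Icc (0 : ℝ) 1} (hY : Measurable Y)
    {μ : 𝒳 → ℝ} (hμm : Measurable μ) (hμ1 : ∀ x, μ x ∈ Set.Icc (0 : ℝ) 1)
    (hμ : (fun o => μ (X o)) =ᵐ[P] P[fun o => (Y o : ℝ) | MeasurableSpace.comap X inferInstance])
    {f : 𝒳 → ℝ} (hf : Measurable f) (hf1 : ∀ x, f x ∈ Set.Icc (0 : ℝ) 1) :
    ∫ o, l (μ (X o)) (f (X o)) ∂P ≤ ∫ o, l (Y o) (f (X o)) ∂P := by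
  set κ := condDistrib Y X P
  have hval : Measurable ((↑) : Set.Icc (0 : ℝ) 1 → ℝ) := measurable_subtype_coe
  have hloss : Measurable fun p : 𝒳 × Set.Icc (0 : ℝ) 1 => l p.2 (f p.1) :=
    hl.measurable (hval.comp measurable_snd) (hf.comp measurable_fst) (fun p => p.2.2)
      fun p => hf1 p.1
  have hcond : P[fun o => l (Y o) (f (X o)) | MeasurableSpace.comap X inferInstance] =ᵐ[P]
      fun o => ∫ y : Set.Icc (0 : ℝ) 1, l y (f (X o)) ∂κ (X o) :=
    condExp_prod_ae_eq_integral_condDistrib hX hY.aemeasurable hloss.stronglyMeasurable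
      (hl.integrable P (hval.comp hY) (hf.comp hX) (fun o => (Y o).2) fun o => hf1 _)
  have hmean : P[fun o => (Y o : ℝ) | MeasurableSpace.comap X inferInstance] =ᵐ[P]
      fun o => ∫ y : Set.Icc (0 : ℝ) 1, (y : ℝ) ∂κ (X o) :=
    condExp_ae_eq_integral_condDistrib hX hY.aemeasurable hval.stronglyMeasurable
      (.of_mem_Icc 0 1 (hval.comp hY).aemeasurable (ae_of_all _ fun o => (Y o).2))
  rw [← integral_condExp hX.comap_le (f := fun o => l (Y o) (f (X o))), integral_congr_ae hcond]
  refine integral_mono_ae (hl.integrable P (hμm.comp hX) (hf.comp hX) (fun o => hμ1 _)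
    fun o => hf1 _) (integrable_condExp.congr hcond) ?_
  filter_upwards [hμ, hmean] with o hμo hmeano
  rw [hμo, hmeano]
  exact (hconv _ (hf1 _)).map_integral_le (hl.continuousOn_left (hf1 _)) isClosed_Icc
    (ae_of_all _ fun y => y.2) (.of_mem_Icc 0 1 hval.aemeasurable (ae_of_all _ fun y => y.2))
    (hl.integrable _ hval measurable_const (fun y => y.2) fun _ => hf1 _)

theorem lossMu_le_loss {𝒳 : Type*} [MeasurableSpace 𝒳] {P : Measure (Obs 𝒳)} [IsFiniteMeasure P]
    {μ : 𝒳 → ℝ} (hμ : IsRegression P μ) (hY : ∀ᵐ o ∂P, outY o ∈ Set.Icc (0 : ℝ) 1)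
    (hl : UnitLipschitzLoss l)
    (hconv : ∀ u ∈ Set.Icc (0 : ℝ) 1, ConvexOn ℝ (Set.Icc (0 : ℝ) 1) fun y => l y u) {f : 𝒳 → ℝ}
    (hf : Measurable f) (hf1 : ∀ x, f x ∈ Set.Icc (0 : ℝ) 1) :
    lossMu P μ l f ≤ loss P l f := by
  set Y : Obs 𝒳 → Set.Icc (0 : ℝ) 1 := fun o => Set.projIcc 0 1 zero_le_one (outY o)
  have hYout : ∀ᵐ o ∂P, outY o = Y o := by
    filter_upwards [hY] with o ho
    simp only [Y, Set.projIcc_of_mem zero_le_one ho]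
  calc lossMu P μ l f ≤ ∫ o, l (Y o) (f (featX o)) ∂P :=
        integral_loss_condExp_le hl hconv measurable_featX
          (continuous_projIcc.measurable.comp measurable_outY) hμ.measurable hμ.mem_Icc
          (hμ.ae_eq.trans (condExp_congr_ae hYout)) hf hf1
    _ = loss P l f := integral_congr_ae <| by
        filter_upwards [hYout] with o ho
        rw [ho]

end ConvexLoss

/-! ### Good samples -/

theorem exists_measurableSet_one_sub_le_of_measure_le {Ω : Type*} [MeasurableSpace Ω]
    {ν : Measure Ω} [IsProbabilityMeasure ν] {p : Ω → Prop} {δ : ℝ} (hδ : 0 ≤ δ)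
    (h : ν {s | ¬ p s} ≤ ENNReal.ofReal δ) :
    ∃ G : Set Ω, MeasurableSet G ∧ 1 - δ ≤ ν.real G ∧ ∀ s ∈ G, p s := by
  have hmeas := measurableSet_toMeasurable ν {s | ¬ p s}
  refine ⟨(toMeasurable ν {s | ¬ p s})ᶜ, hmeas.compl, ?_, fun s hs => ?_⟩
  · rw [probReal_compl_eq_one_sub hmeas, measureReal_def, measure_toMeasurable]
    exact sub_le_sub_left (ENNReal.toReal_le_of_le_ofReal hδ h) 1
  · exact not_not.1 fun hp => hs (subset_toMeasurable _ _ hp)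

/-- The population-level assumptions of the learning problem: the class `ℱ`, the loss `l`, and
the disparity with parameters `β`, group events `S` and weight `g`. -/
structure Admissible {𝒳 : Type*} [MeasurableSpace 𝒳] (P : Measure (Obs 𝒳)) (μ : 𝒳 → ℝ)
    (ℱ : Set (𝒳 → ℝ)) (l : ℝ → ℝ → ℝ) (S : Fin 2 → Set (Fin 2)) (g : 𝒳 → ℝ → ℝ)
    (β : Fin 2 → ℝ) (Bxi ω : ℝ) : Prop where
  reg_measurable : Measurable μ
  reg_mem : ∀ x, μ x ∈ Set.Icc (0 : ℝ) 1
  pred_measurable : ∀ f ∈ ℱ, Measurable f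
  pred_mem : ∀ f ∈ ℱ, ∀ x, f x ∈ Set.Icc (0 : ℝ) 1
  loss : UnitLipschitzLoss l
  weight_measurable : Measurable (Function.uncurry g)
  weight_mem : ∀ x, ∀ m ∈ Set.Icc (0 : ℝ) 1, g x m ∈ Set.Icc (0 : ℝ) 1
  omega_pos : 0 < ω
  weight_mean : ∀ a, β a ≠ 0 → ω ≤ ∫ o, g (featX o) (μ (featX o)) ∂P[|attrA ⁻¹' S a]
  Bxi_pos : 0 < Bxi
  disp_bound : ∀ u ∈ Set.Icc (0 : ℝ) 1, ∀ v ∈ Set.Icc (0 : ℝ) 1, |β 0 * u + β 1 * v| ≤ Bxi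

/-- The samples on which the returned distribution is near-optimal. The comparison distribution
`Q` needs only the one-sided Hoeffding bound, whose width does not involve the complexity of `ℱ`. -/
structure GoodSample {𝒳 : Type*} [MeasurableSpace 𝒳] {n : ℕ} (P : Measure (Obs 𝒳)) (μ : 𝒳 → ℝ)
    {ℱ : Set (𝒳 → ℝ)} (l : ℝ → ℝ → ℝ) (S : Fin 2 → Set (Fin 2)) (g : 𝒳 → ℝ → ℝ)
    (β : Fin 2 → ℝ) (C φ δ : ℝ) (N : ℕ) (Q : PMF ℱ) (s : Fin n → Obs 𝒳) : Prop where
  loss : UniformOnGrid ℱ N (lossWeight l N fun o => μ (featX o)) featX P (devWidth C φ δ N n) s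
  group : ∀ a, β a ≠ 0 → 0 < groupCount (S a) s →
    UniformOnGrid ℱ N (fun _ o => g (featX o) (μ (featX o))) featX P[|attrA ⁻¹' S a]
      (devWidth C φ δ N (groupCount (S a) s)) fun i : hits (attrA ⁻¹' S a) s => s i
  hoeffding : (mix Q fun f => sampleError P s fun o => l (μ (featX o)) ((f : 𝒳 → ℝ) (featX o))) ≤
    √(-Real.log δ / 2) * (n : ℝ) ^ (-(1 / 2) : ℝ)

namespace Admissible

variable {𝒳 : Type*} [MeasurableSpace 𝒳] {P : Measure (Obs 𝒳)} {μ : 𝒳 → ℝ} {ℱ : Set (𝒳 → ℝ)}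
  {l : ℝ → ℝ → ℝ} {S : Fin 2 → Set (Fin 2)} {g : 𝒳 → ℝ → ℝ} {β : Fin 2 → ℝ} {Bxi ω : ℝ}

theorem measurable_reg_featX (h : Admissible P μ ℱ l S g β Bxi ω) :
    Measurable fun o : Obs 𝒳 => μ (featX o) :=
  h.reg_measurable.comp measurable_featX

theorem measurable_weight_featX (h : Admissible P μ ℱ l S g β Bxi ω) :
    Measurable fun o : Obs 𝒳 => g (featX o) (μ (featX o)) :=
  h.weight_measurable.comp (measurable_featX.prodMk h.measurable_reg_featX)

theorem weight_featX_mem (h : Admissible P μ ℱ l S g β Bxi ω) (o : Obs 𝒳) :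
    g (featX o) (μ (featX o)) ∈ Set.Icc (0 : ℝ) 1 :=
  h.weight_mem _ _ (h.reg_mem _)

theorem loss_mem (h : Admissible P μ ℱ l S g β Bxi ω) (f : ℱ) (o : Obs 𝒳) :
    l (μ (featX o)) ((f : 𝒳 → ℝ) (featX o)) ∈ Set.Icc (0 : ℝ) 1 :=
  h.loss.mem_Icc _ (h.reg_mem _) _ (h.pred_mem f f.2 _)

theorem abs_beta_le (h : Admissible P μ ℱ l S g β Bxi ω) (a : Fin 2) : |β a| ≤ Bxi := by
  have hone := h.disp_bound 1 (by simp) 0 (by simp)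
  have hzero := h.disp_bound 0 (by simp) 1 (by simp)
  fin_cases a
  · simpa using hone
  · simpa using hzero

theorem measure_group_ne_zero (h : Admissible P μ ℱ l S g β Bxi ω) {a : Fin 2} (ha : β a ≠ 0) :
    P (attrA ⁻¹' S a) ≠ 0 := by
  intro hzero
  have hmean := h.weight_mean a ha
  rw [cond_eq_zero_of_meas_eq_zero hzero, integral_zero_measure] at hmean
  exact hmean.not_gt h.omega_pos

theorem abs_lossMu_le [IsProbabilityMeasure P] (h : Admissible P μ ℱ l S g β Bxi ω) (f : ℱ) :
    |lossMu P μ l f| ≤ 1 :=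
  h.loss.abs_integral_le (ae_of_all P fun _ => h.reg_mem _) fun _ => h.pred_mem f f.2 _

theorem abs_disparity_le [IsFiniteMeasure P] (h : Admissible P μ ℱ l S g β Bxi ω) (f : ℱ) :
    |disparity P μ g S β f| ≤ Bxi := by
  have hratio (a : Fin 2) := integral_mul_div_integral_mem_Icc (ν := P[|attrA ⁻¹' S a])
    (X := featX) h.measurable_weight_featX h.weight_featX_mem (h.pred_mem f f.2)
  rw [disparity, Fin.sum_univ_two]
  exact h.disp_bound _ (hratio 0) _ (hratio 1)

variable [IsProbabilityMeasure P] {C φ δ : ℝ} {n N : ℕ}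

theorem measure_not_loss_uniformOnGrid_le (h : Admissible P μ ℱ l S g β Bxi ω)
    (hℱ : PointwiseMeasurable ℱ) (hφ : φ ≤ 1 / 2)
    (hR : ∀ m : ℕ, 1 ≤ m → rademacher (thrClass ℱ) m ≤ C * (m : ℝ) ^ (-φ))
    (hn : 0 < n) (hN : 0 < N) (hδ : 0 < δ) :
    (Measure.pi fun _ : Fin n => P) {s | ¬ UniformOnGrid ℱ N (lossWeight l N fun o => μ (featX o))
      featX P (devWidth C φ δ N n) s} ≤ ENNReal.ofReal δ := by
  have : Nonempty (Fin n) := ⟨⟨0, hn⟩⟩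
  simpa only [Fintype.card_fin] using measure_not_uniformOnGrid_le (ι := Fin n) h.pred_measurable
    hℱ hφ hR measurable_featX
    (fun _ => measurable_lossWeight h.loss hN h.measurable_reg_featX fun _ => h.reg_mem _)
    (fun _ hj o => abs_lossWeight_le h.loss hN (fun _ => h.reg_mem _) hj o) hδ

theorem measure_not_group_uniformOnGrid_le (h : Admissible P μ ℱ l S g β Bxi ω)
    (hℱ : PointwiseMeasurable ℱ) (hφ : φ ≤ 1 / 2)
    (hR : ∀ m : ℕ, 1 ≤ m → rademacher (thrClass ℱ) m ≤ C * (m : ℝ) ^ (-φ)) (hδ : 0 < δ)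
    {a : Fin 2} (ha : β a ≠ 0) :
    (Measure.pi fun _ : Fin n => P) {s | 0 < groupCount (S a) s ∧
      ¬ UniformOnGrid ℱ N (fun _ o => g (featX o) (μ (featX o))) featX P[|attrA ⁻¹' S a]
        (devWidth C φ δ N (groupCount (S a) s)) fun i : hits (attrA ⁻¹' S a) s => s i} ≤
      ENNReal.ofReal δ := by
  have := cond_isProbabilityMeasure (h.measure_group_ne_zero ha)
  simp only [groupCount_eq_card_hits]
  refine measure_hits_le P (measurable_attrA .of_discrete) (h.measure_group_ne_zero ha)
    (fun T => {u | 0 < T.card ∧ ¬ UniformOnGrid ℱ N (fun _ o => g (featX o) (μ (featX o))) featX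
      P[|attrA ⁻¹' S a] (devWidth C φ δ N T.card) u}) fun T => ?_
  rcases T.eq_empty_or_nonempty with hT | hT
  · simp [hT]
  · have : Nonempty T := hT.to_subtype
    have hbound := measure_not_uniformOnGrid_le (ι := T) (N := N) (ν := P[|attrA ⁻¹' S a])
      h.pred_measurable hℱ hφ hR measurable_featX (fun _ _ => h.measurable_weight_featX)
      (fun _ _ o => abs_le_one_of_mem_Icc (h.weight_featX_mem o)) hδ
    rw [Fintype.card_coe] at hbound
    exact (measure_mono fun u hu => hu.2).trans hbound

theorem measure_hoeffding_lt_le (h : Admissible P μ ℱ l S g β Bxi ω) (hn : 0 < n)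
    (hδ0 : 0 < δ) (hδ1 : δ ≤ 1) (Q : PMF ℱ) :
    (Measure.pi fun _ : Fin n => P) {s | √(-Real.log δ / 2) * (n : ℝ) ^ (-(1 / 2) : ℝ) <
      mix Q fun f => sampleError P s fun o => l (μ (featX o)) ((f : 𝒳 → ℝ) (featX o))} ≤
      ENNReal.ofReal δ := by
  have hn0 : (0 : ℝ) < n := Nat.cast_pos.2 hn
  have hlog : 0 ≤ -Real.log δ / 2 := by linarith [Real.log_nonpos hδ0.le hδ1]
  have hsq : ((n : ℝ) ^ (-(1 / 2) : ℝ)) ^ 2 = (n : ℝ)⁻¹ := by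
    rw [← Real.rpow_natCast, ← Real.rpow_mul hn0.le, ← Real.rpow_neg_one]
    norm_num
  have htail : Real.exp (-(2 * n * (√(-Real.log δ / 2) * (n : ℝ) ^ (-(1 / 2) : ℝ)) ^ 2)) = δ := by
    rw [mul_pow, Real.sq_sqrt hlog, hsq]
    field_simp
    exact Real.exp_log hδ0
  have : Nonempty (Fin n) := ⟨⟨0, hn⟩⟩
  have hbound := measure_lt_mix_sampleError_le (ι := Fin n) Q P
    (v := fun f o => l (μ (featX o)) ((f : 𝒳 → ℝ) (featX o)))
    (fun f => h.loss.measurable h.measurable_reg_featX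
      ((h.pred_measurable f f.2).comp measurable_featX) (fun _ => h.reg_mem _)
      fun _ => h.pred_mem f f.2 _) h.loss_mem
    (t := √(-Real.log δ / 2) * (n : ℝ) ^ (-(1 / 2) : ℝ)) (by positivity)
  rwa [Fintype.card_fin, htail] at hbound

theorem measure_not_goodSample_le (h : Admissible P μ ℱ l S g β Bxi ω)
    (hℱ : PointwiseMeasurable ℱ) (hφ : φ ≤ 1 / 2)
    (hR : ∀ m : ℕ, 1 ≤ m → rademacher (thrClass ℱ) m ≤ C * (m : ℝ) ^ (-φ))
    (hn : 0 < n) (hN : 0 < N) (hδ0 : 0 < δ) (hδ1 : δ ≤ 1) (Q : PMF ℱ) :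
    (Measure.pi fun _ : Fin n => P) {s | ¬ GoodSample P μ l S g β C φ δ N Q s} ≤
      ENNReal.ofReal (4 * δ) := by
  set groupBad : Fin 2 → Set (Fin n → Obs 𝒳) := fun a => {s | β a ≠ 0 ∧ 0 < groupCount (S a) s ∧
    ¬ UniformOnGrid ℱ N (fun _ o => g (featX o) (μ (featX o))) featX P[|attrA ⁻¹' S a]
      (devWidth C φ δ N (groupCount (S a) s)) fun i : hits (attrA ⁻¹' S a) s => s i}
  have hgroup (a : Fin 2) : (Measure.pi fun _ : Fin n => P) (groupBad a) ≤ ENNReal.ofReal δ := by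
    by_cases ha : β a = 0
    · simp [groupBad, ha]
    · exact (measure_mono fun s hs => hs.2).trans
        (h.measure_not_group_uniformOnGrid_le hℱ hφ hR hδ0 ha)
  refine (measure_mono fun s hs => ?_).trans <| (measure_union_le _ _).trans <| (add_le_add
    (measure_union_le _ _) (measure_union_le _ _)).trans <| (add_le_add
    (add_le_add (h.measure_not_loss_uniformOnGrid_le hℱ hφ hR hn hN hδ0)
      (h.measure_hoeffding_lt_le hn hδ0 hδ1 Q)) (add_le_add (hgroup 0) (hgroup 1))).trans_eq ?_
  · by_contra hgood
    simp only [Set.mem_union, not_or, Set.mem_ofPred_eq, not_not, not_lt] at hgood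
    refine hs ⟨hgood.1.1, fun a ha hcount => ?_, hgood.1.2⟩
    have hmem : s ∉ groupBad a := by
      fin_cases a
      exacts [hgood.2.1, hgood.2.2]
    exact not_not.1 fun hgrid => hmem ⟨ha, hcount, hgrid⟩
  · rw [← ENNReal.ofReal_add hδ0.le hδ0.le, ← ENNReal.ofReal_add (by positivity) (by positivity)]
    ring_nf

end Admissible

/-! ### From empirical to population quantities -/

namespace AlgInput

/-- `I` is an admissible input whose data come from the sample `s` of the population `P`. -/
structure SampledFrom {𝒳 : Type*} [MeasurableSpace 𝒳] {n : ℕ} (I : AlgInput 𝒳 n)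
    (P : Measure (Obs 𝒳)) (μ : 𝒳 → ℝ) (ℱ : Set (𝒳 → ℝ)) (ω : ℝ) (s : Fin n → Obs 𝒳) : Prop where
  regular : I.Regular ℱ
  admissible : Admissible P μ ℱ I.l I.S I.g I.β I.Bxi ω
  data_eq : I.data = modifiedData μ s

/-- `GoodSample` with the parameters of `I`. -/
abbrev IsGood {𝒳 : Type*} [MeasurableSpace 𝒳] {n : ℕ} (I : AlgInput 𝒳 n) (P : Measure (Obs 𝒳))
    (μ : 𝒳 → ℝ) {ℱ : Set (𝒳 → ℝ)} (C φ δ : ℝ) (Q : PMF ℱ) (s : Fin n → Obs 𝒳) : Prop :=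
  GoodSample P μ I.l I.S I.g I.β C φ δ I.N Q s

namespace SampledFrom

variable {𝒳 : Type*} [MeasurableSpace 𝒳] {n : ℕ} {I : AlgInput 𝒳 n} {P : Measure (Obs 𝒳)}
  {μ : 𝒳 → ℝ} {ℱ : Set (𝒳 → ℝ)} {ω : ℝ} {s : Fin n → Obs 𝒳}

theorem abs_costHat_add_c0Hat_sub_sampleError_le (h : I.SampledFrom P μ ℱ ω s) (f : ℱ) :
    |I.costHat f + c0Hat I.l I.N I.cover I.data - (lossMu P μ I.l f +
      sampleError P s fun o => I.l (μ (featX o)) ((f : 𝒳 → ℝ) (featX o)))| ≤ 1 / I.N := by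
  have hcost := h.regular.abs_costHat_add_c0Hat_sub_le f.2
  simp only [h.data_eq, modifiedData] at hcost ⊢
  rwa [lossMu, sampleError, Fintype.card_fin, add_sub_cancel]

variable [IsProbabilityMeasure P]

theorem costHatQ_add_c0Hat_le (h : I.SampledFrom P μ ℱ ω s) (Q : PMF ℱ) :
    I.costHatQ Q + c0Hat I.l I.N I.cover I.data ≤ mix Q (fun f => lossMu P μ I.l f) +
      mix Q (fun f => sampleError P s fun o => I.l (μ (featX o)) ((f : 𝒳 → ℝ) (featX o))) +
      1 / I.N := by
  set c := c0Hat I.l I.N I.cover I.data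
  have hcost (f : ℱ) : |I.costHat f| ≤ 1 := h.regular.abs_costHat_le f
  have hpoint (f : ℱ) := abs_le.1 (h.abs_costHat_add_c0Hat_sub_sampleError_le f)
  have herror (f : ℱ) : |sampleError P s fun o => I.l (μ (featX o)) ((f : 𝒳 → ℝ) (featX o))| ≤
      2 + |c| + 1 / I.N := by
    have hcost := abs_le.1 (hcost f)
    have hloss := abs_le.1 (h.admissible.abs_lossMu_le f)
    have hc := abs_le.1 (le_refl |c|)
    obtain ⟨hlower, hupper⟩ := hpoint f
    exact abs_le.2 ⟨by linarith, by linarith⟩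
  have hsum (f : ℱ) : |lossMu P μ I.l f + sampleError P s fun o =>
      I.l (μ (featX o)) ((f : 𝒳 → ℝ) (featX o))| ≤ 1 + (2 + |c| + 1 / I.N) :=
    (abs_add_le _ _).trans (add_le_add (h.admissible.abs_lossMu_le f) (herror f))
  have hmono := mix_mono Q (v := fun f : ℱ => I.costHat f + c)
    (fun f => (abs_add_le _ _).trans (add_le_add (hcost f) le_rfl))
    (fun f => (abs_add_le _ _).trans (add_le_add (hsum f) le_rfl))
    (fun f => sub_le_iff_le_add'.1 (hpoint f).2)
  rwa [mix_add Q hcost fun _ => le_rfl, mix_add Q hsum fun _ => le_rfl,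
    mix_add Q h.admissible.abs_lossMu_le herror, mix_const, mix_const] at hmono

variable {C φ δ : ℝ} {Qs : PMF ℱ}

theorem abs_costHat_add_c0Hat_sub_lossMu_le (h : I.SampledFrom P μ ℱ ω s)
    (hs : I.IsGood P μ C φ δ Qs s) (f : ℱ) :
    |I.costHat f + c0Hat I.l I.N I.cover I.data - lossMu P μ I.l f| ≤
      2 * devWidth C φ δ I.N n + 2 / I.N := by
  have hcost := abs_le.1 (h.abs_costHat_add_c0Hat_sub_sampleError_le f)
  have hsample := abs_le.1 (h.admissible.loss.abs_sampleError_le h.regular.N_pos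
    h.admissible.measurable_reg_featX (fun _ => h.admissible.reg_mem _) measurable_featX hs.loss
    f.2 (h.admissible.pred_measurable f f.2) (h.admissible.pred_mem f f.2))
  have htwo : 2 / (I.N : ℝ) = 1 / I.N + 1 / I.N := by ring
  rw [abs_le, htwo]
  constructor <;> linarith

theorem mix_lossMu_le (h : I.SampledFrom P μ ℱ ω s) (hs : I.IsGood P μ C φ δ Qs s) (Q : PMF ℱ) :
    mix Q (fun f => lossMu P μ I.l f) ≤ I.costHatQ Q + c0Hat I.l I.N I.cover I.data +
      (2 * devWidth C φ δ I.N n + 2 / I.N) := by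
  have hcost (f : ℱ) : |I.costHat f| ≤ 1 := h.regular.abs_costHat_le f
  have hmix := abs_mix_sub_mix_le Q
    (fun f => (abs_add_le _ _).trans (add_le_add (hcost f) le_rfl)) h.admissible.abs_lossMu_le
    fun f => h.abs_costHat_add_c0Hat_sub_lossMu_le hs f
  rw [mix_add Q hcost fun _ => le_rfl, mix_const] at hmix
  rw [costHatQ]
  linarith [(abs_le.1 hmix).1]

theorem abs_dispHat_sub_disparity_le (h : I.SampledFrom P μ ℱ ω s)
    (hs : I.IsGood P μ C φ δ Qs s) (hcount : ∀ a, I.β a ≠ 0 → 0 < groupCount (I.S a) s) (f : ℱ) :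
    |I.dispHat f - disparity P μ I.g I.S I.β f| ≤
      ∑ a, |I.β a| * ((2 * devWidth C φ δ I.N (groupCount (I.S a) s) + 1 / I.N) / ω) := by
  rw [dispHat, disparity, ← Finset.sum_sub_distrib]
  refine (Finset.abs_sum_le_sum_abs _ _).trans (Finset.sum_le_sum fun a _ => ?_)
  rw [← mul_sub, abs_mul]
  by_cases ha : I.β a = 0
  · simp [ha]
  refine mul_le_mul_of_nonneg_left ?_ (abs_nonneg _)
  have hprob := cond_isProbabilityMeasure (h.admissible.measure_group_ne_zero ha)
  have hnonempty : Nonempty (hits (attrA ⁻¹' I.S a) s) :=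
    (Finset.card_pos.1 (groupCount_eq_card_hits (I.S a) s ▸ hcount a ha)).to_subtype
  have hden := sum_groupWeight_mul h.data_eq a fun _ => 1
  simp only [mul_one] at hden
  rw [sum_groupWeight_mul h.data_eq a (I.gridThr f), hden]
  exact abs_ratio_sub_le h.regular.N_pos h.admissible.measurable_weight_featX
    h.admissible.weight_featX_mem measurable_featX h.admissible.omega_pos
    (h.admissible.weight_mean a ha) (hs.group a ha (hcount a ha)) f.2
    (h.admissible.pred_measurable f f.2) (h.admissible.pred_mem f f.2)

theorem abs_abs_dispHatQ_sub_le (h : I.SampledFrom P μ ℱ ω s) (hs : I.IsGood P μ C φ δ Qs s)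
    (hcount : ∀ a, I.β a ≠ 0 → 0 < groupCount (I.S a) s) (Q : PMF ℱ) :
    |(|I.dispHatQ Q| - |mix Q fun f => disparity P μ I.g I.S I.β f|)| ≤
      ∑ a, |I.β a| * ((2 * devWidth C φ δ I.N (groupCount (I.S a) s) + 1 / I.N) / ω) :=
  (abs_abs_sub_abs_le _ _).trans <| abs_mix_sub_mix_le Q
    (fun f : ℱ => h.regular.abs_dispHat_le f) h.admissible.abs_disparity_le
    fun f => h.abs_dispHat_sub_disparity_le hs hcount f

theorem abs_mix_disparity_QHat_le (h : I.SampledFrom P μ ℱ ω s) (hs : I.IsGood P μ C φ δ Qs s)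
    (hcount : ∀ a, I.β a ≠ 0 → 0 < groupCount (I.S a) s) {η : ℝ} {best : (Fin 3 → ℝ) → ℱ}
    (hbest : I.IsBestH ℱ best) (hBl : 0 < I.Blam) {t : ℕ} (hgap : I.gap η best t ≤ I.nu)
    {Q : PMF ℱ} (hQ : I.costHatQ Q ≤ I.epsHat) :
    |mix (I.QHat η best t) fun f => disparity P μ I.g I.S I.β f| ≤
      |mix Q fun f => disparity P μ I.g I.S I.β f| + 2 * I.nu + (I.Bxi + 2 * I.nu) / I.Blam +
        2 * ∑ a, |I.β a| * ((2 * devWidth C φ δ I.N (groupCount (I.S a) s) + 1 / I.N) / ω) := by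
  have hsaddle := (saddle_guarantee hbest hBl h.admissible.Bxi_pos.le
    (fun f => h.regular.abs_dispHat_le f) (fun f => h.regular.abs_costHat_le f) hgap hQ).2
  have hhat := abs_le.1 (h.abs_abs_dispHatQ_sub_le hs hcount (I.QHat η best t))
  have hcomparison := abs_le.1 (h.abs_abs_dispHatQ_sub_le hs hcount Q)
  linarith

end SampledFrom

end AlgInput

/-! ### Rates -/

/-- The quantity `1 + ln n + ln (1/δ)`, powers of which are hidden in `Õ`. -/
def logFactor (n : ℕ) (δ : ℝ) : ℝ := 1 + Real.log n + Real.log (1 / δ)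

theorem one_le_logFactor {n : ℕ} {δ : ℝ} (hδ0 : 0 < δ) (hδ1 : δ ≤ 1) : 1 ≤ logFactor n δ := by
  have hlog : 0 ≤ Real.log (1 / δ) := Real.log_nonneg ((one_le_div hδ0).2 hδ1)
  have hn : 0 ≤ Real.log n := Real.log_natCast_nonneg n
  rw [logFactor]
  linarith

theorem polylog_one (K : ℝ) (n : ℕ) (δ : ℝ) : polylog K 1 n δ = K * logFactor n δ := by
  rw [polylog, pow_one, logFactor]

theorem rpow_neg_le_one {n : ℕ} {φ : ℝ} (hn : 0 < n) (hφ : 0 ≤ φ) : (n : ℝ) ^ (-φ) ≤ 1 :=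
  Real.rpow_le_one_of_one_le_of_nonpos (Nat.one_le_cast.2 hn) (neg_nonpos.2 hφ)

section DevWidth

/-- Bounds `√(8 ln (8 (N + 1) / δ))` in units of `logFactor` when `N ≤ cN' n ^ φ`. -/
def gridConst (cN' : ℝ) : ℝ := Real.log 8 + |Real.log (2 * cN')| + 1

/-- Bounds `devWidth` in units of `logFactor n δ * m ^ (-φ)`. -/
def devConst (C cN' : ℝ) : ℝ := 2 * C + 8 * gridConst cN'

theorem one_le_gridConst (cN' : ℝ) : 1 ≤ gridConst cN' := by
  have hlog : 0 ≤ Real.log 8 := Real.log_nonneg (by norm_num)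
  rw [gridConst]
  linarith [abs_nonneg (Real.log (2 * cN'))]

theorem devConst_nonneg {C : ℝ} (hC : 0 ≤ C) (cN' : ℝ) : 0 ≤ devConst C cN' := by
  rw [devConst]
  linarith [one_le_gridConst cN']

variable {φ cN' δ : ℝ} {N n : ℕ}

theorem log_grid_le (hφ : φ ≤ 1) (hn : 0 < n) (hN0 : 0 < N) (hN : (N : ℝ) ≤ cN' * (n : ℝ) ^ φ)
    (hδ0 : 0 < δ) (hδ1 : δ ≤ 1) :
    Real.log (1 / (δ / 8 / (N + 1))) ≤ gridConst cN' * logFactor n δ := by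
  have hn0 : (0 : ℝ) < n := Nat.cast_pos.2 hn
  have hN1 : (1 : ℝ) ≤ N := Nat.one_le_cast.2 hN0
  have hnφ : 0 < (n : ℝ) ^ φ := Real.rpow_pos_of_pos hn0 _
  have hcN' : 0 < cN' := pos_of_mul_pos_left (by linarith) hnφ.le
  have hsplit : Real.log (1 / (δ / 8 / (N + 1))) =
      Real.log 8 + Real.log (N + 1) + Real.log (1 / δ) := by
    rw [← Real.log_mul (by norm_num) (by positivity), ← Real.log_mul (by positivity)
      (by positivity)]
    congr 1
    field_simp
  have hgrid : Real.log ((N : ℝ) + 1) ≤ |Real.log (2 * cN')| + Real.log n := by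
    calc Real.log ((N : ℝ) + 1) ≤ Real.log (2 * cN' * (n : ℝ) ^ φ) :=
          Real.log_le_log (by positivity) (by linarith)
      _ = Real.log (2 * cN') + φ * Real.log n := by
          rw [Real.log_mul (by positivity) hnφ.ne', Real.log_rpow hn0]
      _ ≤ |Real.log (2 * cN')| + Real.log n := add_le_add (le_abs_self _)
          (mul_le_of_le_one_left (Real.log_natCast_nonneg n) hφ)
  have hfactor : gridConst cN' - 1 + logFactor n δ ≤ gridConst cN' * logFactor n δ := by
    nlinarith [one_le_gridConst cN', one_le_logFactor (n := n) hδ0 hδ1]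
  rw [gridConst, logFactor] at hfactor
  rw [hsplit, gridConst, logFactor]
  linarith

theorem devWidth_le {C : ℝ} (hC : 0 ≤ C) (hφ : φ ≤ 1) (hn : 0 < n) (hN0 : 0 < N)
    (hN : (N : ℝ) ≤ cN' * (n : ℝ) ^ φ) (hδ0 : 0 < δ) (hδ1 : δ ≤ 1) (m : ℕ) :
    devWidth C φ (δ / 8) N m ≤ devConst C cN' * logFactor n δ * (m : ℝ) ^ (-φ) := by
  have hΛ := one_le_logFactor (n := n) hδ0 hδ1
  have hunit : 1 ≤ gridConst cN' * logFactor n δ :=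
    one_le_mul_of_one_le_of_one_le (one_le_gridConst cN') hΛ
  have hsqrt : √(8 * Real.log (1 / (δ / 8 / (N + 1)))) ≤ 8 * (gridConst cN' * logFactor n δ) := by
    rw [Real.sqrt_le_left (by positivity)]
    nlinarith [log_grid_le hφ hn hN0 hN hδ0 hδ1]
  have hCΛ : C ≤ C * logFactor n δ := le_mul_of_one_le_right hC hΛ
  rw [devWidth, devConst]
  gcongr
  linarith

end DevWidth

theorem exists_threshold {φ cN δ : ℝ} (hφ : 0 < φ) (hcN : 0 < cN) (hδ : 0 < δ) (b : ℝ) :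
    ∃ m : ℕ, ∀ n ≥ m, b ≤ √(2 * Real.log (8 * (cN * (n : ℝ) ^ φ) / δ)) := by
  have hpow : Filter.Tendsto (fun n : ℕ => 8 * (cN * (n : ℝ) ^ φ) / δ) .atTop .atTop :=
    (((tendsto_rpow_atTop hφ).comp tendsto_natCast_atTop_atTop).const_mul_atTop hcN
      |>.const_mul_atTop (by norm_num)).atTop_div_const hδ
  exact Filter.eventually_atTop.1 <| (Real.tendsto_sqrt_atTop.comp
    ((Real.tendsto_log_atTop.comp hpow).const_mul_atTop two_pos)).eventually_ge_atTop b

/-- Bounds the number of iterations in units of `(1 + C' n^(-φ) + C'' n^(-1/2))² n^(4φ)`. -/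
def iterConst (ε Bxi cν cB : ℝ) : ℝ :=
  4 * (2 * Bxi + ε + 2) ^ 2 * (cB / cν) ^ 2 * Real.log 4 + 1

/-- Bounds the excess loss in units of `C' * logFactor n δ * n ^ (-φ)`. -/
def lossConst (Bxi C cν cB cN cN' : ℝ) : ℝ :=
  1 + (Bxi + 2 * cν) / cB + 2 * devConst C cN' + 2 / cN

/-- Bounds the error of the empirical disparity in units of
`logFactor n δ * (n₀ ^ (-φ) + n₁ ^ (-φ))`. -/
def dispErrConst (Bxi C ω cN cN' : ℝ) : ℝ := Bxi * ((2 * devConst C cN' + 1 / cN) / ω)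

/-- Bounds the excess disparity in units of `logFactor n δ * (n₀ ^ (-φ) + n₁ ^ (-φ))`. -/
def dispConst (Bxi C ω cν cB cN cN' : ℝ) : ℝ :=
  1 + 2 * cν + (Bxi + 2 * cν) / cB + 2 * dispErrConst Bxi C ω cN cN'

theorem lossConst_nonneg {Bxi C cν cB cN : ℝ} (hBxi : 0 ≤ Bxi) (hC : 0 ≤ C) (hcν : 0 ≤ cν)
    (hcB : 0 ≤ cB) (hcN : 0 ≤ cN) (cN' : ℝ) : 0 ≤ lossConst Bxi C cν cB cN cN' := by
  have hdev := devConst_nonneg hC cN'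
  rw [lossConst]
  positivity

/-- The constant `K` of the theorem. -/
def rateConst (ε Bxi C ω cν cB cN cN' : ℝ) : ℝ :=
  max (iterConst ε Bxi cν cB)
    (max (lossConst Bxi C cν cB cN cN') (dispConst Bxi C ω cν cB cN cN'))

namespace AlgInput

/-- The tuning parameters of `I` have the rates in the sample size `n` prescribed by the theorem.
The width `C' n^(-φ) - C'' n^(-1/2)` is how much larger than `ε` the empirical tolerance is. -/
structure Calibrated {𝒳 : Type*} {n : ℕ} (I : AlgInput 𝒳 n) (ε φ cν cB cN cN' C' C'' : ℝ) :
    Prop where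
  n_pos : 0 < n
  eps_nonneg : 0 ≤ ε
  phi_pos : 0 < φ
  phi_le : φ ≤ 1 / 2
  cnu_pos : 0 < cν
  cB_pos : 0 < cB
  cN_pos : 0 < cN
  Bxi_pos : 0 < I.Bxi
  nu_eq : I.nu = cν * (n : ℝ) ^ (-φ)
  Blam_eq : I.Blam = cB * (n : ℝ) ^ φ
  le_N : cN * (n : ℝ) ^ φ ≤ I.N
  N_le : (I.N : ℝ) ≤ cN' * (n : ℝ) ^ φ
  epsHat_eq : I.epsHat = ε - c0Hat I.l I.N I.cover I.data + C' * (n : ℝ) ^ (-φ) -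
    C'' * (n : ℝ) ^ (-(1 / 2) : ℝ)
  one_le_C' : 1 ≤ C'
  C''_nonneg : 0 ≤ C''

namespace Calibrated

variable {𝒳 : Type*} {n : ℕ} {I : AlgInput 𝒳 n} {ε φ cν cB cN cN' C' C'' : ℝ}

theorem n_cast_pos (hc : I.Calibrated ε φ cν cB cN cN' C' C'') : (0 : ℝ) < n :=
  Nat.cast_pos.2 hc.n_pos

theorem rpow_pos (hc : I.Calibrated ε φ cν cB cN cN' C' C'') (y : ℝ) : 0 < (n : ℝ) ^ y :=
  Real.rpow_pos_of_pos hc.n_cast_pos y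

theorem N_pos (hc : I.Calibrated ε φ cν cB cN cN' C' C'') : 0 < I.N :=
  Nat.cast_pos.1 ((mul_pos hc.cN_pos (hc.rpow_pos φ)).trans_le hc.le_N)

theorem Blam_pos (hc : I.Calibrated ε φ cν cB cN cN' C' C'') : 0 < I.Blam :=
  hc.Blam_eq ▸ mul_pos hc.cB_pos (hc.rpow_pos φ)

theorem nu_pos (hc : I.Calibrated ε φ cν cB cN cN' C' C'') : 0 < I.nu :=
  hc.nu_eq ▸ mul_pos hc.cnu_pos (hc.rpow_pos (-φ))

theorem rpow_mul_rpow_neg (hc : I.Calibrated ε φ cν cB cN cN' C' C'') :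
    (n : ℝ) ^ φ * (n : ℝ) ^ (-φ) = 1 := by
  rw [← Real.rpow_add hc.n_cast_pos, add_neg_cancel, Real.rpow_zero]

theorem rpow_neg_half_le (hc : I.Calibrated ε φ cν cB cN cN' C' C'') :
    (n : ℝ) ^ (-(1 / 2) : ℝ) ≤ (n : ℝ) ^ (-φ) :=
  Real.rpow_le_rpow_of_exponent_le (Nat.one_le_cast.2 hc.n_pos) (neg_le_neg hc.phi_le)

theorem rpow_div_N_le (hc : I.Calibrated ε φ cν cB cN cN' C' C'') :
    (n : ℝ) ^ φ / I.N ≤ 1 / cN := by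
  rw [div_le_div_iff₀ (Nat.cast_pos.2 hc.N_pos) hc.cN_pos, one_mul, mul_comm]
  exact hc.le_N

theorem one_div_N_eq (hc : I.Calibrated ε φ cν cB cN cN' C' C'') :
    1 / (I.N : ℝ) = (n : ℝ) ^ φ / I.N * (n : ℝ) ^ (-φ) := by
  rw [div_mul_eq_mul_div, hc.rpow_mul_rpow_neg]

theorem one_div_N_le (hc : I.Calibrated ε φ cν cB cN cN' C' C'') :
    1 / (I.N : ℝ) ≤ 1 / cN * (n : ℝ) ^ (-φ) :=
  hc.one_div_N_eq.trans_le (mul_le_mul_of_nonneg_right hc.rpow_div_N_le (hc.rpow_pos _).le)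

theorem devWidth_le (hc : I.Calibrated ε φ cν cB cN cN' C' C'') {C δ : ℝ} (hC : 0 ≤ C)
    (hδ0 : 0 < δ) (hδ1 : δ ≤ 1) (m : ℕ) :
    devWidth C φ (δ / 8) I.N m ≤ devConst C cN' * logFactor n δ * (m : ℝ) ^ (-φ) :=
  FairRashomon.devWidth_le hC (hc.phi_le.trans one_half_lt_one.le) hc.n_pos hc.N_pos hc.N_le
    hδ0 hδ1 m

theorem constraint_slack_le (hc : I.Calibrated ε φ cν cB cN cN' C' C'') :
    (I.Bxi + 2 * I.nu) / I.Blam ≤ (I.Bxi + 2 * cν) / cB * (n : ℝ) ^ (-φ) := by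
  have hnu : I.nu ≤ cν :=
    hc.nu_eq.trans_le (mul_le_of_le_one_right hc.cnu_pos.le
      (rpow_neg_le_one hc.n_pos hc.phi_pos.le))
  have hB := hc.cB_pos
  rw [hc.Blam_eq, div_mul_eq_div_div, Real.rpow_neg hc.n_cast_pos.le, ← div_eq_mul_inv]
  gcongr

theorem one_div_N_add_le (hc : I.Calibrated ε φ cν cB cN cN' C' C'') {r : ℝ} (hr : 0 ≤ r)
    (hslack : C'' + (n : ℝ) ^ φ / I.N + r ≤ C') :
    1 / (I.N : ℝ) + r * (n : ℝ) ^ (-(1 / 2) : ℝ) ≤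
      C' * (n : ℝ) ^ (-φ) - C'' * (n : ℝ) ^ (-(1 / 2) : ℝ) := by
  have hscaled := mul_le_mul_of_nonneg_right hslack (hc.rpow_pos (-φ)).le
  have hhalf := mul_le_mul_of_nonneg_left hc.rpow_neg_half_le (add_nonneg hc.C''_nonneg hr)
  rw [hc.one_div_N_eq]
  linarith

theorem tolerance_nonneg (hc : I.Calibrated ε φ cν cB cN cN' C' C'') :
    0 ≤ C' * (n : ℝ) ^ (-φ) ∧ 0 ≤ C'' * (n : ℝ) ^ (-(1 / 2) : ℝ) :=
  ⟨mul_nonneg (zero_le_one.trans hc.one_le_C') (hc.rpow_pos _).le,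
    mul_nonneg hc.C''_nonneg (hc.rpow_pos _).le⟩

variable {ℱ : Set (𝒳 → ℝ)}

theorem rho_le (hc : I.Calibrated ε φ cν cB cN cN' C' C'') (hI : I.Regular ℱ) (f : ℱ) :
    I.rho ℱ ≤ (2 * I.Bxi + ε + 2) *
      (1 + C' * (n : ℝ) ^ (-φ) + C'' * (n : ℝ) ^ (-(1 / 2) : ℝ)) := by
  obtain ⟨hA', hA''⟩ := hc.tolerance_nonneg
  have hc0 : |c0Hat I.l I.N I.cover I.data| ≤ 1 :=
    abs_mean_le (Finset.card_fin n) zero_le_one fun i _ => abs_le_one_of_mem_Icc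
      (hI.loss.mem_Icc _ (hI.lowerY_mem i) _ (half_grid_mem hI.N_pos))
  have heps : |I.epsHat| ≤ ε + 1 + (C' * (n : ℝ) ^ (-φ) + C'' * (n : ℝ) ^ (-(1 / 2) : ℝ)) := by
    obtain ⟨hlower, hupper⟩ := abs_le.1 hc0
    rw [hc.epsHat_eq, abs_le]
    constructor <;> linarith [hc.eps_nonneg]
  have hB := hc.Bxi_pos.le
  refine (hI.rho_le f hB).trans ?_
  nlinarith [mul_nonneg (add_nonneg hA' hA'') hB, mul_nonneg (add_nonneg hA' hA'') hc.eps_nonneg]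

theorem sq_Blam_div_nu (hc : I.Calibrated ε φ cν cB cN cN' C' C'') :
    (I.Blam / I.nu) ^ 2 = (cB / cν) ^ 2 * (n : ℝ) ^ (4 * φ) := by
  have hfour : (n : ℝ) ^ (4 * φ) = ((n : ℝ) ^ φ) ^ 4 := by
    rw [mul_comm, Real.rpow_mul hc.n_cast_pos.le, ← Real.rpow_natCast]
    norm_num
  have hφ := (hc.rpow_pos φ).ne'
  have hν := hc.cnu_pos.ne'
  rw [hc.Blam_eq, hc.nu_eq, Real.rpow_neg hc.n_cast_pos.le, hfour]
  field_simp

theorem exists_stopsAt_le (hc : I.Calibrated ε φ cν cB cN cN' C' C'') (hI : I.Regular ℱ)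
    {best : (Fin 3 → ℝ) → ℱ} (hbest : I.IsBestH ℱ best) :
    ∃ t : ℕ, I.StopsAt (I.learningRate ℱ) best t ∧ ((t + 1 : ℕ) : ℝ) ≤
      iterConst ε I.Bxi cν cB *
        (1 + C' * (n : ℝ) ^ (-φ) + C'' * (n : ℝ) ^ (-(1 / 2) : ℝ)) ^ 2 * (n : ℝ) ^ (4 * φ) := by
  have hρ := hI.rho_pos (best 0) hc.Bxi_pos
  obtain ⟨t, ht, hle⟩ := AlgInput.exists_stopsAt hbest hc.Blam_pos hc.Bxi_pos.le hc.nu_pos hρ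
    (η := I.learningRate ℱ) rfl hI.abs_viol_le_rho
  refine ⟨t, ht, hle.trans ?_⟩
  obtain ⟨hA', hA''⟩ := hc.tolerance_nonneg
  set A := 1 + C' * (n : ℝ) ^ (-φ) + C'' * (n : ℝ) ^ (-(1 / 2) : ℝ)
  have hone : 1 ≤ A ^ 2 * (n : ℝ) ^ (4 * φ) :=
    one_le_mul_of_one_le_of_one_le (one_le_pow₀ (by linarith))
      (Real.one_le_rpow (Nat.one_le_cast.2 hc.n_pos) (by linarith [hc.phi_pos]))
  have : 0 ≤ Real.log 4 := Real.log_nonneg (by norm_num)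
  calc 4 * I.rho ℱ ^ 2 * I.Blam ^ 2 * Real.log 4 / I.nu ^ 2 + 1
      = 4 * I.rho ℱ ^ 2 * (I.Blam / I.nu) ^ 2 * Real.log 4 + 1 := by ring
    _ ≤ 4 * ((2 * I.Bxi + ε + 2) * A) ^ 2 * ((cB / cν) ^ 2 * (n : ℝ) ^ (4 * φ)) * Real.log 4 +
          A ^ 2 * (n : ℝ) ^ (4 * φ) := by
        rw [hc.sq_Blam_div_nu]
        gcongr
        exact hc.rho_le hI (best 0)
    _ = iterConst ε I.Bxi cν cB * A ^ 2 * (n : ℝ) ^ (4 * φ) := by rw [iterConst]; ring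

end Calibrated

end AlgInput

/-! ### Near-optimality of the returned distribution -/

theorem exists_mix_le_abs_mix_le {𝒳 : Type*} {ℱ : Set (𝒳 → ℝ)} (hℱ : ℱ.Nonempty)
    (v w : ℱ → ℝ) (b : ℝ) {x : ℝ} (hx : 0 < x) :
    ∃ Q : PMF ℱ, ∀ Q' : PMF ℱ, mix Q' v ≤ b → mix Q v ≤ b ∧ |mix Q w| ≤ |mix Q' w| + x := by
  set V : Set ℝ := (fun Q : PMF ℱ => |mix Q w|) '' {Q | mix Q v ≤ b}
  rcases V.eq_empty_or_nonempty with hV | hV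
  · obtain ⟨f, hf⟩ := hℱ
    exact ⟨PMF.pure ⟨f, hf⟩, fun Q' hQ' =>
      (Set.eq_empty_iff_forall_notMem.1 hV _ ⟨Q', hQ', rfl⟩).elim⟩
  · obtain ⟨_, ⟨Q, hQ, rfl⟩, hlt⟩ := exists_lt_of_csInf_lt hV (lt_add_of_pos_right _ hx)
    have hbelow : BddBelow V := ⟨0, by rintro _ ⟨Q', _, rfl⟩; exact abs_nonneg _⟩
    exact ⟨Q, fun Q' hQ' => ⟨hQ, hlt.le.trans
      (add_le_add_left (csInf_le hbelow ⟨Q', hQ', rfl⟩) x)⟩⟩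

namespace AlgInput

/-- The two alternatives for the output `out` of the algorithm on the sample `s`: a near-optimal
distribution, with `R` in place of the factor hidden in `Õ`, or a correct report of
infeasibility. -/
def NearOptimal {𝒳 : Type*} [MeasurableSpace 𝒳] {n : ℕ} (I : AlgInput 𝒳 n) (P : Measure (Obs 𝒳))
    (μ : 𝒳 → ℝ) {ℱ : Set (𝒳 → ℝ)} (ε φ C' R : ℝ) (s : Fin n → Obs 𝒳) (out : Option (PMF ℱ)) :
    Prop :=
  (∃ Q : PMF ℱ, out = some Q ∧
    mix Q (fun f => lossMu P μ I.l f) ≤ ε + C' * R * (n : ℝ) ^ (-φ) ∧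
    ((∀ a, I.β a ≠ 0 → 0 < groupCount (I.S a) s) →
      ∀ Q' : PMF ℱ, mix Q' (fun f => lossMu P μ I.l f) ≤ ε →
        |mix Q (fun f => disparity P μ I.g I.S I.β f)| ≤
          |mix Q' (fun f => disparity P μ I.g I.S I.β f)| +
            R * (groupCount (I.S 0) s : ℝ) ^ (-φ) + R * (groupCount (I.S 1) s : ℝ) ^ (-φ))) ∨
  (out = none ∧ ¬ ∃ Q' : PMF ℱ, mix Q' (fun f => lossMu P μ I.l f) ≤ ε)

end AlgInput

theorem groupCount_le {𝒳 : Type*} {n : ℕ} (T : Set (Fin 2)) (s : Fin n → Obs 𝒳) :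
    groupCount T s ≤ n :=
  (Set.ncard_le_card _).trans_eq (Nat.card_fin n)

theorem rpow_neg_le_groupCount_rpow_neg {𝒳 : Type*} {n : ℕ} {T : Set (Fin 2)} {s : Fin n → Obs 𝒳}
    {φ : ℝ} (hφ : 0 ≤ φ) (hcount : 0 < groupCount T s) :
    (n : ℝ) ^ (-φ) ≤ (groupCount T s : ℝ) ^ (-φ) :=
  Real.rpow_le_rpow_of_nonpos (Nat.cast_pos.2 hcount) (Nat.cast_le.2 (groupCount_le T s))
    (neg_nonpos.2 hφ)

namespace AlgInput.Calibrated

variable {𝒳 : Type*} {n : ℕ} {I : AlgInput 𝒳 n} {s : Fin n → Obs 𝒳}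
  {ε C φ ω δ cν cB cN cN' C' C'' : ℝ}

theorem sum_group_error_le (hc : I.Calibrated ε φ cν cB cN cN' C' C'') (hC : 0 ≤ C)
    (hω : 0 < ω) (hβ : ∀ a, |I.β a| ≤ I.Bxi) (hδ0 : 0 < δ) (hδ1 : δ ≤ 1)
    (hcount : ∀ a, I.β a ≠ 0 → 0 < groupCount (I.S a) s) :
    ∑ a, |I.β a| * ((2 * devWidth C φ (δ / 8) I.N (groupCount (I.S a) s) + 1 / I.N) / ω) ≤
      dispErrConst I.Bxi C ω cN cN' * (logFactor n δ *
        ((groupCount (I.S 0) s : ℝ) ^ (-φ) + (groupCount (I.S 1) s : ℝ) ^ (-φ))) := by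
  set d := devConst C cN'
  set Λ := logFactor n δ
  have hΛ : 1 ≤ Λ := one_le_logFactor hδ0 hδ1
  have hd : 0 ≤ d := devConst_nonneg hC cN'
  have hcN := hc.cN_pos
  have hB := hc.Bxi_pos
  rw [← Fin.sum_univ_two fun a => (groupCount (I.S a) s : ℝ) ^ (-φ), Finset.mul_sum,
    Finset.mul_sum]
  refine Finset.sum_le_sum fun a _ => ?_
  set y := (groupCount (I.S a) s : ℝ) ^ (-φ)
  have hy : 0 ≤ y := by positivity
  by_cases ha : I.β a = 0
  · rw [ha, abs_zero, zero_mul, dispErrConst]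
    positivity
  have hxy : (n : ℝ) ^ (-φ) ≤ y := rpow_neg_le_groupCount_rpow_neg hc.phi_pos.le (hcount a ha)
  have hdev : 2 * devWidth C φ (δ / 8) I.N (groupCount (I.S a) s) + 1 / I.N ≤
      (2 * d + 1 / cN) * (Λ * y) := by
    have hN : 1 / (I.N : ℝ) ≤ 1 / cN * (Λ * y) := hc.one_div_N_le.trans <|
      mul_le_mul_of_nonneg_left (hxy.trans (le_mul_of_one_le_left hy hΛ)) (by positivity)
    linarith [hc.devWidth_le hC hδ0 hδ1 (groupCount (I.S a) s)]
  calc |I.β a| * ((2 * devWidth C φ (δ / 8) I.N (groupCount (I.S a) s) + 1 / I.N) / ω)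
      ≤ |I.β a| * ((2 * d + 1 / cN) * (Λ * y) / ω) := by gcongr
    _ ≤ I.Bxi * ((2 * d + 1 / cN) * (Λ * y) / ω) := by gcongr; exact hβ a
    _ = dispErrConst I.Bxi C ω cN cN' * (Λ * y) := by rw [dispErrConst]; ring

variable [MeasurableSpace 𝒳] {P : Measure (Obs 𝒳)} [IsProbabilityMeasure P] {μ : 𝒳 → ℝ}
  {ℱ : Set (𝒳 → ℝ)} {Qs : PMF ℱ}

theorem costHatQ_le_epsHat (hc : I.Calibrated ε φ cν cB cN cN' C' C'')
    (h : I.SampledFrom P μ ℱ ω s) (hs : I.IsGood P μ C φ (δ / 8) Qs s)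
    (hslack : C'' + (n : ℝ) ^ φ / I.N + √(-Real.log (δ / 8) / 2) ≤ C')
    (hQs : mix Qs (fun f => lossMu P μ I.l f) ≤ ε) : I.costHatQ Qs ≤ I.epsHat := by
  have hcost := h.costHatQ_add_c0Hat_le Qs
  have htol := hc.one_div_N_add_le (Real.sqrt_nonneg _) hslack
  rw [hc.epsHat_eq]
  linarith [hs.hoeffding]

theorem mix_lossMu_le (hc : I.Calibrated ε φ cν cB cN cN' C' C'')
    (h : I.SampledFrom P μ ℱ ω s) (hs : I.IsGood P μ C φ (δ / 8) Qs s) (hC : 0 ≤ C)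
    (hδ0 : 0 < δ) (hδ1 : δ ≤ 1) {Q : PMF ℱ}
    (hQ : I.costHatQ Q ≤ I.epsHat + (I.Bxi + 2 * I.nu) / I.Blam) :
    mix Q (fun f => lossMu P μ I.l f) ≤
      ε + C' * (lossConst I.Bxi C cν cB cN cN' * logFactor n δ) * (n : ℝ) ^ (-φ) := by
  set x := (n : ℝ) ^ (-φ)
  set Λ := logFactor n δ
  set d := devConst C cN'
  have hx : 0 ≤ x := (hc.rpow_pos _).le
  have hΛ : 1 ≤ Λ := one_le_logFactor hδ0 hδ1
  have hd : 0 ≤ d := devConst_nonneg hC cN'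
  have hslack_nonneg : 0 ≤ (I.Bxi + 2 * cν) / cB :=
    div_nonneg (by linarith [hc.Bxi_pos, hc.cnu_pos]) hc.cB_pos.le
  have hN_nonneg : 0 ≤ 2 / cN := div_nonneg two_pos.le hc.cN_pos.le
  have hterms : mix Q (fun f => lossMu P μ I.l f) ≤
      ε + (C' + (I.Bxi + 2 * cν) / cB + 2 * (d * Λ) + 2 / cN) * x := by
    have hN : 2 / (I.N : ℝ) ≤ 2 / cN * x := by
      simpa only [← mul_assoc, mul_one_div] using
        mul_le_mul_of_nonneg_left hc.one_div_N_le two_pos.le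
    linarith [h.mix_lossMu_le hs Q, hc.devWidth_le hC hδ0 hδ1 n, hc.constraint_slack_le,
      hc.epsHat_eq, hc.tolerance_nonneg.2]
  have hC' := hc.one_le_C'
  have hfactor : C' + (I.Bxi + 2 * cν) / cB + 2 * (d * Λ) + 2 / cN ≤
      C' * (lossConst I.Bxi C cν cB cN cN' * Λ) := by
    have hone : 1 ≤ C' * Λ := one_le_mul_of_one_le_of_one_le hC' hΛ
    calc C' + (I.Bxi + 2 * cν) / cB + 2 * (d * Λ) + 2 / cN
        ≤ C' * Λ + (I.Bxi + 2 * cν) / cB * (C' * Λ) + 2 * (d * (C' * Λ)) + 2 / cN * (C' * Λ) := by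
          gcongr
          exacts [le_mul_of_one_le_right (by linarith) hΛ,
            le_mul_of_one_le_right hslack_nonneg hone,
            le_mul_of_one_le_left (by linarith) hC', le_mul_of_one_le_right hN_nonneg hone]
      _ = C' * (lossConst I.Bxi C cν cB cN cN' * Λ) := by rw [lossConst]; ring
  exact hterms.trans (add_le_add_right (mul_le_mul_of_nonneg_right hfactor hx) ε)

theorem abs_mix_disparity_QHat_le (hc : I.Calibrated ε φ cν cB cN cN' C' C'')
    (h : I.SampledFrom P μ ℱ ω s) (hs : I.IsGood P μ C φ (δ / 8) Qs s) (hC : 0 ≤ C)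
    (hδ0 : 0 < δ) (hδ1 : δ ≤ 1) (hcount : ∀ a, I.β a ≠ 0 → 0 < groupCount (I.S a) s)
    (hβ : ∃ a, I.β a ≠ 0) {η : ℝ} {best : (Fin 3 → ℝ) → ℱ} (hbest : I.IsBestH ℱ best) {t : ℕ}
    (hgap : I.gap η best t ≤ I.nu) {Q : PMF ℱ} (hQ : I.costHatQ Q ≤ I.epsHat) :
    |mix (I.QHat η best t) fun f => disparity P μ I.g I.S I.β f| + (n : ℝ) ^ (-φ) ≤
      |mix Q fun f => disparity P μ I.g I.S I.β f| +
        dispConst I.Bxi C ω cν cB cN cN' * (logFactor n δ *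
          ((groupCount (I.S 0) s : ℝ) ^ (-φ) + (groupCount (I.S 1) s : ℝ) ^ (-φ))) := by
  set Y := (groupCount (I.S 0) s : ℝ) ^ (-φ) + (groupCount (I.S 1) s : ℝ) ^ (-φ)
  have hxY : (n : ℝ) ^ (-φ) ≤ logFactor n δ * Y := by
    have hnonneg (a : Fin 2) : 0 ≤ (groupCount (I.S a) s : ℝ) ^ (-φ) := by positivity
    obtain ⟨a, ha⟩ := hβ
    have hle : (groupCount (I.S a) s : ℝ) ^ (-φ) ≤ Y := by
      fin_cases a
      exacts [le_add_of_nonneg_right (hnonneg 1), le_add_of_nonneg_left (hnonneg 0)]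
    exact ((rpow_neg_le_groupCount_rpow_neg hc.phi_pos.le (hcount a ha)).trans hle).trans
      (le_mul_of_one_le_left (add_nonneg (hnonneg 0) (hnonneg 1)) (one_le_logFactor hδ0 hδ1))
  have hslack_nonneg : 0 ≤ (I.Bxi + 2 * cν) / cB :=
    div_nonneg (by linarith [hc.Bxi_pos, hc.cnu_pos]) hc.cB_pos.le
  have hscaled := mul_le_mul_of_nonneg_left hxY
    (add_nonneg (add_nonneg zero_le_one (mul_nonneg zero_le_two hc.cnu_pos.le)) hslack_nonneg)
  have herror := hc.sum_group_error_le hC h.admissible.omega_pos h.admissible.abs_beta_le hδ0 hδ1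
    hcount
  have hdisp := h.abs_mix_disparity_QHat_le hs hcount hbest hc.Blam_pos hgap hQ
  have hslack := hc.constraint_slack_le
  rw [dispConst]
  linarith [hc.nu_eq]

theorem output_nearOptimal (hc : I.Calibrated ε φ cν cB cN cN' C' C'')
    (h : I.SampledFrom P μ ℱ ω s) (hs : I.IsGood P μ C φ (δ / 8) Qs s) (hC : 0 ≤ C)
    (hδ0 : 0 < δ) (hδ1 : δ ≤ 1)
    (hslack : C'' + (n : ℝ) ^ φ / I.N + √(-Real.log (δ / 8) / 2) ≤ C')
    (hQs : ∀ Q' : PMF ℱ, mix Q' (fun f => lossMu P μ I.l f) ≤ ε →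
      mix Qs (fun f => lossMu P μ I.l f) ≤ ε ∧
        |mix Qs fun f => disparity P μ I.g I.S I.β f| ≤
          |mix Q' fun f => disparity P μ I.g I.S I.β f| + (n : ℝ) ^ (-φ))
    {K : ℝ} (hKl : lossConst I.Bxi C cν cB cN cN' ≤ K)
    (hKd : dispConst I.Bxi C ω cν cB cN cN' ≤ K) {η : ℝ} {best : (Fin 3 → ℝ) → ℱ}
    (hbest : I.IsBestH ℱ best) {t : ℕ} (ht : I.StopsAt η best t) :
    I.NearOptimal P μ ε φ C' (polylog K 1 n δ) s (I.output η best t) := by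
  have hcost (Q' : PMF ℱ) (hQ' : mix Q' (fun f => lossMu P μ I.l f) ≤ ε) :
      I.costHatQ Qs ≤ I.epsHat := hc.costHatQ_le_epsHat h hs hslack (hQs Q' hQ').1
  have hΛ := one_le_logFactor (n := n) hδ0 hδ1
  have hy (a : Fin 2) : 0 ≤ (groupCount (I.S a) s : ℝ) ^ (-φ) := by positivity
  have hC' := hc.one_le_C'
  rw [polylog_one]
  by_cases hout : I.costHatQ (I.QHat η best t) ≤ I.epsHat + (I.Bxi + 2 * I.nu) / I.Blam
  · refine Or.inl ⟨I.QHat η best t, if_pos hout, ?_, fun hcount Q' hQ' => ?_⟩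
    · refine (hc.mix_lossMu_le h hs hC hδ0 hδ1 hout).trans ?_
      gcongr
    · by_cases hβ : ∃ a, I.β a ≠ 0
      · linarith [hc.abs_mix_disparity_QHat_le h hs hC hδ0 hδ1 hcount hβ hbest ht.1
          (hcost Q' hQ'), (hQs Q' hQ').2, mul_le_mul_of_nonneg_right hKd (mul_nonneg
          (zero_le_one.trans hΛ) (add_nonneg (hy 0) (hy 1)))]
      · have hdisp (f : 𝒳 → ℝ) : disparity P μ I.g I.S I.β f = 0 := by
          simp [disparity, not_exists_not.1 hβ]
        have hK : 0 ≤ K * logFactor n δ := mul_nonneg ((lossConst_nonneg hc.Bxi_pos.le hC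
          hc.cnu_pos.le hc.cB_pos.le hc.cN_pos.le cN').trans hKl) (zero_le_one.trans hΛ)
        simp only [hdisp, mix_const, abs_zero, zero_add]
        exact add_nonneg (mul_nonneg hK (hy 0)) (mul_nonneg hK (hy 1))
  · refine Or.inr ⟨if_neg hout, fun ⟨Q', hQ'⟩ => hout ?_⟩
    exact (saddle_guarantee hbest hc.Blam_pos hc.Bxi_pos.le (fun f => h.regular.abs_dispHat_le f)
      (fun f => h.regular.abs_costHat_le f) ht.1 (hcost Q' hQ')).1

end AlgInput.Calibrated

/-! ### The algorithm on the modified training data -/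

theorem exists_sampleSize_slack_le {φ cN : ℝ} (hφ : 0 < φ) (hcN : 0 < cN) :
    ∃ n₀ : ℝ → ℝ → ℕ, ∀ δ C'' : ℝ, 0 < δ → ∀ n N : ℕ, 0 < n → n₀ δ C'' ≤ n →
      cN * (n : ℝ) ^ φ ≤ N →
      C'' + (n : ℝ) ^ φ / N + √(-Real.log (δ / 8) / 2) ≤ √(2 * Real.log (8 * N / δ)) := by
  have hthreshold (δ C'' : ℝ) : ∃ m : ℕ, 0 < δ → ∀ n ≥ m,
      C'' + 1 / cN + √(-Real.log (δ / 8) / 2) ≤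
        √(2 * Real.log (8 * (cN * (n : ℝ) ^ φ) / δ)) := by
    by_cases hδ : 0 < δ
    · obtain ⟨m, hm⟩ := exists_threshold hφ hcN hδ (C'' + 1 / cN + √(-Real.log (δ / 8) / 2))
      exact ⟨m, fun _ => hm⟩
    · exact ⟨0, fun h => absurd h hδ⟩
  choose n₀ hn₀ using hthreshold
  refine ⟨n₀, fun δ C'' hδ n N hn hle hN => ?_⟩
  have hnφ : 0 < cN * (n : ℝ) ^ φ := mul_pos hcN (Real.rpow_pos_of_pos (Nat.cast_pos.2 hn) _)
  have hratio : (n : ℝ) ^ φ / N ≤ 1 / cN := by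
    rw [div_le_div_iff₀ (hnφ.trans_le hN) hcN, one_mul, mul_comm]
    exact hN
  have hmono : √(2 * Real.log (8 * (cN * (n : ℝ) ^ φ) / δ)) ≤ √(2 * Real.log (8 * N / δ)) := by
    gcongr
  linarith [hn₀ δ C'' hδ n hle]

section SelectiveInput

variable {𝒳 : Type*} {n N : ℕ} {μ : 𝒳 → ℝ} {ℱ : Set (𝒳 → ℝ)} {l : ℝ → ℝ → ℝ}
  {S : Fin 2 → Set (Fin 2)} {g : 𝒳 → ℝ → ℝ} {β : Fin 2 → ℝ} {cover : Finset ℝ}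
  {ε Bxi C φ ω δ cν cB cN cN' C' C'' : ℝ}

theorem calibrated_selectiveInput (hε : 0 ≤ ε) (hBxi : 0 < Bxi) (hφ0 : 0 < φ) (hφ : φ ≤ 1 / 2)
    (hcν : 0 < cν) (hcB : 0 < cB) (hcN : 0 < cN) (hn : 0 < n) (hN : cN * (n : ℝ) ^ φ ≤ N)
    (hN' : (N : ℝ) ≤ cN' * (n : ℝ) ^ φ) (hC' : 1 ≤ C') (hC'' : 0 ≤ C'') (s : Fin n → Obs 𝒳) :
    (selectiveInput μ β S g l ε Bxi φ cν cB C' C'' N cover s).Calibrated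
      ε φ cν cB cN cN' C' C'' :=
  ⟨hn, hε, hφ0, hφ, hcν, hcB, hcN, hBxi, rfl, rfl, hN, hN', rfl, hC', hC''⟩

variable [MeasurableSpace 𝒳] {P : Measure (Obs 𝒳)}

theorem Admissible.sampledFrom_selectiveInput (h : Admissible P μ ℱ l S g β Bxi ω) (hN : 0 < N)
    (hcover : ∀ t ∈ cover, t ∈ Set.Icc (0 : ℝ) 1)
    (hcovered : ∀ x, ∃ t ∈ cover, |μ x - t| ≤ 1 / (2 * (N : ℝ))) (s : Fin n → Obs 𝒳) :
    (selectiveInput μ β S g l ε Bxi φ cν cB C' C'' N cover s).SampledFrom P μ ℱ ω s where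
  regular :=
    { N_pos := hN
      loss := h.loss
      outcome _ := h.reg_mem _
      cover_mem := hcover
      covered _ := hcovered _
      weight x m hm := (h.weight_mem x m hm).1
      disp := h.disp_bound
      pred := h.pred_mem }
  admissible := h
  data_eq := rfl

theorem exists_event_output_nearOptimal [IsProbabilityMeasure P] (hℱ : PointwiseMeasurable ℱ)
    (hC : 0 ≤ C)
    (hR : ∀ m : ℕ, 1 ≤ m → rademacher (thrClass ℱ) m ≤ C * (m : ℝ) ^ (-φ))
    (hδ0 : 0 < δ) (hδ1 : δ ≤ 1) {I : (Fin n → Obs 𝒳) → AlgInput 𝒳 n}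
    (hI : I = selectiveInput μ β S g l ε Bxi φ cν cB C' C'' N cover)
    (hcal : ∀ s, (I s).Calibrated ε φ cν cB cN cN' C' C'')
    (hsampled : ∀ s, (I s).SampledFrom P μ ℱ ω s)
    (hslack : C'' + (n : ℝ) ^ φ / N + √(-Real.log (δ / 8) / 2) ≤ C') {K : ℝ}
    (hKl : lossConst Bxi C cν cB cN cN' ≤ K) (hKd : dispConst Bxi C ω cν cB cN cN' ≤ K) :
    ∃ G : Set (Fin n → Obs 𝒳), MeasurableSet G ∧ 1 - δ ≤ (Measure.pi fun _ : Fin n => P).real G ∧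
      ∀ s ∈ G, ∀ best : (Fin 3 → ℝ) → ℱ, (I s).IsBestH ℱ best →
        ∀ t : ℕ, (I s).StopsAt ((I s).learningRate ℱ) best t →
          (I s).NearOptimal P μ ε φ C' (polylog K 1 n δ) s
            ((I s).output ((I s).learningRate ℱ) best t) := by
  subst hI
  obtain ⟨s₀⟩ := nonempty_of_isProbabilityMeasure (Measure.pi fun _ : Fin n => P)
  rcases ℱ.eq_empty_or_nonempty with hempty | hnonempty
  · exact ⟨Set.univ, .univ, by simpa using hδ0.le,
      fun s _ best => (Set.eq_empty_iff_forall_notMem.1 hempty _ (best 0).2).elim⟩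
  · obtain ⟨Qs, hQs⟩ := exists_mix_le_abs_mix_le hnonempty (fun f : ℱ => lossMu P μ l f)
      (fun f => disparity P μ g S β f) ε ((hcal s₀).rpow_pos (-φ))
    obtain ⟨G, hGm, hGP, hG⟩ := exists_measurableSet_one_sub_le_of_measure_le hδ0.le <|
      ((hsampled s₀).admissible.measure_not_goodSample_le hℱ (hcal s₀).phi_le hR
        (hcal s₀).n_pos (hcal s₀).N_pos (δ := δ / 8) (by linarith) (by linarith) Qs).trans
        (ENNReal.ofReal_le_ofReal (show _ ≤ δ by linarith))
    exact ⟨G, hGm, hGP, fun s hs best hbest t ht => (hcal s).output_nearOptimal (hsampled s)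
      (hG s hs) hC hδ0 hδ1 hslack hQs hKl hKd hbest ht⟩

end SelectiveInput

section MixedPredictions

variable {𝒳 : Type*} [MeasurableSpace 𝒳] {P : Measure (Obs 𝒳)} [IsProbabilityMeasure P]
  {μ : 𝒳 → ℝ} {ℱ : Set (𝒳 → ℝ)} {S : Fin 2 → Set (Fin 2)} {β : Fin 2 → ℝ}

theorem mix_disparity_outcome (hμ : IsRegression P μ)
    (hℱ : ∀ f ∈ ℱ, Measurable f ∧ ∀ x, f x ∈ Set.Icc (0 : ℝ) 1)
    (hY : ∀ᵐ o ∂P, outY o = 0 ∨ outY o = 1) (hind : CondIndepGivenX P attrA outY) (Q : PMF ℱ) :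
    mix Q (fun f => disparity P μ (fun _ m => m) S β f) =
        mix Q (fun f => disparityOn P (fun a => {o | outY o = 1 ∧ attrA o ∈ S a}) β f) ∧
      mix Q (fun f => disparity P μ (fun _ m => 1 - m) S β f) =
        mix Q (fun f => disparityOn P (fun a => {o | outY o = 0 ∧ attrA o ∈ S a}) β f) :=
  ⟨congrArg (mix Q) <| funext fun f => disparity_eq_disparityOn_outcome hind hμ.measurable
      (fun x => abs_le_one_of_mem_Icc (hμ.mem_Icc x)) (condExp_outcome_one hμ hY)
      (hℱ f f.2).1 fun x => abs_le_one_of_mem_Icc ((hℱ f f.2).2 x),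
    congrArg (mix Q) <| funext fun f => disparity_eq_disparityOn_outcome hind
      (hμ.measurable.const_sub 1)
      (fun x => abs_le_one_of_mem_Icc ⟨sub_nonneg.2 (hμ.mem_Icc x).2,
        sub_le_self 1 (hμ.mem_Icc x).1⟩) (condExp_outcome_zero hμ hY)
      (hℱ f f.2).1 fun x => abs_le_one_of_mem_Icc ((hℱ f f.2).2 x)⟩

theorem mix_lossMu_le_mix_loss {l : ℝ → ℝ → ℝ} (hμ : IsRegression P μ)
    (hℱ : ∀ f ∈ ℱ, Measurable f ∧ ∀ x, f x ∈ Set.Icc (0 : ℝ) 1)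
    (hY : ∀ᵐ o ∂P, outY o ∈ Set.Icc (0 : ℝ) 1) (hl : UnitLipschitzLoss l)
    (hconv : ∀ u ∈ Set.Icc (0 : ℝ) 1, ConvexOn ℝ (Set.Icc (0 : ℝ) 1) fun y => l y u)
    (Q : PMF ℱ) : mix Q (fun f => lossMu P μ l f) ≤ mix Q (fun f => loss P l f) :=
  mix_mono Q
    (fun f => hl.abs_integral_le (ae_of_all P fun _ => hμ.mem_Icc _) fun _ => (hℱ f f.2).2 _)
    (fun f => hl.abs_integral_le hY fun _ => (hℱ f f.2).2 _)
    fun f => lossMu_le_loss hμ hY hl hconv (hℱ f f.2).1 (hℱ f f.2).2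

end MixedPredictions

end FairRashomon

end

open FairRashomon in
theorem theorem4_general
    (ε : ℝ) (hε : 0 ≤ ε) (β : Fin 2 → ℝ) (Bxi : ℝ) (hBxi0 : 0 < Bxi)
    (hBxi : ∀ u ∈ Set.Icc (0 : ℝ) 1, ∀ v ∈ Set.Icc (0 : ℝ) 1, |β 0 * u + β 1 * v| ≤ Bxi)
    (C φ : ℝ) (hC : 0 ≤ C) (hφ0 : 0 < φ) (hφ : φ ≤ 1 / 2) (ω : ℝ) (hω : 0 < ω)
    (cν cB cN cN' : ℝ) (hcν : 0 < cν) (hcB : 0 < cB) (hcN : 0 < cN) :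
    ∃ (K : ℝ) (p : ℕ) (n₀ : ℝ → ℝ → ℕ),
    ∀ {𝒳 : Type*} [MeasurableSpace 𝒳]
    (P : Measure (Obs 𝒳)) [IsProbabilityMeasure P]
    (hY : ∀ᵐ o ∂P, outY o ∈ Set.Icc (0 : ℝ) 1)
    (μ : 𝒳 → ℝ) (hμ : IsRegression P μ)
    (ℱ : Set (𝒳 → ℝ)) (hℱ : ∀ f ∈ ℱ, Measurable f ∧ ∀ x, f x ∈ Set.Icc (0 : ℝ) 1)
    (hℱm : PointwiseMeasurable ℱ)
    (hR : ∀ m : ℕ, 1 ≤ m → rademacher (thrClass ℱ) m ≤ C * (m : ℝ) ^ (-φ))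
    (l : ℝ → ℝ → ℝ)
    (hl01 : ∀ y ∈ Set.Icc (0 : ℝ) 1, ∀ u ∈ Set.Icc (0 : ℝ) 1, l y u ∈ Set.Icc (0 : ℝ) 1)
    (hlLip : ∀ y ∈ Set.Icc (0 : ℝ) 1, ∀ y' ∈ Set.Icc (0 : ℝ) 1,
      ∀ u ∈ Set.Icc (0 : ℝ) 1, ∀ u' ∈ Set.Icc (0 : ℝ) 1,
        |l y u - l y' u'| ≤ |y - y'| + |u - u'|)
    (S : Fin 2 → Set (Fin 2)) (g : 𝒳 → ℝ → ℝ) (hgm : Measurable (Function.uncurry g))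
    (hg01 : ∀ x, ∀ m ∈ Set.Icc (0 : ℝ) 1, g x m ∈ Set.Icc (0 : ℝ) 1)
    (hgpos : ∀ a, β a ≠ 0 →
      ω ≤ ∫ o, g (featX o) (μ (featX o)) ∂P[|attrA ⁻¹' S a]),
    (∀ (n : ℕ), 1 ≤ n → ∀ (δ : ℝ), 0 < δ → δ < 1 →
      ∀ (N : ℕ), cN * (n : ℝ) ^ φ ≤ N → (N : ℝ) ≤ cN' * (n : ℝ) ^ φ →
      ∀ (cover : Finset ℝ), (∀ t ∈ cover, t ∈ Set.Icc (0 : ℝ) 1) →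
        (∀ x, ∃ t ∈ cover, |μ x - t| ≤ 1 / (2 * (N : ℝ))) →
      ∀ (C' C'' : ℝ), 1 + √(2 * Real.log (8 * N / δ)) ≤ C' → 0 ≤ C'' →
      let I : (Fin n → Obs 𝒳) → AlgInput 𝒳 n :=
        selectiveInput μ β S g l ε Bxi φ cν cB C' C'' N cover
      (∀ (s : Fin n → Obs 𝒳) (best : (Fin 3 → ℝ) → ℱ), (I s).IsBestH ℱ best →
        ∃ t : ℕ, (I s).StopsAt ((I s).learningRate ℱ) best t ∧
          ((t + 1 : ℕ) : ℝ) ≤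
            K * (1 + C' * (n : ℝ) ^ (-φ) + C'' * (n : ℝ) ^ (-(1 / 2) : ℝ)) ^ 2 *
              (n : ℝ) ^ (4 * φ)) ∧
      (n₀ δ C'' ≤ n ∨ C'' + (n : ℝ) ^ φ / N + √(-Real.log (δ / 8) / 2) ≤ C' →
        ∃ G : Set (Fin n → Obs 𝒳), MeasurableSet G ∧
          1 - δ ≤ (Measure.pi fun _ : Fin n => P).real G ∧
          ∀ s ∈ G, ∀ best : (Fin 3 → ℝ) → ℱ, (I s).IsBestH ℱ best →
          ∀ t : ℕ, (I s).StopsAt ((I s).learningRate ℱ) best t →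
            (I s).NearOptimal P μ ε φ C' (polylog K p n δ) s
              ((I s).output ((I s).learningRate ℱ) best t))) ∧
    (∀ Q : PMF ℱ, mix Q (fun f => disparity P μ (fun _ _ => 1) S β f) =
      mix Q (fun f => disparityOn P (fun a => {o | attrA o ∈ S a}) β f)) ∧
    ((∀ᵐ o ∂P, outY o = 0 ∨ outY o = 1) → CondIndepGivenX P attrA outY →
      ∀ Q : PMF ℱ,
        mix Q (fun f => disparity P μ (fun _ m => m) S β f) =
          mix Q (fun f => disparityOn P (fun a => {o | outY o = 1 ∧ attrA o ∈ S a}) β f) ∧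
        mix Q (fun f => disparity P μ (fun _ m => 1 - m) S β f) =
          mix Q (fun f => disparityOn P (fun a => {o | outY o = 0 ∧ attrA o ∈ S a}) β f)) ∧
    ((∀ u ∈ Set.Icc (0 : ℝ) 1, ConvexOn ℝ (Set.Icc (0 : ℝ) 1) (fun y => l y u)) →
      ∀ Q : PMF ℱ, mix Q (fun f => lossMu P μ l f) ≤ mix Q (fun f => loss P l f)) := by
  obtain ⟨n₀, hn₀⟩ := exists_sampleSize_slack_le hφ0 hcN
  refine ⟨rateConst ε Bxi C ω cν cB cN cN', 1, n₀, fun P _ hY μ hμ ℱ hℱ hℱm hR l hl01 hlLip S g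
    hgm hg01 hgpos => ⟨fun n hn δ hδ0 hδ1 N hN hN' cover hcover hcovered C' C'' hC' hC'' => ?_,
      fun Q => congrArg (mix Q) (funext fun f => disparity_one_eq_disparityOn),
      fun hbin hind Q => mix_disparity_outcome hμ hℱ hbin hind Q,
      fun hconv Q => mix_lossMu_le_mix_loss hμ hℱ hY ⟨hl01, hlLip⟩ hconv Q⟩⟩
  intro I
  have hsqrt := Real.sqrt_nonneg (2 * Real.log (8 * N / δ))
  have hcal (s : Fin n → Obs _) : (I s).Calibrated ε φ cν cB cN cN' C' C'' :=
    calibrated_selectiveInput hε hBxi0 hφ0 hφ hcν hcB hcN hn hN hN' (by linarith) hC'' s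
  have hadm : Admissible P μ ℱ l S g β Bxi ω := ⟨hμ.measurable, hμ.mem_Icc,
    fun f hf => (hℱ f hf).1, fun f hf => (hℱ f hf).2, ⟨hl01, hlLip⟩, hgm, hg01, hω, hgpos, hBxi0,
    hBxi⟩
  have hsampled (s : Fin n → Obs _) : (I s).SampledFrom P μ ℱ ω s :=
    hadm.sampledFrom_selectiveInput (hcal s).N_pos hcover hcovered s
  refine ⟨fun s best hbest => ?_, fun hlarge => ?_⟩
  · obtain ⟨t, ht, hle⟩ := (hcal s).exists_stopsAt_le (hsampled s).regular hbest
    exact ⟨t, ht, hle.trans (by gcongr; exact le_max_left _ _)⟩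
  · have hslack : C'' + (n : ℝ) ^ φ / N + √(-Real.log (δ / 8) / 2) ≤ C' :=
      hlarge.elim (fun h => (hn₀ δ C'' hδ0 n N hn h hN).trans (by linarith)) id
    exact exists_event_output_nearOptimal hℱm hC hR hδ0 hδ1.le rfl hcal hsampled hslack
      ((le_max_left _ _).trans (le_max_right _ _)) ((le_max_right _ _).trans (le_max_right _ _))

open FairRashomon in
theorem theorem4
    -- loss tolerance, disparity parameters, and a bound `Bxi` on the absolute disparity
    (ε : ℝ) (hε : 0 ≤ ε) (β : Fin 2 → ℝ) (Bxi : ℝ) (hBxi0 : 0 < Bxi)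
    (hBxi : ∀ u ∈ Set.Icc (0 : ℝ) 1, ∀ v ∈ Set.Icc (0 : ℝ) 1, |β 0 * u + β 1 * v| ≤ Bxi)
    -- complexity constants, lower bound on the mean weights, constants of proportionality
    (C φ : ℝ) (hC : 0 < C) (hφ0 : 0 < φ) (hφ : φ ≤ 1 / 2) (ω : ℝ) (hω : 0 < ω)
    (cν cB cN cN' : ℝ) (hcν : 0 < cν) (hcB : 0 < cB) (hcN : 0 < cN) (hcN' : cN ≤ cN') :
    ∃ (K : ℝ) (p : ℕ) (n₀ : ℝ → ℝ → ℕ),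
    ∀ {𝒳 : Type*} [MeasurableSpace 𝒳]
    -- the population
    (P : Measure (Obs 𝒳)) [IsProbabilityMeasure P]
    (_hY : ∀ᵐ o ∂P, outY o ∈ Set.Icc (0 : ℝ) 1)
    (_hsel : SelectionOnObservables P) (_hpos : Positivity P)
    (μ : 𝒳 → ℝ) (_hμ : IsRegression P μ)
    -- the model class
    (ℱ : Set (𝒳 → ℝ)) (_hℱ : ∀ f ∈ ℱ, Measurable f ∧ ∀ x, f x ∈ Set.Icc (0 : ℝ) 1)
    (_hℱm : PointwiseMeasurable ℱ)
    (_hR : ∀ m : ℕ, 1 ≤ m → rademacher (thrClass ℱ) m ≤ C * (m : ℝ) ^ (-φ))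
    -- the loss
    (l : ℝ → ℝ → ℝ)
    (_hl01 : ∀ y ∈ Set.Icc (0 : ℝ) 1, ∀ u ∈ Set.Icc (0 : ℝ) 1, l y u ∈ Set.Icc (0 : ℝ) 1)
    (_hlLip : ∀ y ∈ Set.Icc (0 : ℝ) 1, ∀ y' ∈ Set.Icc (0 : ℝ) 1,
      ∀ u ∈ Set.Icc (0 : ℝ) 1, ∀ u' ∈ Set.Icc (0 : ℝ) 1,
        |l y u - l y' u'| ≤ |y - y'| + |u - u'|)
    -- groups and weights of the disparity measure
    (S : Fin 2 → Set (Fin 2)) (g : 𝒳 → ℝ → ℝ) (_hgm : Measurable (Function.uncurry g))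
    (_hg01 : ∀ x, ∀ m ∈ Set.Icc (0 : ℝ) 1, g x m ∈ Set.Icc (0 : ℝ) 1)
    (_hgpos : ∀ a, β a ≠ 0 →
      ω ≤ ∫ o, g (featX o) (μ (featX o)) ∂P[|attrA ⁻¹' S a]),
    -- the error guarantees
    (∀ (n : ℕ), 1 ≤ n → ∀ (δ : ℝ), 0 < δ → δ < 1 →
      ∀ (N : ℕ), cN * (n : ℝ) ^ φ ≤ N → (N : ℝ) ≤ cN' * (n : ℝ) ^ φ →
      ∀ (cover : Finset ℝ), (∀ t ∈ cover, t ∈ Set.Icc (0 : ℝ) 1) →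
        (∀ x, ∃ t ∈ cover, |μ x - t| ≤ 1 / (2 * (N : ℝ))) →
      ∀ (C' C'' : ℝ), 2 * C + 2 + √(2 * Real.log (8 * N / δ)) ≤ C' →
        √(-Real.log (δ / 8) / 2) ≤ C'' →
      let I : (Fin n → Obs 𝒳) → AlgInput 𝒳 n :=
        selectiveInput μ β S g l ε Bxi φ cν cB C' C'' N cover
      -- iteration bound, for every sample and every best-response oracle
      (∀ (s : Fin n → Obs 𝒳) (best : (Fin 3 → ℝ) → ℱ), (I s).IsBestH ℱ best →
        ∃ t : ℕ, (I s).StopsAt ((I s).learningRate ℱ) best t ∧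
          ((t + 1 : ℕ) : ℝ) ≤
            K * (1 + C' * (n : ℝ) ^ (-φ) + C'' * (n : ℝ) ^ (-(1 / 2) : ℝ)) ^ 2 *
              (n : ℝ) ^ (4 * φ)) ∧
      -- quality of the returned solution, with probability at least `1 - δ`
      (n₀ δ C'' ≤ n ∨ C'' + (n : ℝ) ^ φ / N + √(-Real.log (δ / 8) / 2) ≤ C' →
        ∃ G : Set (Fin n → Obs 𝒳), MeasurableSet G ∧
          1 - δ ≤ (Measure.pi fun _ : Fin n => P).real G ∧
          ∀ s ∈ G, ∀ best : (Fin 3 → ℝ) → ℱ, (I s).IsBestH ℱ best →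
          ∀ t : ℕ, (I s).StopsAt ((I s).learningRate ℱ) best t →
            (∃ Q : PMF ℱ, (I s).output ((I s).learningRate ℱ) best t = some Q ∧
              mix Q (fun f => lossMu P μ l f) ≤
                ε + C' * polylog K p n δ * (n : ℝ) ^ (-φ) ∧
              ((∀ a, β a ≠ 0 → 0 < groupCount (S a) s) →
                ∀ Q' : PMF ℱ, mix Q' (fun f => lossMu P μ l f) ≤ ε →
                  |mix Q (fun f => disparity P μ g S β f)| ≤
                    |mix Q' (fun f => disparity P μ g S β f)|
                      + polylog K p n δ * (groupCount (S 0) s : ℝ) ^ (-φ)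
                      + polylog K p n δ * (groupCount (S 1) s : ℝ) ^ (-φ))) ∨
            ((I s).output ((I s).learningRate ℱ) best t = none ∧
              ¬ ∃ Q' : PMF ℱ, mix Q' (fun f => lossMu P μ l f) ≤ ε))) ∧
    -- the disparity with weight `1`, `μ` or `1 - μ` is the one that conditions on the events
    -- `{A ∈ Sₐ}`, `{Y* = 1, A ∈ Sₐ}` or `{Y* = 0, A ∈ Sₐ}`
    (∀ Q : PMF ℱ, mix Q (fun f => disparity P μ (fun _ _ => 1) S β f) =
      mix Q (fun f => disparityOn P (fun a => {o | attrA o ∈ S a}) β f)) ∧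
    ((∀ᵐ o ∂P, outY o = 0 ∨ outY o = 1) → CondIndepGivenX P attrA outY →
      ∀ Q : PMF ℱ,
        mix Q (fun f => disparity P μ (fun _ m => m) S β f) =
          mix Q (fun f => disparityOn P (fun a => {o | outY o = 1 ∧ attrA o ∈ S a}) β f) ∧
        mix Q (fun f => disparity P μ (fun _ m => 1 - m) S β f) =
          mix Q (fun f => disparityOn P (fun a => {o | outY o = 0 ∧ attrA o ∈ S a}) β f)) ∧
    -- for a loss convex in the outcome, feasibility for the true loss implies feasibility
    -- for `loss_μ`
    ((∀ u ∈ Set.Icc (0 : ℝ) 1, ConvexOn ℝ (Set.Icc (0 : ℝ) 1) (fun y => l y u)) →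
      ∀ Q : PMF ℱ, mix Q (fun f => lossMu P μ l f) ≤ mix Q (fun f => loss P l f)) := by
  obtain ⟨K, p, n₀, h⟩ :=
    theorem4_general ε hε β Bxi hBxi0 hBxi C φ hC.le hφ0 hφ ω hω cν cB cN cN' hcν hcB hcN
  refine ⟨K, p, n₀, fun P _ hY _ _ μ hμ ℱ hℱ hℱm hR l hl01 hlLip S g hgm hg01 hgpos => ?_⟩
  refine (h P hY μ hμ ℱ hℱ hℱm hR l hl01 hlLip S g hgm hg01 hgpos).imp_left ?_
  exact fun h n hn δ hδ0 hδ1 N hN hN' cover hcover hcovered C' C'' hC' hC'' =>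
    h n hn δ hδ0 hδ1 N hN hN' cover hcover hcovered C' C'' (by linarith)
      ((Real.sqrt_nonneg _).trans hC'')
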